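/- Work either with smooth real manifolds and smooth maps, or with complex manifolds and holomorphic maps (finite-dimensional, Hausdorff, second countable, of pure dimension). A Lie groupoid $\Gamma\rightrightarrows M$ has source $s$, target $t$, both submersions, and a product $\gamma\delta$ defined when $t(\gamma)=s(\delta)$. A right $\Gamma$-module is a manifold $Z$ with a smooth map $\phi:Z\to M$ and a smooth action $z\cdot\gamma$, defined when $\phi(z)=s(\gamma)$, with $\phi(z\cdot\gamma)=t(\gamma)$; left modules are defined symmetrically ($\gamma\cdot z$ is defined when $t(\gamma)=\phi(z)$, and $\phi(\gamma\cdot z)=s(\gamma)$). A Morita equivalence $\mathcal X$ between $\Gamma\rightrightarrows M$ and $\Gamma'\rightrightarrows M'$ is a manifold $X$ with surjective submersions $p:X\to M$ and $p':X\to M'$, a left $\Gamma$-action along $p$ and a right $\Gamma'$-action along $p'$ that commute, are proper and free, and such that $\Gamma$ preserves the fibres of $p'$ and acts transitively on each of them, and $\Gamma'$ preserves the fibres of $p$ and acts transitively on each of them. For $S\subset M$ put $\underline{\mathcal X}(S)=p'(p^{-1}(S))$. For a right $\Gamma$-module $(Z,\phi)$ let $\underline{\mathcal X}(Z,\phi)$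 be the right $\Gamma'$-module $$(Z\times_{\phi,M,p}X)/\big((z,x)\sim(z\cdot\gamma^{-1},\gamma\cdot x)\big),\qquad [z,x]\mapsto p'(x),\qquad [z,x]\cdot\gamma'=[z,x\cdot\gamma'],$$ with the manifold structure for which the quotient map is a submersion. A subset $\mathcal S\subset M$ is $\Gamma$-stable if $t(\gamma)\in \mathcal S\Leftrightarrow s(\gamma)\in \mathcal S$ for all $\gamma\in\Gamma$. Let $\mathcal S$ be an embedded submanifold of $M$. A resolution of $\overline{\mathcal S}$ is a manifold $Z$ with a smooth (holomorphic) map $\phi:Z\to M$ such that $\phi^{-1}(\mathcal S)$ is dense in $Z$ and $\phi$ restricts to a diffeomorphism (biholomorphism) $\phi^{-1}(\mathcal S)\to\mathcal S$. It is surjective if $\phi(Z)=\overline{\mathcal S}$, and proper if $\phi$ is proper. If $\mathcal S$ is $\Gamma$-stable, a $\Gamma$-resolution of $\overline{\mathcal S}$ is a resolution $(Z,\phi)$ that admits a (necessarily unique) structure of right $\Gamma$-module. Resolutions $(Z_1,\phi_1)$ and $(Z_2,\phi_2)$ are identified when there is a diffeomorphism (biholomorphism) $\Phi:Z_1\to Z_2$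 with $\phi_2\circ\Phi=\phi_1$. **Proposition.** Let $\mathcal X$ be a Morita equivalence between Lie groupoids $\Gamma\rightrightarrows M$ and $\Gamma'\rightrightarrows M'$, and let $\mathcal S$ be a $\Gamma$-stable embedded submanifold of $M$. Then $\mathcal S'=\underline{\mathcal X}(\mathcal S)$ is a $\Gamma'$-stable embedded submanifold of $M'$; whenever a right $\Gamma'$-module $(Z',\phi')$ is (isomorphic to) $\underline{\mathcal X}(Z,\phi)$, the pair $(Z,\phi)$ is a resolution of $\overline{\mathcal S}$ if and only if $(Z',\phi')$ is a resolution of $\overline{\mathcal S'}$; and $(Z,\phi)\mapsto\underline{\mathcal X}(Z,\phi)$ is a one-to-one correspondence between isomorphism classes of $\Gamma$-resolutions of $\overline{\mathcal S}$ and isomorphism classes of $\Gamma'$-resolutions of $\overline{\mathcal S'}$. Under this correspondence, surjective resolutions correspond exactly to surjective ones and proper resolutions exactly to proper ones. -/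

import Mathlib

open scoped Manifold ContDiff

universe u v

/-- A finite-dimensional manifold over `𝕜` (Hausdorff, second countable, without boundary, of pure
dimension `dim`). For `𝕜 = ℝ` this is a smooth manifold, for `𝕜 = ℂ` a complex manifold: over `ℂ`
a map is `C^∞` in the sense of `ℂ`-differentiability if and only if it is holomorphic. -/
structure Mfd (𝕜 : Type v) [RCLike 𝕜] where
  carrier : Type u
  [top : TopologicalSpace carrier]
  dim : ℕ
  [charted : ChartedSpace (EuclideanSpace 𝕜 (Fin dim)) carrier]
  [isManifold : IsManifold 𝓘(𝕜, EuclideanSpace 𝕜 (Fin dim)) ∞ carrier]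
  [t2 : T2Space carrier]
  [secondCountable : SecondCountableTopology carrier]

namespace Mfd

variable {𝕜 : Type v} [RCLike 𝕜]

instance : CoeSort (Mfd.{u, v} 𝕜) (Type u) := ⟨Mfd.carrier⟩

attribute [instance] Mfd.top Mfd.charted Mfd.isManifold Mfd.t2 Mfd.secondCountable

/-- The model with corners (the identity of `𝕜^dim`) of a manifold. -/
noncomputable abbrev model (M : Mfd.{u, v} 𝕜) :
    ModelWithCorners 𝕜 (EuclideanSpace 𝕜 (Fin M.dim)) (EuclideanSpace 𝕜 (Fin M.dim)) :=
  𝓘(𝕜, EuclideanSpace 𝕜 (Fin M.dim))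

end Mfd

section Submanifolds

variable {𝕜 : Type v} [RCLike 𝕜] {E : Type*} [NormedAddCommGroup E] [NormedSpace 𝕜 E]
  {H : Type*} [TopologicalSpace H] {M : Type*} [TopologicalSpace M] [ChartedSpace H M]

/-- The given atlas on the subset `S` of `M` (with the subspace topology) makes `S` an embedded
submanifold of `M` of dimension `d`. There is at most one such smooth structure on `S`. -/
def IsSubmanifoldStructure (I : ModelWithCorners 𝕜 E H) (S : Set M) (d : ℕ)
    [ChartedSpace (EuclideanSpace 𝕜 (Fin d)) S] : Prop :=
  IsManifold 𝓘(𝕜, EuclideanSpace 𝕜 (Fin d)) ∞ S ∧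
    Manifold.IsSmoothEmbedding 𝓘(𝕜, EuclideanSpace 𝕜 (Fin d)) I ∞ (Subtype.val : S → M)

/-- `S` is an embedded submanifold of `M`. -/
def IsEmbeddedSubmanifold (I : ModelWithCorners 𝕜 E H) (S : Set M) : Prop :=
  ∃ (d : ℕ) (_ : ChartedSpace (EuclideanSpace 𝕜 (Fin d)) S), IsSubmanifoldStructure I S d

/-- `S` is an embedded submanifold of `M`, and `q : S → N` is a submersion. -/
def IsSubmersionOnSubmanifold (I : ModelWithCorners 𝕜 E H) (S : Set M)
    {N : Mfd.{u, v} 𝕜} (q : S → N) : Prop :=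
  ∃ (d : ℕ) (_ : ChartedSpace (EuclideanSpace 𝕜 (Fin d)) S), IsSubmanifoldStructure I S d ∧
    Manifold.IsSubmersion 𝓘(𝕜, EuclideanSpace 𝕜 (Fin d)) N.model ∞ q

end Submanifolds

/-- A Lie groupoid `Arr ⇉ Obj`. The product `mul γ δ` is meaningful when `t γ = s δ` only
(its values elsewhere play no role), and then goes from `s γ` to `t δ`.

Here and below, smoothness of a partially defined operation is smoothness (`ContMDiffOn`) on its
domain, a closed embedded submanifold of a product because `s` and `t` are submersions; there
`ContMDiffOn` agrees with smoothness for the submanifold structure. -/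
structure LieGroupoid (𝕜 : Type v) [RCLike 𝕜] where
  Obj : Mfd.{u, v} 𝕜
  Arr : Mfd.{u, v} 𝕜
  s : Arr → Obj
  t : Arr → Obj
  one : Obj → Arr
  mul : Arr → Arr → Arr
  inv : Arr → Arr
  isSubmersion_s : Manifold.IsSubmersion Arr.model Obj.model ∞ s
  isSubmersion_t : Manifold.IsSubmersion Arr.model Obj.model ∞ t
  contMDiff_one : ContMDiff Obj.model Arr.model ∞ one
  contMDiffOn_mul : ContMDiffOn (Arr.model.prod Arr.model) Arr.model ∞
    (fun a : Arr × Arr => mul a.1 a.2) {a | t a.1 = s a.2}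
  contMDiff_inv : ContMDiff Arr.model Arr.model ∞ inv
  s_one : ∀ m, s (one m) = m
  t_one : ∀ m, t (one m) = m
  s_mul : ∀ γ δ, t γ = s δ → s (mul γ δ) = s γ
  t_mul : ∀ γ δ, t γ = s δ → t (mul γ δ) = t δ
  mul_assoc : ∀ γ δ ε, t γ = s δ → t δ = s ε → mul (mul γ δ) ε = mul γ (mul δ ε)
  one_mul : ∀ γ, mul (one (s γ)) γ = γ
  mul_one : ∀ γ, mul γ (one (t γ)) = γ
  s_inv : ∀ γ, s (inv γ) = t γ
  t_inv : ∀ γ, t (inv γ) = s γ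
  mul_inv : ∀ γ, mul γ (inv γ) = one (s γ)
  inv_mul : ∀ γ, mul (inv γ) γ = one (t γ)

namespace LieGroupoid

variable {𝕜 : Type v} [RCLike 𝕜]

/-- `Γ`-stable subsets of the manifold of objects. -/
def IsStable (Γ : LieGroupoid.{u, v} 𝕜) (S : Set Γ.Obj) : Prop :=
  ∀ γ : Γ.Arr, Γ.t γ ∈ S ↔ Γ.s γ ∈ S

/-- A right action of `Γ` on `Z` along `φ : Z → Obj`: the point `z · γ` is defined when
`φ z = s γ`, and `φ (z · γ) = t γ`. -/
structure RightAction (Γ : LieGroupoid.{u, v} 𝕜) (Z : Mfd.{u, v} 𝕜) (φ : Z → Γ.Obj) where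
  act : Z → Γ.Arr → Z
  contMDiffOn_act : ContMDiffOn (Z.model.prod Γ.Arr.model) Z.model ∞
    (fun a : Z × Γ.Arr => act a.1 a.2) {a | φ a.1 = Γ.s a.2}
  map_act : ∀ z γ, φ z = Γ.s γ → φ (act z γ) = Γ.t γ
  act_one : ∀ z, act z (Γ.one (φ z)) = z
  act_mul : ∀ z γ δ, φ z = Γ.s γ → Γ.t γ = Γ.s δ → act z (Γ.mul γ δ) = act (act z γ) δ

/-- A left action of `Γ` on `Z` along `φ : Z → Obj`: the point `γ · z` is defined when
`t γ = φ z`, and `φ (γ · z) = s γ`. -/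
structure LeftAction (Γ : LieGroupoid.{u, v} 𝕜) (Z : Mfd.{u, v} 𝕜) (φ : Z → Γ.Obj) where
  act : Γ.Arr → Z → Z
  contMDiffOn_act : ContMDiffOn (Γ.Arr.model.prod Z.model) Z.model ∞
    (fun a : Γ.Arr × Z => act a.1 a.2) {a | Γ.t a.1 = φ a.2}
  map_act : ∀ γ z, Γ.t γ = φ z → φ (act γ z) = Γ.s γ
  one_act : ∀ z, act (Γ.one (φ z)) z = z
  mul_act : ∀ γ δ z, Γ.t γ = Γ.s δ → Γ.t δ = φ z → act (Γ.mul γ δ) z = act γ (act δ z)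

/-- A right `Γ`-module `(Z, φ)`. -/
structure RightModule (Γ : LieGroupoid.{u, v} 𝕜) where
  space : Mfd.{u, v} 𝕜
  map : space → Γ.Obj
  contMDiff_map : ContMDiff space.model Γ.Obj.model ∞ map
  action : RightAction Γ space map

/-- A Morita equivalence between `Γ` and `Γ'`: a manifold `X` with two surjective submersions
`p : X → M`, `p' : X → M'` and commuting actions of `Γ` (left, along `p`) and `Γ'` (right, along
`p'`), where the left (right) action is proper, free, preserves the fibres of `p'` (of `p`) and is
transitive on them. -/
structure MoritaEquivalence (Γ Γ' : LieGroupoid.{u, v} 𝕜) where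
  X : Mfd.{u, v} 𝕜
  p : X → Γ.Obj
  p' : X → Γ'.Obj
  surjective_p : Function.Surjective p
  surjective_p' : Function.Surjective p'
  isSubmersion_p : Manifold.IsSubmersion X.model Γ.Obj.model ∞ p
  isSubmersion_p' : Manifold.IsSubmersion X.model Γ'.Obj.model ∞ p'
  left : LeftAction Γ X p
  right : RightAction Γ' X p'
  p'_left : ∀ γ x, Γ.t γ = p x → p' (left.act γ x) = p' x
  p_right : ∀ x γ', p' x = Γ'.s γ' → p (right.act x γ') = p x
  comm : ∀ γ x γ', Γ.t γ = p x → p' x = Γ'.s γ' →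
    right.act (left.act γ x) γ' = left.act γ (right.act x γ')
  proper_left : IsProperMap (fun a : {a : Γ.Arr × X // Γ.t a.1 = p a.2} =>
    (left.act a.1.1 a.1.2, a.1.2))
  proper_right : IsProperMap (fun a : {a : X × Γ'.Arr // p' a.1 = Γ'.s a.2} =>
    (a.1.1, right.act a.1.1 a.1.2))
  free_left : ∀ γ x, Γ.t γ = p x → left.act γ x = x → γ = Γ.one (p x)
  free_right : ∀ x γ', p' x = Γ'.s γ' → right.act x γ' = x → γ' = Γ'.one (p' x)
  transitive_left : ∀ x y, p' x = p' y → ∃ γ, Γ.t γ = p x ∧ left.act γ x = y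
  transitive_right : ∀ x y, p x = p y → ∃ γ', p' x = Γ'.s γ' ∧ right.act x γ' = y

namespace MoritaEquivalence

variable {Γ Γ' : LieGroupoid.{u, v} 𝕜} (X : MoritaEquivalence Γ Γ')

/-- The subset `p' (p⁻¹ S)` of `M'` that corresponds to the subset `S` of `M`. -/
def mapSet (S : Set Γ.Obj) : Set Γ'.Obj := X.p' '' (X.p ⁻¹' S)

/-- The fibre product `Z ×_{φ, M, p} X`. -/
def fiberProduct (Z : RightModule Γ) : Set (Z.space × X.X) := {a | Z.map a.1 = X.p a.2}

/-- The orbit relation of `Γ` on `Z ×_{φ, M, p} X`: `(z, x) ∼ (z · γ⁻¹, γ · x)`. -/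
def orbitRel (Z : RightModule Γ) (a b : X.fiberProduct Z) : Prop :=
  ∃ γ : Γ.Arr, Γ.t γ = X.p a.1.2 ∧
    b.1 = (Z.action.act a.1.1 (Γ.inv γ), X.left.act γ a.1.2)

/-- The set `(Z ×_{φ, M, p} X) / Γ`. -/
def BalancedProduct (Z : RightModule Γ) : Type u := Quot (X.orbitRel Z)

/-- The right `Γ'`-module `Z'` is (a copy of) the module induced by `Z` through the Morita
equivalence `X`: the set `(Z ×_{φ, M, p} X) / Γ`, with the manifold structure for which the
projection from `Z ×_{φ, M, p} X` is a submersion, with the map `[z, x] ↦ p' x`, and with the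
action `[z, x] · γ' = [z, x · γ']`. -/
def IsInduced (Z : RightModule Γ) (Z' : RightModule Γ') : Prop :=
  ∃ e : X.BalancedProduct Z ≃ Z'.space,
    IsSubmersionOnSubmanifold (Z.space.model.prod X.X.model) (X.fiberProduct Z)
      (fun a => e (Quot.mk _ a)) ∧
    (∀ a : X.fiberProduct Z, Z'.map (e (Quot.mk _ a)) = X.p' a.1.2) ∧
    ∀ (a : X.fiberProduct Z) (γ' : Γ'.Arr) (h : X.p' a.1.2 = Γ'.s γ'),
      Z'.action.act (e (Quot.mk _ a)) γ' =
        e (Quot.mk _ ⟨(a.1.1, X.right.act a.1.2 γ'), a.2.trans (X.p_right _ _ h).symm⟩)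

end MoritaEquivalence

/-- `φ : Z → M` is a resolution of the closure of the embedded submanifold `S` of `M`: it is smooth,
`φ⁻¹ S` is dense in `Z`, and `φ` restricts to a diffeomorphism from `φ⁻¹ S` (an open subset of `Z`)
onto the manifold `S`, that is, the restriction has a smooth inverse `ψ : S → Z`. -/
structure IsResolution {Z M : Mfd.{u, v} 𝕜} (S : Set M) (φ : Z → M) : Prop where
  contMDiff : ContMDiff Z.model M.model ∞ φ
  dense : Dense (φ ⁻¹' S)
  diffeo : ∃ (d : ℕ) (_ : ChartedSpace (EuclideanSpace 𝕜 (Fin d)) S),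
    IsSubmanifoldStructure M.model S d ∧
    ∃ ψ : S → Z, ContMDiff 𝓘(𝕜, EuclideanSpace 𝕜 (Fin d)) Z.model ∞ ψ ∧
      (∀ m, φ (ψ m) = m) ∧ ∀ (z : Z) (h : φ z ∈ S), ψ ⟨φ z, h⟩ = z

/-- A `Γ`-resolution of the closure of `S`: a resolution `(Z, φ)` with a structure of right
`Γ`-module (which is unique, by density of `φ⁻¹ S`). -/
structure EquivariantResolution (Γ : LieGroupoid.{u, v} 𝕜) (S : Set Γ.Obj) extends
    RightModule Γ where
  isResolution : IsResolution S map

namespace EquivariantResolution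

variable {Γ : LieGroupoid.{u, v} 𝕜} {S : Set Γ.Obj}

/-- Surjective resolutions: `φ(Z)` is the whole closure of `S`. -/
def IsSurjective (R : EquivariantResolution Γ S) : Prop := Set.range R.map = closure S

/-- Proper resolutions: `φ` is a proper map. -/
def IsProper (R : EquivariantResolution Γ S) : Prop := IsProperMap R.map

/-- Isomorphism of resolutions: a diffeomorphism `Φ : Z₁ → Z₂` with `φ₂ ∘ Φ = φ₁`. -/
def Iso (R₁ R₂ : EquivariantResolution Γ S) : Prop :=
  ∃ Φ : Diffeomorph R₁.space.model R₂.space.model R₁.space R₂.space ∞,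
    ∀ z, R₂.map (Φ z) = R₁.map z

instance isoSetoid (Γ : LieGroupoid.{u, v} 𝕜) (S : Set Γ.Obj) :
    Setoid (EquivariantResolution Γ S) where
  r := Iso
  iseqv :=
    { refl := fun R => ⟨Diffeomorph.refl _ _ _, fun _ => rfl⟩
      symm := fun {R₁ R₂} ⟨Φ, h⟩ => ⟨Φ.symm, fun z => by
        rw [← h (Φ.symm z), Diffeomorph.apply_symm_apply]⟩
      trans := fun ⟨Φ, h⟩ ⟨Ψ, k⟩ => ⟨Φ.trans Ψ, fun z => (k (Φ z)).trans (h z)⟩ }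

end EquivariantResolution

/-- `Γ`-resolutions of the closure of `S`, isomorphic ones being identified. -/
def ResolutionClass (Γ : LieGroupoid.{u, v} 𝕜) (S : Set Γ.Obj) : Type (max (u + 1) v) :=
  Quotient (EquivariantResolution.isoSetoid Γ S)

/-- The class of a `Γ`-resolution. -/
def EquivariantResolution.cls {Γ : LieGroupoid.{u, v} 𝕜} {S : Set Γ.Obj}
    (R : EquivariantResolution Γ S) : ResolutionClass Γ S :=
  Quotient.mk _ R

end LieGroupoid

/-! For stable `S` one has `p'⁻¹(S') = p⁻¹(S)`, because the fibres of `p'` are `Γ`-orbits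
(`preimage_mapSet`). Local properties of `S` can therefore be read on `X` and carried to `S'`. A
submanifold pulls back along `p`. It descends along `p'`: if `R` is a local retraction onto the
preimage and `σ` a local section of `p'`, then `p' ∘ R ∘ σ` is a local retraction onto `S'`, and
smooth local retracts are submanifolds (`IsSliceAt.of_retraction`). Submanifolds and submersions are
handled throughout by local parametrizations, extensions and sections (`IsSliceAt`,
`IsProjectionAt`); atlases appear only when translating from and to the definitions.

The analytic core is the smoothness of the division map `(γ · x, x) ↦ γ` on `X ×_{M'} X`
(`contMDiffOn_div`). On a fibre of `t` the orbit map `γ ↦ γ · x₀` is injective and intertwines local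
translations, so its rank at the unit is at least the rank nearby, and an injective map of locally
maximal rank is an immersion (`injective_fderiv_of_rank_le`, `injective_fderiv_of_homogeneous`). A
local left inverse then gives a smooth candidate for division near the diagonal
(`exists_local_division`). Properness and freeness force the true quotient to be close to a unit
there (`tendsto_div`), so it agrees with the candidate; a translation covers the remaining points.

Division moves a point `(z, x)` of the fibre product along its `Γ`-orbit to any prescribed second
component in the `p'`-fibre of `x`. Hence local sections of `p'` cut out slices for the orbits, the
orbit relation is closed, and the balanced product is a Hausdorff manifold with a right `Γ'`-action
(`exists_isInduced`).

Induction is reversible: `[z, x]` and `x` determine `z`, and `([z, x], x) ↦ z` exhibits `Z` as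
induced from `Z'` through the opposite equivalence (`IsInducedVia.exists_symm`). Each equivalence
therefore needs only one implication. Being a resolution amounts to density, injectivity over `S`
and local smooth sections over the submanifold `S` (`isResolution_iff`), and each of these
transfers. Isomorphisms of resolutions are equivariant by density (`map_act_of_iso`), so induction
is defined on classes. Surjectivity transfers because the open maps `p`, `p'` commute with closures
(`mapSet_closure`), properness by lifting ultrafilters along sections of `p'`. -/

open Filter Topology Set

/-! ### Smoothness near a point -/

section SmoothNear

variable {𝕜 : Type*} [RCLike 𝕜]
  {E : Type*} [NormedAddCommGroup E] [NormedSpace 𝕜 E] {H : Type*} [TopologicalSpace H]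
  {I : ModelWithCorners 𝕜 E H} {M : Type*} [TopologicalSpace M] [ChartedSpace H M]
  {E' : Type*} [NormedAddCommGroup E'] [NormedSpace 𝕜 E'] {H' : Type*} [TopologicalSpace H']
  {I' : ModelWithCorners 𝕜 E' H'} {M' : Type*} [TopologicalSpace M'] [ChartedSpace H' M']
  {E'' : Type*} [NormedAddCommGroup E''] [NormedSpace 𝕜 E''] {H'' : Type*} [TopologicalSpace H'']
  {I'' : ModelWithCorners 𝕜 E'' H''} {M'' : Type*} [TopologicalSpace M''] [ChartedSpace H'' M'']

/-- `f` is smooth on a neighbourhood of `a`. -/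
def SmoothNear (I : ModelWithCorners 𝕜 E H) (I' : ModelWithCorners 𝕜 E' H') (f : M → M') (a : M) :
    Prop :=
  ∀ᶠ y in 𝓝 a, ContMDiffAt I I' ∞ f y

namespace SmoothNear

variable {f : M → M'} {a : M}

theorem contMDiffAt (hf : SmoothNear I I' f a) : ContMDiffAt I I' ∞ f a := hf.self_of_nhds

theorem continuousAt (hf : SmoothNear I I' f a) : ContinuousAt f a := hf.contMDiffAt.continuousAt

/-- This persistence is the reason for working on a neighbourhood: `ContMDiffAt` of order `∞` at one
point provides each finite order on a neighbourhood that may shrink with the order. -/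
theorem eventually (hf : SmoothNear I I' f a) : ∀ᶠ y in 𝓝 a, SmoothNear I I' f y :=
  eventually_eventually_nhds.2 hf

theorem congr {g : M → M'} (hf : SmoothNear I I' f a) (h : g =ᶠ[𝓝 a] f) : SmoothNear I I' g a := by
  filter_upwards [hf, eventually_eventually_nhds.2 h] with y hy hy'
  exact hy.congr_of_eventuallyEq hy'

theorem comp {g : M' → M''} {b : M'} (hg : SmoothNear I' I'' g b) (hf : SmoothNear I I' f a)
    (hab : f a = b) : SmoothNear I I'' (fun y => g (f y)) a := by
  subst hab
  filter_upwards [hf, hf.continuousAt.eventually hg] with y hy hy'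
  exact hy'.comp y hy

theorem prodMk {g : M → M''} (hf : SmoothNear I I' f a) (hg : SmoothNear I I'' g a) :
    SmoothNear I (I'.prod I'') (fun y => (f y, g y)) a := by
  filter_upwards [hf, hg] with y hy hy'
  exact hy.prodMk hy'

theorem prodMk_space {g : M → E'} {h : M → E''} (hf : SmoothNear I 𝓘(𝕜, E') g a)
    (hg : SmoothNear I 𝓘(𝕜, E'') h a) :
    SmoothNear I 𝓘(𝕜, E' × E'') (fun y => (g y, h y)) a := by
  filter_upwards [hf, hg] with y hy hy'
  exact hy.prodMk_space hy'

theorem id : SmoothNear I I (fun y : M => y) a := Eventually.of_forall fun _ => contMDiffAt_id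

theorem const {c : M'} : SmoothNear I I' (fun _ : M => c) a :=
  Eventually.of_forall fun _ => contMDiffAt_const

theorem fst {a : M × M'} : SmoothNear (I.prod I') I (fun y : M × M' => y.1) a :=
  Eventually.of_forall fun _ => contMDiffAt_fst

theorem snd {a : M × M'} : SmoothNear (I.prod I') I' (fun y : M × M' => y.2) a :=
  Eventually.of_forall fun _ => contMDiffAt_snd

/-- Pulling back an eventual property along a map that is smooth near a point. -/
theorem pull (hf : SmoothNear I I' f a) {q : M' → Prop} {b : M'} (h : ∀ᶠ y in 𝓝 b, q y)
    (hab : f a = b) : ∀ᶠ y in 𝓝 a, q (f y) := by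
  subst hab; exact hf.continuousAt.eventually h

/-- Pulling back a property that holds eventually within a set. -/
theorem pullWithin (hf : SmoothNear I I' f a) {q : M' → Prop} {b : M'} {A : Set M'}
    (h : ∀ᶠ y in 𝓝[A] b, q y) (hab : f a = b) : ∀ᶠ y in 𝓝 a, f y ∈ A → q (f y) := by
  subst hab; exact hf.continuousAt.eventually (eventually_nhdsWithin_iff.1 h)

end SmoothNear

theorem ContMDiff.smoothNear {f : M → M'} (hf : ContMDiff I I' ∞ f) (a : M) :
    SmoothNear I I' f a := Eventually.of_forall fun y => hf y

theorem contMDiff_iff_smoothNear {f : M → M'} : ContMDiff I I' ∞ f ↔ ∀ a, SmoothNear I I' f a :=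
  ⟨fun hf => hf.smoothNear, fun hf a => (hf a).contMDiffAt⟩

theorem ContMDiffOn.smoothNear {f : M → M'} {s : Set M} (hf : ContMDiffOn I I' ∞ f s) {a : M}
    (hs : s ∈ 𝓝 a) : SmoothNear I I' f a := by
  filter_upwards [eventually_mem_nhds_iff.2 hs] with y hy using hf.contMDiffAt hy

/-- A map that is smooth on a set `A` is smooth along every smooth map into `A`. -/
theorem ContMDiffOn.comp_smoothNear {g : M' → M''} {A : Set M'} (hg : ContMDiffOn I' I'' ∞ g A)
    {c : M → M'} {a : M} (hc : SmoothNear I I' c a) (hA : ∀ᶠ y in 𝓝 a, c y ∈ A) :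
    SmoothNear I I'' (fun y => g (c y)) a := by
  filter_upwards [hc, eventually_eventually_nhds.2 hA] with y hy hy'
  have h1 := (hg (c y) hy'.self_of_nhds).comp (s := {w | c w ∈ A}) y hy.contMDiffWithinAt
    (fun w hw => hw)
  exact h1.contMDiffAt hy'

/-- A map with local smooth extensions from `A` is smooth on `A`. -/
theorem contMDiffOn_of_local_extension {g : M → M'} {A : Set M}
    (h : ∀ a ∈ A, ∃ G : M → M', SmoothNear I I' G a ∧ ∀ᶠ y in 𝓝[A] a, g y = G y) :
    ContMDiffOn I I' ∞ g A := by
  intro a ha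
  obtain ⟨G, hG, hgG⟩ := h a ha
  exact hG.contMDiffAt.contMDiffWithinAt.congr_of_eventuallyEq hgG (hgG.self_of_nhdsWithin ha)

theorem smoothNear_iff_contDiffAt {f : E → E'} {a : E} :
    SmoothNear 𝓘(𝕜, E) 𝓘(𝕜, E') f a ↔ ∀ᶠ y in 𝓝 a, ContDiffAt 𝕜 ∞ f y := by
  simp only [SmoothNear, contMDiffAt_iff_contDiffAt]

theorem ContDiff.smoothNear {f : E → E'} (hf : ContDiff 𝕜 ∞ f) (a : E) :
    SmoothNear 𝓘(𝕜, E) 𝓘(𝕜, E') f a := hf.contMDiff.smoothNear a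

section Chart

theorem smoothNear_extend {e : OpenPartialHomeomorph M H} (he : e ∈ IsManifold.maximalAtlas I ∞ M)
    {a : M} (ha : a ∈ e.source) : SmoothNear I 𝓘(𝕜, E) (e.extend I) a :=
  (OpenPartialHomeomorph.contMDiffOn_extend he).smoothNear (e.open_source.mem_nhds ha)

theorem smoothNear_extend_symm [I.Boundaryless] {e : OpenPartialHomeomorph M H}
    (he : e ∈ IsManifold.maximalAtlas I ∞ M) {v : E} (hv : v ∈ (e.extend I).target) :
    SmoothNear 𝓘(𝕜, E) I (e.extend I).symm v := by
  refine (contMDiffOn_extend_symm he).smoothNear ?_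
  have : (e.extend I).target = I '' e.target := by
    rw [OpenPartialHomeomorph.extend_target', image_eq_range]
  rw [← this]
  exact e.isOpen_extend_target.mem_nhds hv

theorem smoothNear_extChartAt [IsManifold I ∞ M] (a : M) : SmoothNear I 𝓘(𝕜, E) (extChartAt I a) a :=
  contMDiffOn_extChartAt.smoothNear (chart_source_mem_nhds H a)

theorem smoothNear_extChartAt_symm [IsManifold I ∞ M] [I.Boundaryless] (a : M) :
    SmoothNear 𝓘(𝕜, E) I (extChartAt I a).symm (extChartAt I a a) :=
  (contMDiffOn_extChartAt_symm a).smoothNear (extChartAt_target_mem_nhds a)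

theorem eventually_extChartAt_left_inv (a : M) :
    ∀ᶠ y in 𝓝 a, (extChartAt I a).symm (extChartAt I a y) = y := by
  filter_upwards [extChartAt_source_mem_nhds (I := I) a] with y hy
  exact (extChartAt I a).left_inv hy

theorem eventually_extChartAt_right_inv [I.Boundaryless] (a : M) :
    ∀ᶠ v in 𝓝 (extChartAt I a a), extChartAt I a ((extChartAt I a).symm v) = v := by
  filter_upwards [extChartAt_target_mem_nhds (I := I) a] with y hy
  exact (extChartAt I a).right_inv hy

end Chart

end SmoothNear

/-! ### Calculus in normed spaces -/

section Calculus

variable {𝕜 : Type*} [RCLike 𝕜]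
  {E : Type*} [NormedAddCommGroup E] [NormedSpace 𝕜 E]
  {F : Type*} [NormedAddCommGroup F] [NormedSpace 𝕜 F]

/-- The inverse function theorem for smooth maps, with smoothness on the whole domain of the
local inverse. -/
theorem exists_openPartialHomeomorph_of_contDiff [CompleteSpace E] {f : E → F} {a : E}
    {f' : E ≃L[𝕜] F} (hf : ∀ᶠ y in 𝓝 a, ContDiffAt 𝕜 ∞ f y)
    (hf' : HasFDerivAt f (f' : E →L[𝕜] F) a) {U : Set E} (hU : U ∈ 𝓝 a) :
    ∃ e : OpenPartialHomeomorph E F, a ∈ e.source ∧ e.source ⊆ U ∧ (∀ y, e y = f y) ∧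
      ContDiffOn 𝕜 ∞ e e.source ∧ ContDiffOn 𝕜 ∞ e.symm e.target := by
  have hfa : ContDiffAt 𝕜 ∞ f a := hf.self_of_nhds
  set e₀ := hfa.toOpenPartialHomeomorph f hf' (by simp) with he₀
  have ha₀ : a ∈ e₀.source := hfa.mem_toOpenPartialHomeomorph_source hf' (by simp)
  have hcont : ContinuousAt (fderiv 𝕜 f) a :=
    (hfa.fderiv_right (m := 0) (by simp)).continuousAt
  -- Invertibility of the derivative is an open condition; after restriction to such points the
  -- inverse is smooth on all of its domain, not only at `f a`.
  have hinv : ∀ᶠ y in 𝓝 a, fderiv 𝕜 f y ∈ range ((↑) : (E ≃L[𝕜] F) → E →L[𝕜] F) := by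
    apply hcont.eventually
    rw [hf'.fderiv]
    exact ContinuousLinearEquiv.nhds f'
  obtain ⟨V, hV, hVo, haV⟩ := eventually_nhds_iff.1 (hf.and (hinv.and hU))
  refine ⟨e₀.restr V, ?_, ?_, fun y => rfl, ?_, ?_⟩
  · rw [e₀.restr_source' V hVo]; exact ⟨ha₀, haV⟩
  · rw [e₀.restr_source' V hVo]; exact fun y hy => (hV y hy.2).2.2
  · rw [e₀.restr_source' V hVo]
    exact fun y hy => (hV y hy.2).1.contDiffWithinAt
  · intro v hv
    have hv' := (e₀.restr V).map_target hv
    rw [e₀.restr_source' V hVo] at hv'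
    obtain ⟨h1, ⟨g, hg⟩, -⟩ := hV _ hv'.2
    refine ((e₀.restr V).contDiffAt_symm (f₀' := g) hv ?_ ?_).contDiffWithinAt
    · have := (h1.differentiableAt (by simp)).hasFDerivAt
      rw [← hg] at this
      exact this
    · exact h1

end Calculus

/-! ### Local normal forms in finite-dimensional normed spaces -/

section Derivative

variable {𝕜 : Type*} [RCLike 𝕜]
  {E : Type*} [NormedAddCommGroup E] [NormedSpace 𝕜 E]
  {F : Type*} [NormedAddCommGroup F] [NormedSpace 𝕜 F]

theorem HasFDerivAt.of_smoothNear {f : E → F} {a : E} (hf : SmoothNear 𝓘(𝕜, E) 𝓘(𝕜, F) f a) :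
    HasFDerivAt f (fderiv 𝕜 f a) a :=
  ((contMDiffAt_iff_contDiffAt.1 hf.contMDiffAt).differentiableAt (by simp)).hasFDerivAt

theorem continuousAt_fderiv_of_smoothNear {f : E → F} {a : E}
    (hf : SmoothNear 𝓘(𝕜, E) 𝓘(𝕜, F) f a) : ContinuousAt (fderiv 𝕜 f) a :=
  ((contMDiffAt_iff_contDiffAt.1 hf.contMDiffAt).fderiv_right (m := 0) (by simp)).continuousAt

end Derivative

section NormalForms

variable {𝕜 : Type*} [RCLike 𝕜]
  {E : Type*} [NormedAddCommGroup E] [NormedSpace 𝕜 E] [FiniteDimensional 𝕜 E]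
  {F : Type*} [NormedAddCommGroup F] [NormedSpace 𝕜 F] [FiniteDimensional 𝕜 F]

open Module

/-- A linear map between finite-dimensional spaces has a generalized inverse. -/
theorem exists_generalized_inverse (A : F →L[𝕜] E) :
    ∃ S : E →L[𝕜] F, (∀ x, A (S (A x)) = A x) ∧ ∀ y, S (A (S y)) = S y := by
  obtain ⟨g, hg⟩ := LinearMap.exists_rightInverse_of_surjective (A : F →ₗ[𝕜] E).rangeRestrict
    (LinearMap.range_rangeRestrict _)
  obtain ⟨q, hq⟩ := LinearMap.exists_leftInverse_of_injective
    (Submodule.subtype (LinearMap.range (A : F →ₗ[𝕜] E))) (Submodule.ker_subtype _)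
  have hg' : ∀ r : LinearMap.range (A : F →ₗ[𝕜] E), A (g r) = r := fun r =>
    congrArg Subtype.val (LinearMap.congr_fun hg r)
  have hq' : ∀ r : LinearMap.range (A : F →ₗ[𝕜] E), q r = r := fun r => LinearMap.congr_fun hq r
  refine ⟨LinearMap.toContinuousLinearMap (g ∘ₗ q), fun x => ?_, fun y => ?_⟩
  · have : q (A x) = ⟨A x, x, rfl⟩ := hq' ⟨A x, x, rfl⟩
    simp [this, hg']
  · simp [hg', hq']

/-- The inverse function theorem for a map whose derivative is the identity. -/
theorem exists_local_inverse_of_fderiv_eq_id {f : E → E} {a : E}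
    (hf : SmoothNear 𝓘(𝕜, E) 𝓘(𝕜, E) f a) (hf' : HasFDerivAt f (ContinuousLinearMap.id 𝕜 E) a)
    {U : Set E} (hU : U ∈ 𝓝 a) :
    ∃ e : OpenPartialHomeomorph E E, a ∈ e.source ∧ e.source ⊆ U ∧ (∀ y, e y = f y) ∧
      ContDiffOn 𝕜 ∞ e e.source ∧ ContDiffOn 𝕜 ∞ e.symm e.target := by
  have := FiniteDimensional.complete 𝕜 E
  exact exists_openPartialHomeomorph_of_contDiff (f' := ContinuousLinearEquiv.refl 𝕜 E)
    (smoothNear_iff_contDiffAt.1 hf) hf' hU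

/-- A smooth map with injective derivative has a local smooth left inverse. -/
theorem exists_smooth_left_inverse {f : F → E} {a : F} (hf : SmoothNear 𝓘(𝕜, F) 𝓘(𝕜, E) f a)
    (hinj : Function.Injective (fderiv 𝕜 f a)) :
    ∃ g : E → F, SmoothNear 𝓘(𝕜, E) 𝓘(𝕜, F) g (f a) ∧ ∀ᶠ y in 𝓝 a, g (f y) = y := by
  obtain ⟨S, hS, -⟩ := exists_generalized_inverse (fderiv 𝕜 f a)
  have hSA : ∀ x, S (fderiv 𝕜 f a x) = x := fun x => hinj (hS x)
  -- `S` is a linear left inverse of the derivative, so `S ∘ f` has derivative the identity and is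
  -- locally invertible.
  have hSf : SmoothNear 𝓘(𝕜, F) 𝓘(𝕜, F) (fun y => S (f y)) a :=
    (S.contDiff.smoothNear (f a)).comp hf rfl
  obtain ⟨e, hae, -, hef, -, he⟩ := exists_local_inverse_of_fderiv_eq_id hSf
    (U := univ) (by
      have := S.hasFDerivAt.comp a (HasFDerivAt.of_smoothNear hf)
      convert! this using 1
      ext x; exact (hSA x).symm) univ_mem
  refine ⟨fun v => e.symm (S v), ?_, ?_⟩
  · have h1 : SmoothNear 𝓘(𝕜, F) 𝓘(𝕜, F) e.symm (S (f a)) := by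
      refine (contMDiffOn_iff_contDiffOn.2 he).smoothNear (e.open_target.mem_nhds ?_)
      rw [← hef]; exact e.map_source hae
    exact h1.comp (S.contDiff.smoothNear (f a)) rfl
  · filter_upwards [e.open_source.mem_nhds hae] with y hy
    rw [← hef, e.left_inv hy]

/-- An injective smooth map whose rank is maximal at a point is an immersion there. -/
theorem injective_fderiv_of_rank_le {f : F → E} {a : F} (hf : SmoothNear 𝓘(𝕜, F) 𝓘(𝕜, E) f a)
    {U : Set F} (hU : U ∈ 𝓝 a) (hinj : InjOn f U)
    (hrank : ∀ᶠ y in 𝓝 a, finrank 𝕜 (LinearMap.range (fderiv 𝕜 f y : F →ₗ[𝕜] E)) ≤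
      finrank 𝕜 (LinearMap.range (fderiv 𝕜 f a : F →ₗ[𝕜] E))) :
    Function.Injective (fderiv 𝕜 f a) := by
  set A := fderiv 𝕜 f a with hA
  obtain ⟨S, hASA, hSAS⟩ := exists_generalized_inverse A
  rw [injective_iff_map_eq_zero]
  intro k hk
  -- `S A` is a projection. The derivative of `Φ` at `a` is `S A + (1 - S A) = 1`, and in the
  -- coordinates `Φ` the map `S ∘ f` becomes the linear map `S A` (`hPΦ`).
  set Φ : F → F := fun x => S (f x) + (x - S (A x)) with hΦ
  have hSf : SmoothNear 𝓘(𝕜, F) 𝓘(𝕜, F) (fun y => S (f y)) a :=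
    (S.contDiff.smoothNear (f a)).comp hf rfl
  have hΦs : SmoothNear 𝓘(𝕜, F) 𝓘(𝕜, F) Φ a := by
    rw [smoothNear_iff_contDiffAt] at hSf ⊢
    filter_upwards [hSf] with y hy
    exact hy.add (contDiffAt_id.sub (S.contDiff.comp A.contDiff).contDiffAt)
  have hΦder : ∀ᶠ y in 𝓝 a, HasFDerivAt Φ (S ∘L fderiv 𝕜 f y +
      (ContinuousLinearMap.id 𝕜 F - S ∘L A)) y := by
    filter_upwards [hf.eventually] with y hy
    exact (S.hasFDerivAt.comp y (HasFDerivAt.of_smoothNear hy)).add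
      ((hasFDerivAt_id y).sub (S ∘L A).hasFDerivAt)
  have hPΦ : ∀ x, S (A (Φ x)) = S (f x) := fun x => by simp [hΦ, hSAS, hASA]
  -- the composition with `S` is injective on the range of nearby derivatives
  have hker : ∀ᶠ y in 𝓝 a, ∀ x, S (fderiv 𝕜 f y x) = 0 → fderiv 𝕜 f y x = 0 := by
    have hinv : ∀ᶠ y in 𝓝 a, fderiv 𝕜 Φ y ∈ range ((↑) : (F ≃L[𝕜] F) → F →L[𝕜] F) := by
      have := FiniteDimensional.complete 𝕜 F
      apply (continuousAt_fderiv_of_smoothNear hΦs).eventually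
      rw [hΦder.self_of_nhds.fderiv]
      have hid : S ∘L fderiv 𝕜 f a + (ContinuousLinearMap.id 𝕜 F - S ∘L A) =
          ContinuousLinearMap.id 𝕜 F := by
        ext x; simp [hA]
      rw [hid]
      exact ContinuousLinearEquiv.nhds (ContinuousLinearEquiv.refl 𝕜 F)
    filter_upwards [hΦder, hinv, hrank] with y hy ⟨e, he⟩ hr x hx
    rw [hy.fderiv] at he
    have hSe : ∀ x, S (A (e x)) = S (fderiv 𝕜 f y x) := by
      intro x
      have : e x = S (fderiv 𝕜 f y x) + (x - S (A x)) := by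
        have := DFunLike.congr_fun he x
        simpa using this
      simp [this, hSAS, hASA]
    -- `A S` maps `R` onto a space containing the range of `A`; since the dimension of `R` is at
    -- most that of the range of `A`, the restriction of `A S` to `R` is injective.
    set R := LinearMap.range (fderiv 𝕜 f y : F →ₗ[𝕜] E) with hR
    have hmap : LinearMap.range (A : F →ₗ[𝕜] E) ≤
        Submodule.map ((A : F →ₗ[𝕜] E) ∘ₗ (S : E →ₗ[𝕜] F)) R := by
      rintro _ ⟨w, rfl⟩
      refine ⟨fderiv 𝕜 f y (e.symm w), ⟨_, rfl⟩, ?_⟩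
      have := hSe (e.symm w)
      rw [e.apply_symm_apply] at this
      simp [← this, hASA]
    set T := ((A : F →ₗ[𝕜] E) ∘ₗ (S : E →ₗ[𝕜] F)).domRestrict R with hT
    have hTr : LinearMap.range T = Submodule.map ((A : F →ₗ[𝕜] E) ∘ₗ (S : E →ₗ[𝕜] F)) R :=
      LinearMap.range_domRestrict _ _
    have h1 := LinearMap.finrank_range_add_finrank_ker T
    have h2 := Submodule.finrank_mono hmap
    rw [← hTr] at h2
    have h3 : finrank 𝕜 (LinearMap.ker T) = 0 := by omega
    rw [Submodule.finrank_eq_zero] at h3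
    have h4 : (⟨fderiv 𝕜 f y x, x, rfl⟩ : R) ∈ LinearMap.ker T := by
      simp [hT, hx]
    rw [h3, Submodule.mem_bot] at h4
    exact congrArg Subtype.val h4
  obtain ⟨V, hV, hVo, haV⟩ := eventually_nhds_iff.1 (hker.and (hf.eventually.and hU))
  obtain ⟨e, hae, heV, heΦ, -, hes⟩ := exists_local_inverse_of_fderiv_eq_id hΦs
    (U := V) (by
      convert! hΦder.self_of_nhds using 1
      ext x; simp [hA]) (hVo.mem_nhds haV)
  -- On the line in the kernel direction `k`, read in the coordinates `Φ`, `S ∘ f` is constant. By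
  -- `hker` the derivative of `f` itself then vanishes along it, so `f` is constant there and
  -- injectivity leaves only `k = 0`.
  set l : 𝕜 → F := fun t => Φ a + t • k with hl
  have hlc : Continuous l := by fun_prop
  have hl0 : l 0 ∈ e.target := by
    simp only [hl, zero_smul, add_zero, ← heΦ]; exact e.map_source hae
  obtain ⟨ε, hε, hball⟩ := Metric.mem_nhds_iff.1 (hlc.continuousAt.preimage_mem_nhds
    (e.open_target.mem_nhds hl0))
  have hSc : ∀ t ∈ Metric.ball (0 : 𝕜) ε, S (f (e.symm (l t))) = S (A (Φ a)) := by
    intro t ht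
    rw [← hPΦ, ← heΦ, e.right_inv (hball ht)]
    simp [hl, hk]
  have hder : ∀ t ∈ Metric.ball (0 : 𝕜) ε, ∃ w : F,
      HasDerivAt (fun t => f (e.symm (l t))) (fderiv 𝕜 f (e.symm (l t)) w) t := by
    intro t ht
    have h1 : HasDerivAt l k t := by
      have h := ((hasDerivAt_id t).smul_const k).const_add (Φ a)
      rw [one_smul] at h
      exact h
    have h2 := ((hes.contDiffAt (e.open_target.mem_nhds (hball ht))).differentiableAt
      (by simp)).hasFDerivAt
    have h3 := h2.comp_hasDerivAt t h1
    have h4 := HasFDerivAt.of_smoothNear (hV _ (heV (e.map_target (hball ht)))).2.1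
    exact ⟨_, h4.comp_hasDerivAt t h3⟩
  have hzero : ∀ t ∈ Metric.ball (0 : 𝕜) ε, HasDerivAt (fun t => f (e.symm (l t))) 0 t := by
    intro t ht
    obtain ⟨w, hw⟩ := hder t ht
    have h1 : HasDerivAt (fun t => S (f (e.symm (l t)))) (S (fderiv 𝕜 f (e.symm (l t)) w)) t :=
      S.hasFDerivAt.comp_hasDerivAt t hw
    have h2 : HasDerivAt (fun t => S (f (e.symm (l t)))) 0 t :=
      (hasDerivAt_const t (S (A (Φ a)))).congr_of_eventuallyEq
        (by filter_upwards [Metric.isOpen_ball.mem_nhds ht] with s hs using hSc s hs)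
    rwa [(hV _ (heV (e.map_target (hball ht)))).1 w (h1.unique h2)] at hw
  have hconst : ∀ t ∈ Metric.ball (0 : 𝕜) ε, f (e.symm (l t)) = f (e.symm (l 0)) := by
    intro t ht
    refine Metric.isOpen_ball.is_const_of_deriv_eq_zero Metric.isPreconnected_ball
      (fun s hs => (hzero s hs).differentiableAt.differentiableWithinAt)
      (fun s hs => (hzero s hs).deriv) ht (Metric.mem_ball_self hε)
  obtain ⟨t, ht0, htε⟩ := NormedField.exists_norm_lt 𝕜 hε
  have htb : t ∈ Metric.ball (0 : 𝕜) ε := by simpa using htε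
  have h1 := hinj (hV _ (heV (e.map_target (hball htb)))).2.2
    (hV _ (heV (e.map_target hl0))).2.2 (hconst t htb)
  have h2 : l t = l 0 := by
    rw [← e.right_inv (hball htb), h1, e.right_inv hl0]
  have h3 : t • k = 0 := by simpa [hl] using h2
  exact (smul_eq_zero.1 h3).resolve_left (norm_pos_iff.1 ht0)

/-- An injective smooth map that is locally homogeneous, in the sense that it intertwines a family
of local diffeomorphisms moving the base point with smooth maps, is an immersion. -/
theorem injective_fderiv_of_homogeneous {f : F → E} {a : F}
    (hf : SmoothNear 𝓘(𝕜, F) 𝓘(𝕜, E) f a) {U : Set F} (hU : U ∈ 𝓝 a) (hinj : InjOn f U)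
    {l : F × F → F} (hl : SmoothNear 𝓘(𝕜, F × F) 𝓘(𝕜, F) l (a, a))
    (hl₁ : ∀ᶠ y in 𝓝 a, l (a, y) = y) (hl₂ : ∀ᶠ y in 𝓝 a, l (y, a) = y)
    {m : F × E → E} (hm : SmoothNear 𝓘(𝕜, F × E) 𝓘(𝕜, E) m (a, f a))
    (hlm : ∀ᶠ y in 𝓝 (a, a), f (l y) = m (y.1, f y.2)) :
    Function.Injective (fderiv 𝕜 f a) := by
  have := FiniteDimensional.complete 𝕜 F
  refine injective_fderiv_of_rank_le hf hU hinj ?_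
  -- At `y = a` the map `l (y, ·)` is the identity, so its derivative at `a` stays invertible for
  -- `y` near `a`.
  have hlc : ∀ᶠ y in 𝓝 a, fderiv 𝕜 l (y, a) ∘L ContinuousLinearMap.inr 𝕜 F F ∈
      range ((↑) : (F ≃L[𝕜] F) → F →L[𝕜] F) := by
    have hc : ContinuousAt (fun y => fderiv 𝕜 l (y, a) ∘L ContinuousLinearMap.inr 𝕜 F F) a := by
      have h1 : ContinuousAt (fun y : F => (y, a)) a := by fun_prop
      exact (ContinuousAt.comp (f := fun y : F => (y, a)) (g := fderiv 𝕜 l)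
        (continuousAt_fderiv_of_smoothNear hl) h1).clm_comp continuousAt_const
    apply hc.eventually
    have hid : fderiv 𝕜 l (a, a) ∘L ContinuousLinearMap.inr 𝕜 F F =
        ContinuousLinearMap.id 𝕜 F := by
      have h1 : HasFDerivAt (fun y => l (a, y))
          (fderiv 𝕜 l (a, a) ∘L ContinuousLinearMap.inr 𝕜 F F) a :=
        (HasFDerivAt.of_smoothNear hl).comp a (hasFDerivAt_prodMk_right a a)
      exact h1.unique ((hasFDerivAt_id a).congr_of_eventuallyEq hl₁)
    change ∀ᶠ y in 𝓝 (fderiv 𝕜 l (a, a) ∘L ContinuousLinearMap.inr 𝕜 F F), _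
    rw [hid]
    exact ContinuousLinearEquiv.nhds (ContinuousLinearEquiv.refl 𝕜 F)
  have hpair : ContinuousAt (fun y : F => (y, a)) a := by fun_prop
  have hpair' : ContinuousAt (fun y : F => (y, f a)) a := by fun_prop
  filter_upwards [hl₂, hlm.curry_nhds, hlc, hf.eventually, hpair.eventually hl.eventually,
    hpair'.eventually hm.eventually] with y hly hfl ⟨B, hB⟩ hfy hls hms
  have h1 : HasFDerivAt (fun z => l (y, z)) (B : F →L[𝕜] F) a := by
    rw [hB]
    exact (HasFDerivAt.of_smoothNear hls).comp a (hasFDerivAt_prodMk_right y a)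
  have h2 : HasFDerivAt (fun z => f (l (y, z))) (fderiv 𝕜 f y ∘L (B : F →L[𝕜] F)) a := by
    have := HasFDerivAt.of_smoothNear hfy
    rw [← hly] at this
    have h3 := this.comp a h1
    rwa [hly] at h3
  have h3 : HasFDerivAt (fun z => f (l (y, z)))
      ((fderiv 𝕜 m (y, f a) ∘L ContinuousLinearMap.inr 𝕜 F E) ∘L fderiv 𝕜 f a) a := by
    have h4 : HasFDerivAt (fun z => m (y, z))
        (fderiv 𝕜 m (y, f a) ∘L ContinuousLinearMap.inr 𝕜 F E) (f a) :=
      (HasFDerivAt.of_smoothNear hms).comp (f a) (hasFDerivAt_prodMk_right y (f a))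
    exact (h4.comp a (HasFDerivAt.of_smoothNear hf)).congr_of_eventuallyEq hfl
  -- Both sides differentiate `z ↦ f (l (y, z)) = m (y, f z)` at `a`. As `B` is invertible, the rank
  -- of `f` at `y` is at most the rank at `a`.
  have h4 := h2.unique h3
  have h5 : LinearMap.range (fderiv 𝕜 f y : F →ₗ[𝕜] E) ≤ Submodule.map
      ((fderiv 𝕜 m (y, f a) ∘L ContinuousLinearMap.inr 𝕜 F E : E →L[𝕜] E) : E →ₗ[𝕜] E)
      (LinearMap.range (fderiv 𝕜 f a : F →ₗ[𝕜] E)) := by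
    rintro _ ⟨w, rfl⟩
    refine ⟨fderiv 𝕜 f a (B.symm w), ⟨_, rfl⟩, ?_⟩
    have := DFunLike.congr_fun h4 (B.symm w)
    simp only [ContinuousLinearMap.comp_apply, ContinuousLinearEquiv.coe_coe,
      B.apply_symm_apply] at this
    simp [this]
  exact (Submodule.finrank_mono h5).trans (Submodule.finrank_map_le _ _)

/-- Near a fixed point, a smooth idempotent map is a linear projection in suitable coordinates. -/
theorem exists_coordinates_of_idempotent {r : E → E} {a : E}
    (hr : SmoothNear 𝓘(𝕜, E) 𝓘(𝕜, E) r a) (hra : r a = a) (hrr : ∀ᶠ y in 𝓝 a, r (r y) = r y) :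
    ∃ (d : ℕ) (f : E → EuclideanSpace 𝕜 (Fin d)) (g : EuclideanSpace 𝕜 (Fin d) → E),
      SmoothNear 𝓘(𝕜, E) 𝓘(𝕜, EuclideanSpace 𝕜 (Fin d)) f a ∧
      SmoothNear 𝓘(𝕜, EuclideanSpace 𝕜 (Fin d)) 𝓘(𝕜, E) g (f a) ∧ g (f a) = a ∧
      (∀ᶠ v in 𝓝 (f a), r (g v) = g v ∧ f (g v) = v) ∧ ∀ᶠ y in 𝓝 a, g (f y) = r y := by
  set L := fderiv 𝕜 r a with hL
  have hLr : HasFDerivAt r L a := HasFDerivAt.of_smoothNear hr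
  have hLL : ∀ x, L (L x) = L x := by
    have h1 : HasFDerivAt (fun y => r (r y)) (L ∘L L) a := by
      have h2 : HasFDerivAt r L (r a) := by rwa [hra]
      exact h2.comp a hLr
    have h2 := h1.unique (hLr.congr_of_eventuallyEq hrr)
    exact fun x => DFunLike.congr_fun h2 x
  -- `Ψ` linearizes `r`: near `a` one has `Ψ ∘ r = L ∘ Ψ`, and `L L = L` makes the derivative of `Ψ`
  -- at `a` the identity.
  set Ψ : E → E := fun y => L (r y - a) + ((y - r y) - L (y - r y)) with hΨ
  have hΨs : SmoothNear 𝓘(𝕜, E) 𝓘(𝕜, E) Ψ a := by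
    rw [smoothNear_iff_contDiffAt] at hr ⊢
    filter_upwards [hr] with y hy
    have h1 : ContDiffAt 𝕜 ∞ (fun y => y - r y) y := contDiffAt_id.sub hy
    exact (L.contDiff.contDiffAt.comp y (hy.sub contDiffAt_const)).add
      (h1.sub (L.contDiff.contDiffAt.comp y h1))
  have hLΨ : ∀ y, L (Ψ y) = L (r y - a) := fun y => by simp [hΨ, hLL]
  have hΨr : ∀ᶠ y in 𝓝 a, Ψ (r y) = L (r y - a) := by
    filter_upwards [hrr] with y hy
    simp [hΨ, hy]
  obtain ⟨e, hae, -, heΨ, -, hes⟩ := exists_local_inverse_of_fderiv_eq_id hΨs (U := univ) (by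
    have h1 : HasFDerivAt (fun y => y - r y) (ContinuousLinearMap.id 𝕜 E - L) a :=
      (hasFDerivAt_id a).sub hLr
    have h2 := (L.hasFDerivAt.comp a (hLr.sub_const a)).add (h1.sub (L.hasFDerivAt.comp a h1))
    convert! h2 using 1
    ext x; simp [hLL]) univ_mem
  have hΨa : Ψ a = 0 := by simp [hΨ, hra]
  have he0 : (0 : E) ∈ e.target := by rw [← hΨa, ← heΨ]; exact e.map_source hae
  have hes0 : e.symm 0 = a := by rw [← hΨa, ← heΨ, e.left_inv hae]
  have hesmooth : SmoothNear 𝓘(𝕜, E) 𝓘(𝕜, E) e.symm 0 :=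
    (contMDiffOn_iff_contDiffOn.2 hes).smoothNear (e.open_target.mem_nhds he0)
  set R := LinearMap.range (L : E →ₗ[𝕜] E) with hR
  set L' : E →L[𝕜] R := LinearMap.toContinuousLinearMap (L : E →ₗ[𝕜] E).rangeRestrict with hL'
  set κ : R ≃L[𝕜] EuclideanSpace 𝕜 (Fin (finrank 𝕜 R)) :=
    ContinuousLinearEquiv.ofFinrankEq (by simp) with hκ
  have hLR : ∀ w : R, L (w : E) = w := by
    rintro ⟨_, x, rfl⟩; exact hLL x
  set f : E → EuclideanSpace 𝕜 (Fin (finrank 𝕜 R)) := fun y => κ (L' (r y - a)) with hf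
  set j : EuclideanSpace 𝕜 (Fin (finrank 𝕜 R)) →L[𝕜] E := R.subtypeL ∘L
    (κ.symm : EuclideanSpace 𝕜 (Fin (finrank 𝕜 R)) →L[𝕜] R) with hj
  have hjf : ∀ y, j (f y) = L (r y - a) := fun y => by
    simp only [hj, hf, ContinuousLinearMap.comp_apply, ContinuousLinearEquiv.coe_coe,
      κ.symm_apply_apply]
    rfl
  have hLj : ∀ v, L (j v) = j v := fun v => hLR (κ.symm v)
  have hfa : f a = 0 := by simp [hf, hra]
  have hg : SmoothNear 𝓘(𝕜, EuclideanSpace 𝕜 (Fin (finrank 𝕜 R))) 𝓘(𝕜, E)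
      (fun v => e.symm (j v)) (f a) :=
    hesmooth.comp (j.contDiff.smoothNear _) (by simp [hfa])
  refine ⟨finrank 𝕜 R, f, fun v => e.symm (j v), ?_, hg, ?_, ?_, ?_⟩
  · rw [smoothNear_iff_contDiffAt] at hr ⊢
    filter_upwards [hr] with y hy
    exact κ.contDiff.contDiffAt.comp y (L'.contDiff.contDiffAt.comp y (hy.sub contDiffAt_const))
  · simp [hfa, hes0]
  · have hga : e.symm (j (f a)) = a := by simp [hfa, hes0]
    have hjc : Tendsto j (𝓝 (f a)) (𝓝 0) := by
      have := j.continuous.tendsto (f a)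
      rwa [hfa, map_zero, ← hfa] at this
    have hrc : ContinuousAt (fun v => r (e.symm (j v))) (f a) :=
      (hr.comp hg hga).continuousAt
    filter_upwards [hjc.eventually (e.open_target.mem_nhds he0), hg.pull hΨr hga,
      hrc.preimage_mem_nhds (e.open_source.mem_nhds (by rwa [hga, hra]))] with v hv h1 h2
    have h3 : Ψ (e.symm (j v)) = j v := by rw [← heΨ, e.right_inv hv]
    -- Both points have the same `Ψ`-coordinate, because `L` fixes the vector `j v` of its range.
    have h4 : r (e.symm (j v)) = e.symm (j v) := by
      apply e.injOn h2 (e.map_target hv)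
      rw [heΨ, heΨ, h1, ← hLΨ, h3, hLj]
    refine ⟨h4, ?_⟩
    have h5 : j (f (e.symm (j v))) = j v := by rw [hjf, ← hLΨ, h3, hLj]
    have hjinj : Function.Injective j := Subtype.val_injective.comp κ.symm.injective
    exact hjinj h5
  · have hrc : ContinuousAt r a := hr.continuousAt
    filter_upwards [hΨr, hrc.preimage_mem_nhds (e.open_source.mem_nhds (by rwa [hra]))]
      with y h1 h2
    rw [hjf, ← h1, ← heΨ, e.left_inv h2]

end NormalForms

/-! ### Subsets that are locally submanifolds -/

section Slices

open Module

variable {𝕜 : Type*} [RCLike 𝕜]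
  {E : Type*} [NormedAddCommGroup E] [NormedSpace 𝕜 E] {H : Type*} [TopologicalSpace H]
  {I : ModelWithCorners 𝕜 E H} {M : Type*} [TopologicalSpace M] [ChartedSpace H M]
  {E' : Type*} [NormedAddCommGroup E'] [NormedSpace 𝕜 E'] {H' : Type*} [TopologicalSpace H']
  {I' : ModelWithCorners 𝕜 E' H'} {M' : Type*} [TopologicalSpace M'] [ChartedSpace H' M']
  {E'' : Type*} [NormedAddCommGroup E''] [NormedSpace 𝕜 E''] {H'' : Type*} [TopologicalSpace H'']
  {I'' : ModelWithCorners 𝕜 E'' H''} {M'' : Type*} [TopologicalSpace M''] [ChartedSpace H'' M'']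

/-- Near `a`, the set `A` is a submanifold of dimension `d`: it is parametrized by a smooth map `g`,
and a smooth map `f` on the ambient manifold restricts to the inverse of `g`. -/
def IsSliceAt (I : ModelWithCorners 𝕜 E H) (A : Set M) (a : M) (d : ℕ) : Prop :=
  ∃ (f : M → EuclideanSpace 𝕜 (Fin d)) (g : EuclideanSpace 𝕜 (Fin d) → M),
    SmoothNear I 𝓘(𝕜, EuclideanSpace 𝕜 (Fin d)) f a ∧
    SmoothNear 𝓘(𝕜, EuclideanSpace 𝕜 (Fin d)) I g (f a) ∧ g (f a) = a ∧
    (∀ᶠ v in 𝓝 (f a), g v ∈ A ∧ f (g v) = v) ∧ ∀ᶠ y in 𝓝[A] a, g (f y) = y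

namespace IsSliceAt

variable {A : Set M} {a : M} {d : ℕ}

theorem mem (h : IsSliceAt I A a d) : a ∈ A := by
  obtain ⟨f, g, -, -, hga, hg, -⟩ := h
  rw [← hga]; exact hg.self_of_nhds.1

/-- Being a submanifold near a point is invariant under local diffeomorphisms between subsets. -/
theorem transfer {B : Set M'} {b : M'} (hB : IsSliceAt I' B b d) {α : M → M'} {β : M' → M}
    (hα : SmoothNear I I' α a) (hβ : SmoothNear I' I β b) (hαa : α a = b) (hβb : β b = a)
    (hA : ∀ᶠ y in 𝓝[A] a, α y ∈ B ∧ β (α y) = y) (hB' : ∀ᶠ y in 𝓝[B] b, β y ∈ A ∧ α (β y) = y) :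
    IsSliceAt I A a d := by
  obtain ⟨f, g, hf, hg, hgb, hgf, hfg⟩ := hB
  subst hαa
  refine ⟨fun y => f (α y), fun v => β (g v), hf.comp hα rfl, hβ.comp hg hgb, ?_, ?_, ?_⟩
  · simp only [hgb, hβb]
  · filter_upwards [hgf, hg.pullWithin hB' hgb] with v hv hv'
    exact ⟨(hv' hv.1).1, by rw [(hv' hv.1).2, hv.2]⟩
  · have h1 := hα.pullWithin hfg rfl
    filter_upwards [hA, nhdsWithin_le_nhds h1] with y hy hy'
    rw [hy' hy.1, hy.2]

theorem of_coords {F : Type*} [NormedAddCommGroup F] [NormedSpace 𝕜 F] [FiniteDimensional 𝕜 F]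
    (hF : finrank 𝕜 F = d) {f : M → F} {g : F → M} (hf : SmoothNear I 𝓘(𝕜, F) f a)
    (hg : SmoothNear 𝓘(𝕜, F) I g (f a)) (hga : g (f a) = a)
    (hgf : ∀ᶠ v in 𝓝 (f a), g v ∈ A ∧ f (g v) = v) (hfg : ∀ᶠ y in 𝓝[A] a, g (f y) = y) :
    IsSliceAt I A a d := by
  let κ : F ≃L[𝕜] EuclideanSpace 𝕜 (Fin d) := ContinuousLinearEquiv.ofFinrankEq (by simp [hF])
  have hκ : SmoothNear 𝓘(𝕜, EuclideanSpace 𝕜 (Fin d)) 𝓘(𝕜, F) κ.symm (κ (f a)) :=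
    κ.symm.contDiff.smoothNear _
  refine ⟨fun y => κ (f y), fun v => g (κ.symm v), (κ.contDiff.smoothNear _).comp hf rfl,
    hg.comp hκ (by simp), by simpa using hga, ?_, ?_⟩
  · filter_upwards [hκ.pull hgf (κ.symm_apply_apply _)] with v hv
    exact ⟨hv.1, by rw [hv.2, κ.apply_symm_apply]⟩
  · filter_upwards [hfg] with y hy
    rw [κ.symm_apply_apply, hy]

/-- The dimension of a submanifold near a point is unique. -/
theorem dim_unique {d' : ℕ} (h : IsSliceAt I A a d) (h' : IsSliceAt I A a d') : d = d' := by
  suffices key : ∀ {d d' : ℕ}, IsSliceAt I A a d → IsSliceAt I A a d' → d ≤ d' from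
    le_antisymm (key h h') (key h' h)
  intro d d' h h'
  obtain ⟨f, g, hf, hg, hga, hgf, hfg⟩ := h
  obtain ⟨f', g', hf', hg', hga', hgf', hfg'⟩ := h'
  have h1 : SmoothNear 𝓘(𝕜, EuclideanSpace 𝕜 (Fin d)) 𝓘(𝕜, EuclideanSpace 𝕜 (Fin d'))
      (fun v => f' (g v)) (f a) := hf'.comp hg hga
  have h2 : SmoothNear 𝓘(𝕜, EuclideanSpace 𝕜 (Fin d')) 𝓘(𝕜, EuclideanSpace 𝕜 (Fin d))
      (fun v => f (g' v)) (f' a) := hf.comp hg' hga'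
  -- The change of parameters has a smooth left inverse, so its derivative is injective and bounds
  -- `d` by `d'`.
  have h3 : ∀ᶠ v in 𝓝 (f a), f (g' (f' (g v))) = v := by
    filter_upwards [hgf, hg.pullWithin hfg' hga] with v hv hv'
    rw [hv' hv.1, hv.2]
  have h3' : (fun w => f (g' w)) ∘ (fun v => f' (g v)) =ᶠ[𝓝 (f a)] _root_.id := h3
  have h4 := HasFDerivAt.of_smoothNear h1
  have h5 := HasFDerivAt.of_smoothNear h2
  have h6 : f' (g (f a)) = f' a := by rw [hga]
  rw [← h6] at h5
  have h7 := (h5.comp (f a) h4).unique ((hasFDerivAt_id (f a)).congr_of_eventuallyEq h3')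
  have h8 : Function.Injective (fderiv 𝕜 (fun v => f' (g v)) (f a)) :=
    Function.LeftInverse.injective (fun x => DFunLike.congr_fun h7 x)
  simpa using LinearMap.finrank_le_finrank_of_injective
    (f := (fderiv 𝕜 (fun v => f' (g v)) (f a)).toLinearMap) h8

/-- `g ∘ f` does this. Precomposition with such a retraction is the standard way below to extend a
map from `A` to a neighbourhood. -/
theorem exists_retraction (h : IsSliceAt I A a d) : ∃ r : M → M, SmoothNear I I r a ∧ r a = a ∧
    (∀ᶠ y in 𝓝 a, r y ∈ A) ∧ ∀ᶠ y in 𝓝[A] a, r y = y := by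
  obtain ⟨f, g, hf, hg, hga, hgf, hfg⟩ := h
  refine ⟨fun y => g (f y), hg.comp hf rfl, hga, ?_, hfg⟩
  filter_upwards [hf.pull hgf rfl] with y hy using hy.1

theorem extChartAt_image [IsManifold I ∞ M] [I.Boundaryless] (A : Set M) (a : M)
    (h : IsSliceAt 𝓘(𝕜, E) ((extChartAt I a).symm ⁻¹' A) (extChartAt I a a) d) :
    IsSliceAt I A a d := by
  refine h.transfer (smoothNear_extChartAt a) (smoothNear_extChartAt_symm a) rfl
    (extChartAt_to_inv a) ?_ ?_
  · filter_upwards [nhdsWithin_le_nhds (eventually_extChartAt_left_inv (I := I) a),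
      self_mem_nhdsWithin] with y hy hyA
    exact ⟨by rw [mem_preimage, hy]; exact hyA, hy⟩
  · filter_upwards [nhdsWithin_le_nhds (eventually_extChartAt_right_inv (I := I) a),
      self_mem_nhdsWithin] with y hy hyA
    exact ⟨hyA, hy⟩

/-- A local smooth retract is a submanifold. -/
theorem of_retraction [IsManifold I ∞ M] [I.Boundaryless] [FiniteDimensional 𝕜 E] (ha : a ∈ A)
    {r : M → M} (hr : SmoothNear I I r a) (hrA : ∀ᶠ y in 𝓝 a, r y ∈ A)
    (hrid : ∀ᶠ y in 𝓝[A] a, r y = y) : ∃ d, IsSliceAt I A a d := by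
  have hra : r a = a := hrid.self_of_nhdsWithin ha
  set ψ := extChartAt I a with hψ
  have hψa : ψ.symm (ψ a) = a := extChartAt_to_inv a
  have hψs : SmoothNear I 𝓘(𝕜, E) ψ a := smoothNear_extChartAt a
  have hψs' : SmoothNear 𝓘(𝕜, E) I ψ.symm (ψ a) := smoothNear_extChartAt_symm a
  have hr1 : SmoothNear 𝓘(𝕜, E) I (fun v => r (ψ.symm v)) (ψ a) := hr.comp hψs' hψa
  have hr2 : SmoothNear 𝓘(𝕜, E) 𝓘(𝕜, E) (fun v => ψ (r (ψ.symm v))) (ψ a) :=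
    hψs.comp hr1 (by rw [hψa, hra])
  have hinv : ∀ᶠ v in 𝓝 (ψ a), ψ.symm (ψ (r (ψ.symm v))) = r (ψ.symm v) :=
    hr1.pull (eventually_extChartAt_left_inv (I := I) a) (by rw [hψa, hra])
  -- `r` takes values in `A`, where it is the identity; so it is idempotent near `a`, and linear
  -- projections are its normal form.
  have hrr : ∀ᶠ v in 𝓝 (ψ a), r (r (ψ.symm v)) = r (ψ.symm v) := by
    filter_upwards [hr1.pullWithin hrid (by rw [hψa, hra]), hψs'.pull hrA hψa] with v h1 h2
    exact h1 h2
  have hψa' : ψ (r (ψ.symm (ψ a))) = ψ a := by rw [hψa, hra]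
  obtain ⟨d, f, g, hf, hg, hga, hgf, hfg⟩ := exists_coordinates_of_idempotent hr2 hψa' (by
    filter_upwards [hinv, hrr] with v h1 h2
    rw [h1, h2])
  refine ⟨d, extChartAt_image A a ⟨f, g, hf, hg, hga, ?_, ?_⟩⟩
  · filter_upwards [hgf, hg.pull hinv hga, hg.pull (hψs'.pull hrA hψa) hga] with v h1 h2 h3
    refine ⟨?_, h1.2⟩
    rw [mem_preimage, ← h1.1, h2]; exact h3
  · filter_upwards [nhdsWithin_le_nhds hfg, nhdsWithin_le_nhds (hψs'.pullWithin hrid hψa),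
      nhdsWithin_le_nhds (eventually_extChartAt_right_inv (I := I) a), self_mem_nhdsWithin]
      with v h1 h2 h3 h4
    rw [h1, h2 h4, h3]

theorem prod_univ {F : Type*} [NormedAddCommGroup F] [NormedSpace 𝕜 F] [FiniteDimensional 𝕜 F]
    (h : IsSliceAt I A a d) (w : F) :
    IsSliceAt (I.prod 𝓘(𝕜, F)) {y : M × F | y.1 ∈ A} (a, w) (d + finrank 𝕜 F) := by
  obtain ⟨f, g, hf, hg, hga, hgf, hfg⟩ := h
  have hfst : SmoothNear 𝓘(𝕜, EuclideanSpace 𝕜 (Fin d) × F) 𝓘(𝕜, EuclideanSpace 𝕜 (Fin d))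
      Prod.fst (f a, w) := contDiff_fst.smoothNear _
  refine of_coords (F := EuclideanSpace 𝕜 (Fin d) × F) (by simp)
    (f := fun y => (f y.1, y.2)) (g := fun v => (g v.1, v.2))
    ((hf.comp SmoothNear.fst rfl).prodMk_space SmoothNear.snd)
    ((hg.comp hfst rfl).prodMk (contDiff_snd.smoothNear _)) (by simp [hga]) ?_ ?_
  · filter_upwards [hfst.pull hgf rfl] with v hv
    exact ⟨hv.1, by rw [hv.2]⟩
  · have h1 := (SmoothNear.fst (I := I) (I' := 𝓘(𝕜, F)) (a := (a, w))).pullWithin hfg rfl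
    filter_upwards [nhdsWithin_le_nhds h1, self_mem_nhdsWithin] with y hy hyA
    rw [hy hyA]

theorem univ [IsManifold I ∞ M] [I.Boundaryless] [FiniteDimensional 𝕜 E] (a : M) :
    IsSliceAt I univ a (finrank 𝕜 E) := by
  refine of_coords rfl (smoothNear_extChartAt a) (smoothNear_extChartAt_symm a)
    (extChartAt_to_inv a) ?_ ?_
  · filter_upwards [eventually_extChartAt_right_inv (I := I) a] with v hv using ⟨trivial, hv⟩
  · exact nhdsWithin_le_nhds (eventually_extChartAt_left_inv (I := I) a)

end IsSliceAt

/-! ### Submersions -/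

/-- Near `x`, the map `f` is the projection of a product: `G` and `h` are smooth maps such that
`y ↦ (f y, h y)` and `G` are mutually inverse. -/
def IsProjectionAt (I : ModelWithCorners 𝕜 E H) (I' : ModelWithCorners 𝕜 E' H') (f : M → M') (x : M)
    (k : ℕ) : Prop :=
  ∃ (G : M' × EuclideanSpace 𝕜 (Fin k) → M) (h : M → EuclideanSpace 𝕜 (Fin k)),
    SmoothNear (I'.prod 𝓘(𝕜, EuclideanSpace 𝕜 (Fin k))) I G (f x, h x) ∧
    SmoothNear I 𝓘(𝕜, EuclideanSpace 𝕜 (Fin k)) h x ∧ G (f x, h x) = x ∧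
    (∀ᶠ y in 𝓝 (f x, h x), f (G y) = y.1 ∧ h (G y) = y.2) ∧ ∀ᶠ y in 𝓝 x, G (f y, h y) = y

/-- In adapted charts a submersion is a linear projection with some complement; counting dimensions
replaces the complement by a Euclidean space. The resulting `k` is the same at all points, which
later gives quotients and images a constant dimension. -/
theorem Manifold.IsSubmersion.isProjectionAt [I.Boundaryless] [I'.Boundaryless]
    [FiniteDimensional 𝕜 E] [FiniteDimensional 𝕜 E'] {f : M → M'}
    (hf : Manifold.IsSubmersion I I' ∞ f) (x : M) :
    IsProjectionAt I I' f x (finrank 𝕜 E - finrank 𝕜 E') := by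
  have h := hf.isSubmersionOfComplement_complement x
  set e := h.domChart
  set c := h.codChart
  set eq := h.equiv with heq
  have he := h.domChart_mem_maximalAtlas
  have hc := h.codChart_mem_maximalAtlas
  have hFfin : FiniteDimensional 𝕜 hf.complement := by
    have hinj : Function.Injective ((eq.symm : _ →ₗ[𝕜] E) ∘ₗ LinearMap.inr 𝕜 E' hf.complement) :=
      eq.symm.injective.comp LinearMap.inr_injective
    exact FiniteDimensional.of_injective _ hinj
  have hdim : finrank 𝕜 hf.complement = finrank 𝕜 E - finrank 𝕜 E' := by
    have := eq.toLinearEquiv.finrank_eq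
    rw [Module.finrank_prod] at this
    omega
  set k := finrank 𝕜 E - finrank 𝕜 E' with hk
  let κ : hf.complement ≃L[𝕜] EuclideanSpace 𝕜 (Fin k) :=
    ContinuousLinearEquiv.ofFinrankEq (by simp [hdim])
  have hx : x ∈ e.source := h.mem_domChart_source
  have hfx : f x ∈ c.source := h.mem_codChart_source
  have hwritten := h.writtenInCharts
  have hfe : ∀ y ∈ e.source, f y ∈ c.source := fun y hy => h.source_subset_preimage_source hy
  have hces : ∀ y ∈ e.source, (eq (e.extend I y)).1 = c.extend I' (f y) := by
    intro y hy
    have h1 := hwritten (x := e.extend I y)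
      ((e.extend I).map_source (by rwa [e.extend_source]))
    simp only [Function.comp_apply] at h1
    rw [e.extend_left_inv hy] at h1
    exact h1.symm
  set L : M → EuclideanSpace 𝕜 (Fin k) := fun y => κ (eq (e.extend I y)).2 with hL
  set w : M' × EuclideanSpace 𝕜 (Fin k) → E :=
    fun y => eq.symm (c.extend I' y.1, κ.symm y.2) with hw
  have hwx : w (f x, L x) = e.extend I x := by
    simp only [hw, hL, ← hces x hx, κ.symm_apply_apply, Prod.mk.eta, eq.symm_apply_apply]
  have hws : SmoothNear (I'.prod 𝓘(𝕜, EuclideanSpace 𝕜 (Fin k))) 𝓘(𝕜, E) w (f x, L x) := by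
    have h1 : SmoothNear (I'.prod 𝓘(𝕜, EuclideanSpace 𝕜 (Fin k))) 𝓘(𝕜, E')
      (fun y => c.extend I' y.1) (f x, L x) := (smoothNear_extend hc hfx).comp SmoothNear.fst rfl
    have h2 : SmoothNear (I'.prod 𝓘(𝕜, EuclideanSpace 𝕜 (Fin k))) 𝓘(𝕜, hf.complement)
      (fun y => κ.symm y.2) (f x, L x) := (κ.symm.contDiff.smoothNear _).comp SmoothNear.snd rfl
    exact (eq.symm.contDiff.smoothNear (c.extend I' (f x), κ.symm (L x))).comp
      (h1.prodMk_space h2) rfl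
  have htgt : e.extend I x ∈ (e.extend I).target :=
    (e.extend I).map_source (by rwa [e.extend_source])
  have hLs : SmoothNear I 𝓘(𝕜, EuclideanSpace 𝕜 (Fin k)) L x := by
    have h1 : ContDiff 𝕜 ∞ (fun v : E => κ (eq v).2) :=
      κ.contDiff.comp (contDiff_snd.comp eq.contDiff)
    exact (h1.smoothNear (e.extend I x)).comp (smoothNear_extend he hx) rfl
  refine ⟨fun y => (e.extend I).symm (w y), L,
    (smoothNear_extend_symm he htgt).comp hws hwx, hLs, ?_, ?_, ?_⟩
  · simp only [hwx]; exact e.extend_left_inv hx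
  · have h1 := hws.pull (e.isOpen_extend_target.mem_nhds htgt) hwx
    have h2 : ∀ᶠ y in 𝓝 (f x, L x), y.1 ∈ c.source :=
      continuousAt_fst.preimage_mem_nhds (c.open_source.mem_nhds hfx)
    filter_upwards [h1, h2] with y hy hy'
    have h3 : (e.extend I).symm (w y) ∈ e.source := by
      rw [← e.extend_source (I := I)]; exact (e.extend I).map_target hy
    have h4 : e.extend I ((e.extend I).symm (w y)) = w y := (e.extend I).right_inv hy
    constructor
    · have h5 := hces _ h3
      rw [h4] at h5
      simp only [hw, eq.apply_symm_apply] at h5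
      have hinj : InjOn (c.extend I') c.source := by
        rw [← c.extend_source (I := I')]; exact (c.extend I').injOn
      exact (hinj hy' (hfe _ h3) h5).symm
    · simp only [hL]
      rw [h4]
      simp [hw]
  · filter_upwards [e.open_source.mem_nhds hx] with y hy
    have h1 : w (f y, L y) = e.extend I y := by
      simp only [hw, hL, ← hces y hy, κ.symm_apply_apply, Prod.mk.eta, eq.symm_apply_apply]
    rw [h1]; exact e.extend_left_inv hy

namespace IsProjectionAt

variable {f : M → M'} {x : M} {k : ℕ}

/-- A smooth map `κ` that moves points near `x` to prescribed fibres of `f`. -/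
theorem exists_transport (h : IsProjectionAt I I' f x k) :
    ∃ κ : M' × M → M, SmoothNear (I'.prod I) I κ (f x, x) ∧ κ (f x, x) = x ∧
      (∀ᶠ y in 𝓝 (f x, x), f (κ y) = y.1) ∧ ∀ᶠ y in 𝓝 x, κ (f y, y) = y := by
  obtain ⟨G, L, hG, hL, hGx, hGL, hLG⟩ := h
  have h1 : SmoothNear (I'.prod I) (I'.prod 𝓘(𝕜, EuclideanSpace 𝕜 (Fin k)))
      (fun y : M' × M => (y.1, L y.2)) (f x, x) :=
    SmoothNear.fst.prodMk (hL.comp SmoothNear.snd rfl)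
  refine ⟨fun y => G (y.1, L y.2), hG.comp h1 rfl, hGx, ?_, hLG⟩
  filter_upwards [h1.pull hGL rfl] with y hy using hy.1

/-- Local sections through a point. -/
theorem exists_section (h : IsProjectionAt I I' f x k) :
    ∃ τ : M' → M, SmoothNear I' I τ (f x) ∧ τ (f x) = x ∧ ∀ᶠ m in 𝓝 (f x), f (τ m) = m := by
  obtain ⟨κ, hκ, hκx, hfκ, -⟩ := h.exists_transport
  have h1 : SmoothNear I' (I'.prod I) (fun m => (m, x)) (f x) := SmoothNear.id.prodMk .const
  exact ⟨fun m => κ (m, x), hκ.comp h1 rfl, hκx, h1.pull hfκ rfl⟩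

/-- The fibre product of a submanifold with a submersion. -/
theorem isSliceAt_fiberProduct (h : IsProjectionAt I I' f x k) {A : Set M''} {z : M''} {d : ℕ}
    (hA : IsSliceAt I'' A z d) {φ : M'' → M'} (hφ : SmoothNear I'' I' φ z) (hz : φ z = f x) :
    IsSliceAt (I''.prod I) {y : M'' × M | y.1 ∈ A ∧ φ y.1 = f y.2} (z, x) (d + k) := by
  obtain ⟨G, L, hG, hL, hGx, hGL, hLG⟩ := h
  have h0 := hA.prod_univ (L x)
  rw [finrank_euclideanSpace_fin] at h0
  have h1 : SmoothNear (I''.prod 𝓘(𝕜, EuclideanSpace 𝕜 (Fin k)))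
      (I'.prod 𝓘(𝕜, EuclideanSpace 𝕜 (Fin k)))
      (fun y : M'' × EuclideanSpace 𝕜 (Fin k) => (φ y.1, y.2)) (z, L x) :=
    (hφ.comp SmoothNear.fst rfl).prodMk SmoothNear.snd
  -- The base component of `x` is forced to be `φ z`, so only the fibre coordinate `L x` is free:
  -- the fibre product is locally `A` times the fibre.
  refine h0.transfer (α := fun y => (y.1, L y.2)) (β := fun y => (y.1, G (φ y.1, y.2)))
    (SmoothNear.fst.prodMk (hL.comp SmoothNear.snd rfl))
    (SmoothNear.fst.prodMk (hG.comp h1 (by rw [hz]))) rfl (by simp only [hz, hGx]) ?_ ?_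
  · have h2 := (SmoothNear.snd (I := I'') (I' := I) (a := (z, x))).pull hLG rfl
    filter_upwards [nhdsWithin_le_nhds h2, self_mem_nhdsWithin] with y hy hyA
    refine ⟨hyA.1, ?_⟩
    simp only [hyA.2, hy]
  · have h2 := h1.pull hGL (by rw [hz])
    filter_upwards [nhdsWithin_le_nhds h2, self_mem_nhdsWithin] with y hy hyA
    exact ⟨⟨hyA, hy.1.symm⟩, by rw [hy.2]⟩

end IsProjectionAt

end Slices

/-! ### Immersions and submersions from local left and right inverses -/

section Straightening

open Module

variable {𝕜 : Type*} [RCLike 𝕜]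

/-- An injective linear map is the inclusion of a factor of a product. -/
theorem exists_equiv_prod_of_injective {V E : Type*} [NormedAddCommGroup V] [NormedSpace 𝕜 V]
    [FiniteDimensional 𝕜 V] [NormedAddCommGroup E] [NormedSpace 𝕜 E] [FiniteDimensional 𝕜 E]
    {i : V →L[𝕜] E} (hi : Function.Injective i) :
    ∃ e : (V × EuclideanSpace 𝕜 (Fin (finrank 𝕜 E - finrank 𝕜 V))) ≃L[𝕜] E,
      ∀ u, e (u, 0) = i u := by
  obtain ⟨S, hS, -⟩ := exists_generalized_inverse i
  have hSi : ∀ u, S (i u) = u := fun u => hi (hS u)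
  have hsurj : LinearMap.range (S : E →ₗ[𝕜] V) = ⊤ :=
    LinearMap.range_eq_top.2 fun u => ⟨i u, hSi u⟩
  have hdim : finrank 𝕜 (LinearMap.ker (S : E →ₗ[𝕜] V)) = finrank 𝕜 E - finrank 𝕜 V := by
    have := LinearMap.finrank_range_add_finrank_ker (S : E →ₗ[𝕜] V)
    rw [hsurj, finrank_top] at this
    omega
  let κ : EuclideanSpace 𝕜 (Fin (finrank 𝕜 E - finrank 𝕜 V)) ≃L[𝕜] LinearMap.ker (S : E →ₗ[𝕜] V) :=
    ContinuousLinearEquiv.ofFinrankEq (by simp [hdim])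
  have hSκ : ∀ c, S (κ c : E) = 0 := fun c => (κ c).2
  let T : (V × EuclideanSpace 𝕜 (Fin (finrank 𝕜 E - finrank 𝕜 V))) ≃ₗ[𝕜] E :=
    { toFun := fun y => i y.1 + (κ y.2 : E)
      map_add' := fun x y => by simp; abel
      map_smul' := fun c y => by simp
      invFun := fun x => (S x, κ.symm ⟨x - i (S x), by simp [hSi]⟩)
      left_inv := fun y => by
        ext1
        · simp [hSi, hSκ]
        · simp only [map_add, hSi, hSκ, add_zero, add_sub_cancel_left]
          exact κ.symm_apply_apply _
      right_inv := fun x => by simp }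
  exact ⟨T.toContinuousLinearEquiv, fun u => by simp [T]⟩

/-- A surjective linear map is the projection of a product. -/
theorem exists_equiv_prod_of_surjective {V E : Type*} [NormedAddCommGroup V] [NormedSpace 𝕜 V]
    [FiniteDimensional 𝕜 V] [NormedAddCommGroup E] [NormedSpace 𝕜 E] [FiniteDimensional 𝕜 E]
    {S : E →L[𝕜] V} (hS : Function.Surjective S) :
    ∃ e : E ≃L[𝕜] (V × EuclideanSpace 𝕜 (Fin (finrank 𝕜 E - finrank 𝕜 V))),
      ∀ x, (e x).1 = S x := by
  obtain ⟨i, hi⟩ := LinearMap.exists_rightInverse_of_surjective (S : E →ₗ[𝕜] V)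
    (LinearMap.range_eq_top.2 hS)
  have hSi : ∀ u, S (i u) = u := fun u => LinearMap.congr_fun hi u
  have hdim : finrank 𝕜 (LinearMap.ker (S : E →ₗ[𝕜] V)) = finrank 𝕜 E - finrank 𝕜 V := by
    have := LinearMap.finrank_range_add_finrank_ker (S : E →ₗ[𝕜] V)
    rw [LinearMap.range_eq_top.2 hS, finrank_top] at this
    omega
  let κ : EuclideanSpace 𝕜 (Fin (finrank 𝕜 E - finrank 𝕜 V)) ≃L[𝕜] LinearMap.ker (S : E →ₗ[𝕜] V) :=
    ContinuousLinearEquiv.ofFinrankEq (by simp [hdim])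
  have hSκ : ∀ c, S (κ c : E) = 0 := fun c => (κ c).2
  let T : (V × EuclideanSpace 𝕜 (Fin (finrank 𝕜 E - finrank 𝕜 V))) ≃ₗ[𝕜] E :=
    { toFun := fun y => i y.1 + (κ y.2 : E)
      map_add' := fun x y => by simp; abel
      map_smul' := fun c y => by simp
      invFun := fun x => (S x, κ.symm ⟨x - i (S x), by simp [hSi]⟩)
      left_inv := fun y => by
        ext1
        · simp [hSi, hSκ]
        · simp only [map_add, hSi, hSκ, add_zero, add_sub_cancel_left]
          exact κ.symm_apply_apply _
      right_inv := fun x => by simp }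
  exact ⟨T.symm.toContinuousLinearEquiv, fun u => rfl⟩

variable
  {E : Type*} [NormedAddCommGroup E] [NormedSpace 𝕜 E] {H : Type*} [TopologicalSpace H]
  {I : ModelWithCorners 𝕜 E H} {M : Type*} [TopologicalSpace M] [ChartedSpace H M]
  {E' : Type*} [NormedAddCommGroup E'] [NormedSpace 𝕜 E'] {H' : Type*} [TopologicalSpace H']
  {I' : ModelWithCorners 𝕜 E' H'} {M' : Type*} [TopologicalSpace M'] [ChartedSpace H' M']

/-- Composing a chart with a local diffeomorphism of the model space gives a chart. -/
theorem exists_mem_maximalAtlas_trans [IsManifold I ∞ M] [I.Boundaryless]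
    {c : OpenPartialHomeomorph M H} (hc : c ∈ IsManifold.maximalAtlas I ∞ M)
    {e : OpenPartialHomeomorph E E} (he : ContDiffOn 𝕜 ∞ e e.source)
    (he' : ContDiffOn 𝕜 ∞ e.symm e.target) :
    ∃ c' ∈ IsManifold.maximalAtlas I ∞ M, c'.source = c.source ∩ c.extend I ⁻¹' e.source ∧
      ∀ y, c'.extend I y = e (c.extend I y) := by
  set J := I.toHomeomorph with hJ
  refine ⟨c ≫ₕ (J.toOpenPartialHomeomorph ≫ₕ e ≫ₕ J.symm.toOpenPartialHomeomorph), ?_, ?_, ?_⟩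
  · apply OpenPartialHomeomorph.mem_maximalAtlas_of_contMDiffOn
    · refine I.contMDiffOn_symm.comp (t := range I) ((contMDiffOn_iff_contDiffOn.2 he).comp
        (I.contMDiff.comp_contMDiffOn ((contMDiffOn_of_mem_maximalAtlas hc).mono ?_)) ?_) ?_
      · intro y hy; simp at hy; exact hy.1
      · intro y hy; simp at hy; exact hy.2
      · intro y hy; simp [I.range_eq_univ]
    · refine (contMDiffOn_symm_of_mem_maximalAtlas hc).comp (t := c.target)
        (I.contMDiffOn_symm.comp (t := range I)
        ((contMDiffOn_iff_contDiffOn.2 he').comp I.contMDiff.contMDiffOn ?_) ?_) ?_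
      · intro y hy
        simp only [OpenPartialHomeomorph.trans_target, mem_inter_iff, mem_preimage] at hy
        simpa using hy.1
      · intro y hy; simp [I.range_eq_univ]
      · intro y hy
        simp only [OpenPartialHomeomorph.trans_target, mem_inter_iff, mem_preimage] at hy
        exact hy.2
  · ext y
    simp only [OpenPartialHomeomorph.trans_source, Homeomorph.toOpenPartialHomeomorph_source,
      mem_inter_iff, mem_preimage, mem_univ, and_true, true_and,
      Homeomorph.toOpenPartialHomeomorph_apply]
    rfl
  · intro y
    exact I.right_inv (by rw [I.range_eq_univ]; trivial)

theorem hasFDerivAt_leftInverse {V W : Type*} [NormedAddCommGroup V] [NormedSpace 𝕜 V]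
    [NormedAddCommGroup W] [NormedSpace 𝕜 W] {f : V → W} {g : W → V} {a : V}
    {b : W} (hf : SmoothNear 𝓘(𝕜, V) 𝓘(𝕜, W) f a) (hg : SmoothNear 𝓘(𝕜, W) 𝓘(𝕜, V) g b)
    (hab : f a = b) (h : ∀ᶠ y in 𝓝 a, g (f y) = y) (x : V) :
    fderiv 𝕜 g b (fderiv 𝕜 f a x) = x := by
  subst hab
  have h' : g ∘ f =ᶠ[𝓝 a] _root_.id := h
  exact DFunLike.congr_fun (((HasFDerivAt.of_smoothNear hg).comp a
    (HasFDerivAt.of_smoothNear hf)).unique ((hasFDerivAt_id a).congr_of_eventuallyEq h')) x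

variable [IsManifold I ∞ M] [I.Boundaryless] [FiniteDimensional 𝕜 E]
  [IsManifold I' ∞ M'] [I'.Boundaryless] [FiniteDimensional 𝕜 E']

/-- A smooth map with a local smooth left inverse is an immersion. -/
theorem isImmersionAtOfComplement_of_leftInverse {f : M → M'} {g : M' → M} {a : M}
    (hf : SmoothNear I I' f a) (hg : SmoothNear I' I g (f a)) (hgf : ∀ᶠ y in 𝓝 a, g (f y) = y) :
    Manifold.IsImmersionAtOfComplement
      (EuclideanSpace 𝕜 (Fin (finrank 𝕜 E' - finrank 𝕜 E))) I I' ∞ f a := by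
  have hga : g (f a) = a := hgf.self_of_nhds
  set χ := extChartAt I a with hχ
  set ψ := extChartAt I' (f a) with hψ
  have hχa : χ.symm (χ a) = a := extChartAt_to_inv a
  have hψa : ψ.symm (ψ (f a)) = f a := extChartAt_to_inv (f a)
  have hf1 : SmoothNear 𝓘(𝕜, E) I' (fun v => f (χ.symm v)) (χ a) :=
    hf.comp (smoothNear_extChartAt_symm a) hχa
  have hf2 : SmoothNear 𝓘(𝕜, E) 𝓘(𝕜, E') (fun v => ψ (f (χ.symm v))) (χ a) :=
    (smoothNear_extChartAt (I := I') (f a)).comp hf1 (by rw [hχa])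
  have hg2 : SmoothNear 𝓘(𝕜, E') 𝓘(𝕜, E) (fun v => χ (g (ψ.symm v))) (ψ (f a)) :=
    (smoothNear_extChartAt (I := I) a).comp (hg.comp (smoothNear_extChartAt_symm (f a)) hψa)
      (by rw [hψa, hga])
  have hgf2 : ∀ᶠ v in 𝓝 (χ a), χ (g (ψ.symm (ψ (f (χ.symm v))))) = v := by
    filter_upwards [hf1.pull (eventually_extChartAt_left_inv (I := I') (f a)) (by rw [hχa]),
      (smoothNear_extChartAt_symm (I := I) a).pull hgf hχa,
      eventually_extChartAt_right_inv (I := I) a] with v h1 h2 h3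
    rw [h1, h2, h3]
  set i := fderiv 𝕜 (fun v => ψ (f (χ.symm v))) (χ a) with hi
  have hinj : Function.Injective i := by
    have := hasFDerivAt_leftInverse hf2 hg2 (by rw [hχa]) hgf2
    exact Function.LeftInverse.injective this
  obtain ⟨eq, heq⟩ := exists_equiv_prod_of_injective hinj
  set K := EuclideanSpace 𝕜 (Fin (finrank 𝕜 E' - finrank 𝕜 E))
  -- `Φ` extends `f` in charts from the factor `E` by adding the complementary coordinates. Since
  -- `eq (u, 0) = i u`, its derivative at `y₀` is the identity, and its inverse straightens `f` to
  -- the inclusion.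
  set Φ : E' → E' := fun y => ψ (f (χ.symm (eq.symm y).1)) + eq (0, (eq.symm y).2) with hΦ
  set y₀ := eq (χ a, 0) with hy₀
  have hΦ0 : ∀ u, Φ (eq (u, 0)) = ψ (f (χ.symm u)) := fun u => by
    simp only [hΦ, eq.symm_apply_apply]
    rw [Prod.mk_zero_zero, map_zero, add_zero]
  have hΦs : SmoothNear 𝓘(𝕜, E') 𝓘(𝕜, E') Φ y₀ := by
    have h1 : ContDiff 𝕜 ∞ fun y : E' => (eq.symm y).1 := contDiff_fst.comp eq.symm.contDiff
    have h2 : ContDiff 𝕜 ∞ fun y : E' => eq (0, (eq.symm y).2) :=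
      eq.contDiff.comp (contDiff_const.prodMk (contDiff_snd.comp eq.symm.contDiff))
    have h3 := hf2.comp (h1.smoothNear y₀) (by simp [hy₀])
    rw [smoothNear_iff_contDiffAt] at h3 ⊢
    filter_upwards [h3] with y hy
    exact hy.add h2.contDiffAt
  have hΦd : HasFDerivAt Φ (ContinuousLinearMap.id 𝕜 E') y₀ := by
    have h1 := (ContinuousLinearMap.fst 𝕜 E K ∘L
      (eq.symm : E' →L[𝕜] E × K)).hasFDerivAt (x := y₀)
    have h2 := ((eq : E × K →L[𝕜] E') ∘L (ContinuousLinearMap.inr 𝕜 E K) ∘L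
      (ContinuousLinearMap.snd 𝕜 E K) ∘L (eq.symm : E' →L[𝕜] E × K)).hasFDerivAt (x := y₀)
    have h3 : HasFDerivAt (fun v => ψ (f (χ.symm v))) i ((eq.symm y₀).1) := by
      simp only [hy₀, eq.symm_apply_apply]
      exact HasFDerivAt.of_smoothNear hf2
    have h4 := (h3.comp y₀ h1).add h2
    convert! h4 using 1
    ext y
    obtain ⟨y, rfl⟩ := eq.surjective y
    simp only [ContinuousLinearMap.id_apply, _root_.add_apply,
      ContinuousLinearMap.comp_apply, ContinuousLinearEquiv.coe_coe, eq.symm_apply_apply,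
      ContinuousLinearMap.coe_fst', ContinuousLinearMap.coe_snd', ContinuousLinearMap.inr_apply]
    rw [← heq, ← map_add]
    simp
  obtain ⟨e, hye, -, heΦ, hes, hes'⟩ := exists_local_inverse_of_fderiv_eq_id hΦs hΦd univ_mem
  obtain ⟨c', hc', hc's, hc'e⟩ := exists_mem_maximalAtlas_trans (I := I') (e := e.symm)
    (IsManifold.chart_mem_maximalAtlas (n := ∞) (f a)) hes' hes
  -- The domain chart is shrunk to these points so that `e.symm` cancels `Φ` along the whole chart.
  have hsrc : ∀ᶠ y in 𝓝 a, eq (χ y, 0) ∈ e.source := by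
    have h1 : ContinuousAt (fun y => eq (χ y, 0)) a := by
      have := (smoothNear_extChartAt (I := I) a).continuousAt
      exact eq.continuous.continuousAt.comp (this.prodMk continuousAt_const)
    exact h1.preimage_mem_nhds (e.open_source.mem_nhds hye)
  obtain ⟨V, hV, hVo, haV⟩ := eventually_nhds_iff.1 hsrc
  refine Manifold.IsImmersionAtOfComplement.mk_of_continuousAt hf.continuousAt eq
    ((chartAt H a).restr V) c' ?_ ?_ ?_ hc' ?_
  · rw [(chartAt H a).restr_source' V hVo]; exact ⟨mem_chart_source H a, haV⟩
  · rw [hc's]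
    refine ⟨mem_chart_source H' (f a), ?_⟩
    have h1 : (chartAt H' (f a)).extend I' (f a) = e y₀ := by
      rw [heΦ, hΦ0, hχa]; rfl
    rw [mem_preimage, h1]
    exact e.map_source hye
  · exact restr_mem_maximalAtlas _ (IsManifold.chart_mem_maximalAtlas a) hVo
  · intro u hu
    have hu1 := (((chartAt H a).restr V).extend I).map_target hu
    rw [OpenPartialHomeomorph.extend_source, (chartAt H a).restr_source' V hVo] at hu1
    have hu2 : χ ((((chartAt H a).restr V).extend I).symm u) = u :=
      (((chartAt H a).restr V).extend I).right_inv hu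
    have hu3 := hV _ hu1.2
    rw [hu2] at hu3
    simp only [Function.comp_apply]
    rw [hc'e]
    have h1 : (chartAt H' (f a)).extend I' (f ((((chartAt H a).restr V).extend I).symm u)) =
        e (eq (u, 0)) := by
      rw [heΦ, hΦ0]; rfl
    rw [h1, e.left_inv hu3]

/-- A smooth map with a local smooth section through a point is a submersion there. -/
theorem isSubmersionAtOfComplement_of_section {f : M → M'} {g : M' → M} {a : M}
    (hf : SmoothNear I I' f a) (hg : SmoothNear I' I g (f a)) (hga : g (f a) = a)
    (hfg : ∀ᶠ y in 𝓝 (f a), f (g y) = y) :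
    Manifold.IsSubmersionAtOfComplement
      (EuclideanSpace 𝕜 (Fin (finrank 𝕜 E - finrank 𝕜 E'))) I I' ∞ f a := by
  set χ := extChartAt I a with hχ
  set ψ := extChartAt I' (f a) with hψ
  have hχa : χ.symm (χ a) = a := extChartAt_to_inv a
  have hψa : ψ.symm (ψ (f a)) = f a := extChartAt_to_inv (f a)
  have hf2 : SmoothNear 𝓘(𝕜, E) 𝓘(𝕜, E') (fun v => ψ (f (χ.symm v))) (χ a) :=
    (smoothNear_extChartAt (I := I') (f a)).comp
      (hf.comp (smoothNear_extChartAt_symm a) hχa) (by rw [hχa])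
  have hg1 : SmoothNear 𝓘(𝕜, E') I (fun v => g (ψ.symm v)) (ψ (f a)) :=
    hg.comp (smoothNear_extChartAt_symm (f a)) hψa
  have hg2 : SmoothNear 𝓘(𝕜, E') 𝓘(𝕜, E) (fun v => χ (g (ψ.symm v))) (ψ (f a)) :=
    (smoothNear_extChartAt (I := I) a).comp hg1 (by rw [hψa, hga])
  have hfg2 : ∀ᶠ v in 𝓝 (ψ (f a)), ψ (f (χ.symm (χ (g (ψ.symm v))))) = v := by
    filter_upwards [hg1.pull (eventually_extChartAt_left_inv (I := I) a) (by rw [hψa, hga]),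
      (smoothNear_extChartAt_symm (I := I') (f a)).pull hfg hψa,
      eventually_extChartAt_right_inv (I := I') (f a)] with v h1 h2 h3
    rw [h1, h2, h3]
  set S := fderiv 𝕜 (fun v => ψ (f (χ.symm v))) (χ a) with hS
  have hsurj : Function.Surjective S := by
    have := hasFDerivAt_leftInverse hg2 hf2 (by rw [hψa, hga]) hfg2
    exact Function.RightInverse.surjective this
  obtain ⟨eq, heq⟩ := exists_equiv_prod_of_surjective hsurj
  set K := EuclideanSpace 𝕜 (Fin (finrank 𝕜 E - finrank 𝕜 E'))
  -- The component of `y` along the range of the projection is replaced by the value of `f`; the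
  -- derivative remains the identity because `eq` splits `S`.
  set Φ : E → E := fun y => eq.symm (ψ (f (χ.symm y)), (eq y).2) with hΦ
  have hΦs : SmoothNear 𝓘(𝕜, E) 𝓘(𝕜, E) Φ (χ a) := by
    have h1 : ContDiff 𝕜 ∞ fun y : E => (eq y).2 := contDiff_snd.comp eq.contDiff
    exact (eq.symm.contDiff.smoothNear (ψ (f (χ.symm (χ a))), (eq (χ a)).2)).comp
      (hf2.prodMk_space (h1.smoothNear _)) rfl
  have hΦd : HasFDerivAt Φ (ContinuousLinearMap.id 𝕜 E) (χ a) := by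
    have h1 := (ContinuousLinearMap.snd 𝕜 E' K ∘L
      (eq : E →L[𝕜] E' × K)).hasFDerivAt (x := χ a)
    have h4 := eq.symm.hasFDerivAt.comp (χ a) ((HasFDerivAt.of_smoothNear hf2).prodMk h1)
    convert! h4 using 1
    ext y
    simp only [ContinuousLinearMap.id_apply, ContinuousLinearMap.comp_apply,
      ContinuousLinearMap.prod_apply, ContinuousLinearEquiv.coe_coe,
      ContinuousLinearMap.coe_snd']
    rw [← hS, ← heq]
    simp
  obtain ⟨e, hye, -, heΦ, hes, hes'⟩ := exists_local_inverse_of_fderiv_eq_id hΦs hΦd univ_mem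
  obtain ⟨c', hc', hc's, hc'e⟩ := exists_mem_maximalAtlas_trans (I := I) (e := e)
    (IsManifold.chart_mem_maximalAtlas (n := ∞) a) hes hes'
  refine Manifold.IsSubmersionAtOfComplement.mk_of_continuousAt hf.continuousAt eq
    c' (chartAt H' (f a)) ?_ (mem_chart_source H' (f a)) hc'
    (IsManifold.chart_mem_maximalAtlas (n := ∞) (f a)) ?_
  · rw [hc's]
    exact ⟨mem_chart_source H a, hye⟩
  · intro u hu
    have hu1 := (c'.extend I).map_target hu
    rw [OpenPartialHomeomorph.extend_source, hc's] at hu1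
    have hu2 : c'.extend I ((c'.extend I).symm u) = u := (c'.extend I).right_inv hu
    rw [hc'e, heΦ] at hu2
    have hu3 : χ.symm ((chartAt H a).extend I ((c'.extend I).symm u)) = (c'.extend I).symm u :=
      χ.left_inv (by rw [extChartAt_source]; exact hu1.1)
    simp only [Function.comp_apply]
    conv_rhs => rw [← hu2]
    simp only [hΦ, eq.apply_symm_apply, hu3]
    rfl

end Straightening

/-! ### Manifold structures from slices -/

section Structures

open Module

variable {𝕜 : Type*} [RCLike 𝕜]
  {E : Type*} [NormedAddCommGroup E] [NormedSpace 𝕜 E] {H : Type*} [TopologicalSpace H]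
  {I : ModelWithCorners 𝕜 E H} {M : Type*} [TopologicalSpace M] [ChartedSpace H M]
  {E' : Type*} [NormedAddCommGroup E'] [NormedSpace 𝕜 E'] {H' : Type*} [TopologicalSpace H']
  {I' : ModelWithCorners 𝕜 E' H'} {M' : Type*} [TopologicalSpace M'] [ChartedSpace H' M']

/-- The charted space defined by a family of charts, one around each point. -/
@[reducible] def chartedSpaceOfCharts {Q H : Type*} [TopologicalSpace Q] [TopologicalSpace H]
    (χ : Q → OpenPartialHomeomorph Q H) (hχ : ∀ q, q ∈ (χ q).source) : ChartedSpace H Q where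
  atlas := range χ
  chartAt := χ
  mem_chart_source := hχ
  chart_mem_atlas := fun q => ⟨q, rfl⟩

theorem isManifold_chartedSpaceOfCharts {Q : Type*} [TopologicalSpace Q]
    (χ : Q → OpenPartialHomeomorph Q E) (hχ : ∀ q, q ∈ (χ q).source)
    (h : ∀ q q', ∀ v ∈ (χ q).target, (χ q).symm v ∈ (χ q').source →
      ContDiffAt 𝕜 ∞ (fun v => χ q' ((χ q).symm v)) v) :
    @IsManifold 𝕜 _ E _ _ E _ 𝓘(𝕜, E) ∞ Q _ (chartedSpaceOfCharts χ hχ) := by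
  let _ := chartedSpaceOfCharts χ hχ
  refine isManifold_of_contDiffOn 𝓘(𝕜, E) ∞ Q ?_
  rintro _ _ ⟨q, rfl⟩ ⟨q', rfl⟩ v hv
  simp only [mfld_simps] at hv
  exact (h q q' v hv.1 hv.2).contDiffWithinAt

/-- A chart on a space that is locally homeomorphic to a slice. -/
theorem IsSliceAt.exists_chart {T : Set M} {a : M} {d : ℕ} (hT : IsSliceAt I T a d)
    {Q : Type*} [TopologicalSpace Q] {D : Set Q} (hD : IsOpen D) {j : Q → M} (hj : ContinuousOn j D)
    {k : M → Q} (hk : ContinuousOn k T) (hkD : ∀ y ∈ T, k y ∈ D) (hjk : ∀ y ∈ T, j (k y) = y)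
    (hjT : ∀ q ∈ D, j q ∈ T) (hkj : ∀ q ∈ D, k (j q) = q) :
    ∃ (χ : OpenPartialHomeomorph Q (EuclideanSpace 𝕜 (Fin d))) (f : M → EuclideanSpace 𝕜 (Fin d))
      (g : EuclideanSpace 𝕜 (Fin d) → M), k a ∈ χ.source ∧ χ.source ⊆ D ∧
      (∀ q ∈ χ.source, χ q = f (j q) ∧
        SmoothNear I 𝓘(𝕜, EuclideanSpace 𝕜 (Fin d)) f (j q)) ∧
      ∀ v ∈ χ.target, χ.symm v = k (g v) ∧ g v ∈ T ∧
        SmoothNear 𝓘(𝕜, EuclideanSpace 𝕜 (Fin d)) I g v := by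
  have haT := hT.mem
  obtain ⟨f, g, hf, hg, hga, hgf, hfg⟩ := hT
  obtain ⟨V, hV, hVo, haV⟩ :=
    eventually_nhds_iff.1 (hf.eventually.and (eventually_nhdsWithin_iff.1 hfg))
  obtain ⟨W, hW, hWo, haW⟩ := eventually_nhds_iff.1 (hg.eventually.and hgf)
  have hfV : ContinuousOn f V := fun y hy => (hV y hy).1.continuousAt.continuousWithinAt
  have hgW : ContinuousOn g W := fun y hy => (hW y hy).1.continuousAt.continuousWithinAt
  let χ : OpenPartialHomeomorph Q (EuclideanSpace 𝕜 (Fin d)) :=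
    { toFun := fun q => f (j q)
      invFun := fun v => k (g v)
      -- On `V` the identity `g ∘ f = id` holds along `T`; on `W`, `g` lands in `T` and `f ∘ g =
      -- id`. Cutting by both sets makes the two maps carry source and target into each other.
      source := D ∩ j ⁻¹' (V ∩ f ⁻¹' W)
      target := W ∩ g ⁻¹' V
      map_source' := fun q ⟨hqD, hqV, hqW⟩ => ⟨hqW, by
        rw [mem_preimage, (hV _ hqV).2 (hjT q hqD)]; exact hqV⟩
      map_target' := fun v ⟨hvW, hvV⟩ => by
        obtain ⟨-, hvT, hfgv⟩ := hW v hvW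
        refine ⟨hkD _ hvT, ?_⟩
        rw [mem_preimage, hjk _ hvT]
        exact ⟨hvV, by rw [mem_preimage, hfgv]; exact hvW⟩
      left_inv' := fun q ⟨hqD, hqV, hqW⟩ => by
        rw [(hV _ hqV).2 (hjT q hqD), hkj q hqD]
      right_inv' := fun v ⟨hvW, hvV⟩ => by
        obtain ⟨-, hvT, hfgv⟩ := hW v hvW
        rw [hjk _ hvT, hfgv]
      open_source := hj.isOpen_inter_preimage hD (hfV.isOpen_inter_preimage hVo hWo)
      open_target := hgW.isOpen_inter_preimage hWo hVo
      continuousOn_toFun := hfV.comp (hj.mono inter_subset_left) fun q hq => hq.2.1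
      continuousOn_invFun := hk.comp (hgW.mono inter_subset_left) fun v hv => (hW v hv.1).2.1 }
  refine ⟨χ, f, g, ?_, inter_subset_left, fun q hq => ⟨rfl, (hV _ hq.2.1).1⟩,
    fun v hv => ⟨rfl, (hW v hv.1).2.1, (hW v hv.1).1⟩⟩
  refine ⟨hkD a haT, ?_⟩
  rw [mem_preimage, hjk a haT]
  exact ⟨haV, haW⟩

/-- The data of coordinates on a subset with a submanifold structure. -/
theorem IsSubmanifoldStructure.exists_coords [IsManifold I ∞ M] [I.Boundaryless] {S : Set M} {d : ℕ}
    [ChartedSpace (EuclideanSpace 𝕜 (Fin d)) S] (hS : IsSubmanifoldStructure I S d) (s : S) :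
    ∃ (f : M → EuclideanSpace 𝕜 (Fin d)) (c : EuclideanSpace 𝕜 (Fin d) → S),
      SmoothNear I 𝓘(𝕜, EuclideanSpace 𝕜 (Fin d)) f s ∧
      SmoothNear 𝓘(𝕜, EuclideanSpace 𝕜 (Fin d)) 𝓘(𝕜, EuclideanSpace 𝕜 (Fin d)) c (f s) ∧
      c (f s) = s ∧ (∀ᶠ v in 𝓝 (f s), f (c v) = v) ∧ ∀ᶠ s' : S in 𝓝 s, c (f s') = s' := by
  obtain ⟨hman, himm, hemb⟩ := hS
  have h := himm.isImmersionOfComplement_complement s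
  set e := h.domChart with he
  set c := h.codChart with hc
  set eq := h.equiv with heq
  have hs : s ∈ e.source := h.mem_domChart_source
  have hcs : (s : M) ∈ c.source := h.mem_codChart_source
  have hfe : ∀ s' ∈ e.source, eq.symm (c.extend I s') = (e s', 0) := by
    intro s' hs'
    have h0 : e s' ∈ (e.extend 𝓘(𝕜, EuclideanSpace 𝕜 (Fin d))).target := by
      rw [OpenPartialHomeomorph.extend_target]
      simpa using e.map_source hs'
    have h1 := h.writtenInCharts h0
    simp only [Function.comp_apply] at h1
    have h2 : (e.extend 𝓘(𝕜, EuclideanSpace 𝕜 (Fin d))).symm (e s') = s' :=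
      e.left_inv hs'
    rw [h2] at h1
    rw [h1, eq.symm_apply_apply]
  have hf0 : ∀ s' ∈ e.source, (eq.symm (c.extend I s')).1 = e s' := fun s' hs' => by
    rw [hfe s' hs']
  refine ⟨fun y => (eq.symm (c.extend I y)).1, e.symm, ?_, ?_, ?_, ?_, ?_⟩
  · have h1 : ContDiff 𝕜 ∞ (fun v => (eq.symm v).1) := contDiff_fst.comp eq.symm.contDiff
    exact (h1.smoothNear _).comp (smoothNear_extend h.codChart_mem_maximalAtlas hcs) rfl
  · refine (contMDiffOn_symm_of_mem_maximalAtlas h.domChart_mem_maximalAtlas).smoothNear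
      (e.open_target.mem_nhds ?_)
    simp only [hf0 s hs]; exact e.map_source hs
  · simp only [hf0 s hs]; exact e.left_inv hs
  · simp only [hf0 s hs]
    filter_upwards [e.open_target.mem_nhds (e.map_source hs)] with v hv
    rw [hf0 _ (e.map_target hv), e.right_inv hv]
  · filter_upwards [e.open_source.mem_nhds hs] with s' hs'
    rw [hf0 s' hs', e.left_inv hs']

theorem eventually_nhdsWithin_of_subtype {S : Set M} {s : S} {q : M → Prop}
    (h : ∀ᶠ s' : S in 𝓝 s, q s') : ∀ᶠ y in 𝓝[S] (s : M), q y := by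
  rw [nhdsWithin_eq_map_subtype_coe s.2]
  exact h

theorem eventually_subtype_of_nhdsWithin {S : Set M} {s : S} {q : M → Prop}
    (h : ∀ᶠ y in 𝓝[S] (s : M), q y) : ∀ᶠ s' : S in 𝓝 s, q s' := by
  rw [nhdsWithin_eq_map_subtype_coe s.2] at h
  exact h

theorem IsSubmanifoldStructure.isSliceAt [IsManifold I ∞ M] [I.Boundaryless] {S : Set M} {d : ℕ}
    [ChartedSpace (EuclideanSpace 𝕜 (Fin d)) S] (hS : IsSubmanifoldStructure I S d) (s : S) :
    IsSliceAt I S s d := by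
  obtain ⟨f, c, hf, hc, hcs, hfc, hcf⟩ := hS.exists_coords s
  have := hS.1
  refine ⟨f, fun v => c v, hf, (hS.2.contMDiff.smoothNear s).comp hc hcs, by simp only [hcs], ?_, ?_⟩
  · filter_upwards [hfc] with v hv using ⟨(c v).2, hv⟩
  · exact eventually_nhdsWithin_of_subtype (hcf.mono fun s' hs' => congrArg Subtype.val hs')

/-- Smoothness on a submanifold is the existence of local smooth extensions. -/
theorem IsSubmanifoldStructure.smoothNear_iff [IsManifold I ∞ M] [I.Boundaryless] {S : Set M}
    {d : ℕ} [ChartedSpace (EuclideanSpace 𝕜 (Fin d)) S] (hS : IsSubmanifoldStructure I S d)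
    {h : S → M'} {s : S} : SmoothNear 𝓘(𝕜, EuclideanSpace 𝕜 (Fin d)) I' h s ↔
      ∃ G : M → M', SmoothNear I I' G s ∧ ∀ᶠ y in 𝓝 s, h y = G y := by
  constructor
  · intro hh
    obtain ⟨f, c, hf, hc, hcs, hfc, hcf⟩ := hS.exists_coords s
    refine ⟨fun y => h (c (f y)), hh.comp (hc.comp hf rfl) hcs, ?_⟩
    filter_upwards [hcf] with y hy
    rw [hy]
  · rintro ⟨G, hG, hhG⟩
    exact (hG.comp (hS.2.contMDiff.smoothNear s) rfl).congr hhG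

variable [IsManifold I ∞ M] [I.Boundaryless] [FiniteDimensional 𝕜 E]

/-- A subset that is a slice of dimension `d` near each of its points is an embedded submanifold. -/
theorem exists_isSubmanifoldStructure {S : Set M} {d : ℕ} (hS : ∀ s ∈ S, IsSliceAt I S s d) :
    ∃ _ : ChartedSpace (EuclideanSpace 𝕜 (Fin d)) S, IsSubmanifoldStructure I S d := by
  classical
  have hchart : ∀ s : S, ∃ (χ : OpenPartialHomeomorph S (EuclideanSpace 𝕜 (Fin d)))
      (f : M → EuclideanSpace 𝕜 (Fin d)) (g : EuclideanSpace 𝕜 (Fin d) → M), s ∈ χ.source ∧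
      (∀ q ∈ χ.source, χ q = f q ∧ SmoothNear I 𝓘(𝕜, EuclideanSpace 𝕜 (Fin d)) f q) ∧
      ∀ v ∈ χ.target, (χ.symm v : M) = g v ∧
        SmoothNear 𝓘(𝕜, EuclideanSpace 𝕜 (Fin d)) I g v := by
    intro s
    -- The value `s` off `S` is arbitrary; only the continuity of `k` on `S` is used.
    set k : M → S := fun y => if h : y ∈ S then ⟨y, h⟩ else s with hk
    have hkS : ∀ y (hy : y ∈ S), k y = ⟨y, hy⟩ := fun y hy => by simp [hk, hy]
    have hkc : ContinuousOn k S := by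
      rw [continuousOn_iff_continuous_domRestrict]
      exact continuous_id.congr fun y => (hkS y y.2).symm
    obtain ⟨χ, f, g, h1, -, h3, h4⟩ := (hS s s.2).exists_chart isOpen_univ
      (j := fun y : S => (y : M)) continuous_subtype_val.continuousOn hkc (fun _ _ => trivial)
      (fun y hy => by rw [hkS y hy]) (fun q _ => q.2) (fun q _ => hkS q q.2)
    refine ⟨χ, f, g, by rwa [hkS s s.2] at h1, h3, fun v hv => ⟨?_, (h4 v hv).2.2⟩⟩
    rw [(h4 v hv).1, hkS _ (h4 v hv).2.1]
  choose χ f g hχ hf hg using hchart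
  let _ : ChartedSpace (EuclideanSpace 𝕜 (Fin d)) S := chartedSpaceOfCharts χ hχ
  have hman : IsManifold 𝓘(𝕜, EuclideanSpace 𝕜 (Fin d)) ∞ S := by
    refine isManifold_chartedSpaceOfCharts χ hχ fun q q' v hv hv' => ?_
    have h1 := (hf q' _ hv').2
    rw [(hg q v hv).1] at h1
    have h2 := h1.comp (hg q v hv).2 rfl
    refine (contMDiffAt_iff_contDiffAt.1 h2.contMDiffAt).congr_of_eventuallyEq ?_
    have h3 := ((χ q).symm.continuousAt hv).preimage_mem_nhds ((χ q').open_source.mem_nhds hv')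
    filter_upwards [(χ q).open_target.mem_nhds hv, h3] with w hw hw'
    rw [(hf q' _ hw').1, (hg q w hw).1]
  have hχmax : ∀ q, χ q ∈ IsManifold.maximalAtlas 𝓘(𝕜, EuclideanSpace 𝕜 (Fin d)) ∞ S :=
    fun q => IsManifold.subset_maximalAtlas ⟨q, rfl⟩
  have hval : ∀ s : S, SmoothNear 𝓘(𝕜, EuclideanSpace 𝕜 (Fin d)) I (Subtype.val : S → M) s := by
    intro s
    have h1 : SmoothNear 𝓘(𝕜, EuclideanSpace 𝕜 (Fin d)) 𝓘(𝕜, EuclideanSpace 𝕜 (Fin d)) (χ s) s :=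
      (contMDiffOn_of_mem_maximalAtlas (hχmax s)).smoothNear ((χ s).open_source.mem_nhds (hχ s))
    refine ((hg s _ ((χ s).map_source (hχ s))).2.comp h1 rfl).congr ?_
    filter_upwards [(χ s).open_source.mem_nhds (hχ s)] with y hy
    rw [← (hg s _ ((χ s).map_source hy)).1, (χ s).left_inv hy]
  refine ⟨inferInstance, hman, ?_, IsEmbedding.subtypeVal⟩
  refine Manifold.IsImmersionOfComplement.isImmersion fun s =>
    isImmersionAtOfComplement_of_leftInverse (g := fun y => (χ s).symm (f s y)) (hval s) ?_ ?_
  · have h1 : SmoothNear 𝓘(𝕜, EuclideanSpace 𝕜 (Fin d)) 𝓘(𝕜, EuclideanSpace 𝕜 (Fin d))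
        (χ s).symm (χ s s) :=
      (contMDiffOn_symm_of_mem_maximalAtlas (hχmax s)).smoothNear
        ((χ s).open_target.mem_nhds ((χ s).map_source (hχ s)))
    exact h1.comp (hf s s (hχ s)).2 (hf s s (hχ s)).1.symm
  · filter_upwards [(χ s).open_source.mem_nhds (hχ s)] with y hy
    rw [← (hf s y hy).1, (χ s).left_inv hy]

/-- This makes the submanifold condition pointwise and free of any choice of atlas; the common `d`
encodes pure dimension. -/
theorem isEmbeddedSubmanifold_iff {S : Set M} :
    IsEmbeddedSubmanifold I S ↔ ∃ d, ∀ s ∈ S, IsSliceAt I S s d :=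
  ⟨fun ⟨d, _, h⟩ => ⟨d, fun s hs => h.isSliceAt ⟨s, hs⟩⟩,
    fun ⟨d, h⟩ => ⟨d, exists_isSubmanifoldStructure h⟩⟩

/-- A submersion on a submanifold is a map with local smooth extensions and local sections. -/
theorem IsSubmersionOnSubmanifold.exists_extension_section {𝕜 : Type v} [RCLike 𝕜] {E H M : Type*}
    [NormedAddCommGroup E] [NormedSpace 𝕜 E] [TopologicalSpace H] {I : ModelWithCorners 𝕜 E H}
    [TopologicalSpace M] [ChartedSpace H M] [IsManifold I ∞ M] [I.Boundaryless]
    {S : Set M} {N : Mfd.{u, v} 𝕜} {q : S → N} (h : IsSubmersionOnSubmanifold I S q) (s : S) :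
    (∃ G : M → N, SmoothNear I N.model G s ∧ ∀ᶠ y in 𝓝 s, q y = G y) ∧
    ∃ ζ : N → M, SmoothNear N.model I ζ (q s) ∧ ζ (q s) = s ∧
      ∀ᶠ b in 𝓝 (q s), ∃ hb : ζ b ∈ S, q ⟨ζ b, hb⟩ = b := by
  obtain ⟨d, C, hS, hq⟩ := h
  have := hS.1
  refine ⟨hS.smoothNear_iff.1 (hq.contMDiff.smoothNear s), ?_⟩
  obtain ⟨τ, hτ, hτs, hqτ⟩ := (hq.isProjectionAt s).exists_section
  refine ⟨fun b => τ b, (hS.2.contMDiff.smoothNear s).comp hτ hτs, by simp only [hτs], ?_⟩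
  filter_upwards [hqτ] with b hb using ⟨(τ b).2, hb⟩

/-- In coordinates `f`, `c` of the submanifold, `c ∘ f ∘ ζ` is a smooth local section with values in
`S` itself, and a map with smooth sections through every point is a submersion. -/
theorem isSubmersionOnSubmanifold_of_extension_section {𝕜 : Type v} [RCLike 𝕜] {E H M : Type*}
    [NormedAddCommGroup E] [NormedSpace 𝕜 E] [TopologicalSpace H] {I : ModelWithCorners 𝕜 E H}
    [TopologicalSpace M] [ChartedSpace H M] [IsManifold I ∞ M] [I.Boundaryless]
    [FiniteDimensional 𝕜 E] {S : Set M} {N : Mfd.{u, v} 𝕜} {q : S → N} {d : ℕ}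
    (hS : ∀ s ∈ S, IsSliceAt I S s d)
    (hext : ∀ s : S, ∃ G : M → N, SmoothNear I N.model G s ∧ ∀ᶠ y in 𝓝 s, q y = G y)
    (hsec : ∀ s : S, ∃ ζ : N → M, SmoothNear N.model I ζ (q s) ∧ ζ (q s) = s ∧
      ∀ᶠ b in 𝓝 (q s), ∃ hb : ζ b ∈ S, q ⟨ζ b, hb⟩ = b) :
    IsSubmersionOnSubmanifold I S q := by
  obtain ⟨C, hC⟩ := exists_isSubmanifoldStructure hS
  have := hC.1
  refine ⟨d, C, hC, Manifold.IsSubmersionOfComplement.isSubmersion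
    (F := EuclideanSpace 𝕜 (Fin (finrank 𝕜 (EuclideanSpace 𝕜 (Fin d)) -
      finrank 𝕜 (EuclideanSpace 𝕜 (Fin N.dim))))) fun s => ?_⟩
  obtain ⟨ζ, hζ, hζs, hqζ⟩ := hsec s
  obtain ⟨f, c, hf, hc, hcs, hfc, hcf⟩ := hC.exists_coords s
  refine isSubmersionAtOfComplement_of_section (g := fun b => c (f (ζ b)))
    (hC.smoothNear_iff.2 (hext s)) (hc.comp (hf.comp hζ hζs) (by rw [hζs])) (by rw [hζs, hcs]) ?_
  have h1 := eventually_nhdsWithin_of_subtype (q := fun y => (c (f y) : M) = y)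
    (hcf.mono fun y hy => congrArg Subtype.val hy)
  filter_upwards [hqζ, hζ.pullWithin h1 hζs] with b ⟨hb, hqb⟩ hb'
  have h2 : c (f (ζ b)) = ⟨ζ b, hb⟩ := Subtype.ext (hb' hb)
  rw [h2, hqb]

end Structures

/-! ### Lie groupoids and the division map of a Morita equivalence -/

namespace LieGroupoid

variable {𝕜 : Type v} [RCLike 𝕜]

section Algebra

variable (Γ : LieGroupoid.{u, v} 𝕜)

theorem eq_inv_of_mul_eq_one {γ δ : Γ.Arr} (h : Γ.t γ = Γ.s δ)
    (h1 : Γ.mul γ δ = Γ.one (Γ.s γ)) : δ = Γ.inv γ := by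
  have h2 := Γ.mul_assoc (Γ.inv γ) γ δ (Γ.t_inv γ) h
  rw [h1, Γ.inv_mul, h, Γ.one_mul] at h2
  have h3 := Γ.mul_one (Γ.inv γ)
  rw [Γ.t_inv] at h3
  rw [h2, h3]

theorem inv_inv (γ : Γ.Arr) : Γ.inv (Γ.inv γ) = γ :=
  (Γ.eq_inv_of_mul_eq_one (Γ.t_inv γ) (by rw [Γ.inv_mul, Γ.s_inv])).symm

theorem inv_one (m : Γ.Obj) : Γ.inv (Γ.one m) = Γ.one m := by
  refine (Γ.eq_inv_of_mul_eq_one (by rw [Γ.t_one, Γ.s_one]) ?_).symm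
  have := Γ.one_mul (Γ.one m)
  rwa [Γ.s_one] at this ⊢

theorem inv_mul_rev {γ δ : Γ.Arr} (h : Γ.t γ = Γ.s δ) :
    Γ.inv (Γ.mul γ δ) = Γ.mul (Γ.inv δ) (Γ.inv γ) := by
  have h1 : Γ.t (Γ.inv δ) = Γ.s (Γ.inv γ) := by rw [Γ.t_inv, Γ.s_inv, h]
  refine (Γ.eq_inv_of_mul_eq_one ?_ ?_).symm
  · rw [Γ.t_mul _ _ h, Γ.s_mul _ _ h1, Γ.s_inv]
  · rw [Γ.mul_assoc _ _ _ h (by rw [Γ.s_mul _ _ h1, Γ.s_inv]),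
      ← Γ.mul_assoc _ _ _ (by rw [Γ.s_inv]) h1, Γ.mul_inv, Γ.s_mul _ _ h]
    have h2 := Γ.one_mul (Γ.inv γ)
    rw [Γ.s_inv, h] at h2
    rw [h2, Γ.mul_inv]

end Algebra

namespace MoritaEquivalence

variable {Γ Γ' : LieGroupoid.{u, v} 𝕜} (X : MoritaEquivalence Γ Γ')

theorem act_inv_act {γ : Γ.Arr} {x : X.X} (h : Γ.t γ = X.p x) :
    X.left.act (Γ.inv γ) (X.left.act γ x) = x := by
  rw [← X.left.mul_act _ _ _ (Γ.t_inv γ) h, Γ.inv_mul, h, X.left.one_act]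

/-- The arrow `δ⁻¹ γ` fixes `x`, hence is a unit by freeness. -/
theorem left_act_injective {γ δ : Γ.Arr} {x : X.X} (hγ : Γ.t γ = X.p x) (hδ : Γ.t δ = X.p x)
    (h : X.left.act γ x = X.left.act δ x) : γ = δ := by
  have hs : Γ.s γ = Γ.s δ := by rw [← X.left.map_act _ _ hγ, h, X.left.map_act _ _ hδ]
  have h1 : Γ.t (Γ.inv δ) = Γ.s γ := by rw [Γ.t_inv, hs]
  have h2 := X.free_left (Γ.mul (Γ.inv δ) γ) x (by rw [Γ.t_mul _ _ h1, hγ]) (by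
    rw [X.left.mul_act _ _ _ h1 hγ, h, X.act_inv_act hδ])
  have h3 := Γ.mul_assoc δ (Γ.inv δ) γ (Γ.s_inv δ).symm h1
  rw [h2, Γ.mul_inv, ← hs, Γ.one_mul, ← hδ, Γ.mul_one] at h3
  exact h3

open Classical in
/-- The division map: `div y x` is the arrow `γ` with `γ · x = y`. -/
noncomputable def div (y x : X.X) : Γ.Arr :=
  if h : X.p' x = X.p' y then (X.transitive_left x y h).choose else Γ.one (X.p x)

/-- No relation between `x` and `y` is needed: the default value of `div` is the unit at `p x`. -/
theorem t_div (y x : X.X) : Γ.t (X.div y x) = X.p x := by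
  unfold div
  split_ifs with h
  · exact (X.transitive_left x y h).choose_spec.1
  · exact Γ.t_one _

theorem div_act_self {y x : X.X} (h : X.p' x = X.p' y) : X.left.act (X.div y x) x = y := by
  unfold div
  rw [dif_pos h]
  exact (X.transitive_left x y h).choose_spec.2

theorem s_div {y x : X.X} (h : X.p' x = X.p' y) : Γ.s (X.div y x) = X.p y := by
  rw [← X.left.map_act _ _ (X.t_div y x), X.div_act_self h]

theorem div_eq {γ : Γ.Arr} {x y : X.X} (h : Γ.t γ = X.p x) (hy : X.left.act γ x = y) :
    X.div y x = γ := by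
  have h1 : X.p' x = X.p' y := by rw [← hy, X.p'_left _ _ h]
  exact X.left_act_injective (X.t_div y x) h (by rw [X.div_act_self h1, hy])

/-- Along an ultrafilter converging to the diagonal, properness of `(γ, x) ↦ (γ · x, x)` yields a
limit of the arrows. The limit fixes `x₀`, so freeness identifies it with the unit. -/
theorem tendsto_div (x₀ : X.X) :
    Tendsto (fun a : X.X × X.X => X.div a.1 a.2) (𝓝[{a | X.p' a.2 = X.p' a.1}] (x₀, x₀))
      (𝓝 (Γ.one (X.p x₀))) := by
  rw [tendsto_iff_ultrafilter]
  intro U hU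
  have hUn : (U : Filter (X.X × X.X)) ≤ 𝓝 (x₀, x₀) := hU.trans nhdsWithin_le_nhds
  have hUs : ∀ᶠ a in (U : Filter (X.X × X.X)), X.p' a.2 = X.p' a.1 := hU self_mem_nhdsWithin
  let φ : X.X × X.X → {a : Γ.Arr × X.X // Γ.t a.1 = X.p a.2} :=
    fun a => ⟨(X.div a.1 a.2, a.2), X.t_div a.1 a.2⟩
  have h1 : Tendsto (fun a : {a : Γ.Arr × X.X // Γ.t a.1 = X.p a.2} =>
      (X.left.act a.1.1 a.1.2, a.1.2)) (U.map φ) (𝓝 (x₀, x₀)) := by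
    rw [Ultrafilter.coe_map, tendsto_map'_iff]
    refine Tendsto.congr' ?_ (hUn : Tendsto id (U : Filter (X.X × X.X)) _)
    filter_upwards [hUs] with a ha
    simp only [φ, Function.comp_apply, X.div_act_self ha]
  obtain ⟨⟨⟨γ, x⟩, hγx⟩, h2, h3⟩ := (isProperMap_iff_ultrafilter.1 X.proper_left).2 h1
  simp only [Prod.mk.injEq] at h2 hγx
  obtain ⟨h4, rfl⟩ := h2
  have hγ := X.free_left γ x hγx h4
  rw [← hγ]
  have h5 : Tendsto (fun a : {a : Γ.Arr × X.X // Γ.t a.1 = X.p a.2} => a.1.1)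
      (𝓝 ⟨(γ, x), hγx⟩) (𝓝 γ) := (continuous_fst.comp continuous_subtype_val).tendsto _
  have h6 := h5.mono_left h3
  rw [Ultrafilter.coe_map, tendsto_map'_iff] at h6
  exact h6

/-- The orbit maps of the left action are immersions at the units. -/
theorem injective_fderiv_orbit {F : Type*} [NormedAddCommGroup F] [NormedSpace 𝕜 F]
    [FiniteDimensional 𝕜 F] (x₀ : X.X) {m₀ : Γ.Obj} (hm₀ : m₀ = X.p x₀)
    {G : Γ.Obj × F → Γ.Arr} {h : Γ.Arr → F}
    (hG : SmoothNear (Γ.Obj.model.prod 𝓘(𝕜, F)) Γ.Arr.model G (m₀, h (Γ.one m₀)))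
    (hh : SmoothNear Γ.Arr.model 𝓘(𝕜, F) h (Γ.one m₀))
    (hG1 : G (m₀, h (Γ.one m₀)) = Γ.one m₀)
    (hGh : ∀ᶠ y in 𝓝 (m₀, h (Γ.one m₀)), Γ.t (G y) = y.1 ∧ h (G y) = y.2)
    (hhG : ∀ᶠ γ in 𝓝 (Γ.one m₀), G (Γ.t γ, h γ) = γ) :
    Function.Injective (fderiv 𝕜 (fun f => extChartAt X.X.model x₀
      (X.left.act (G (m₀, f)) x₀)) (h (Γ.one m₀))) := by
  have hone : X.left.act (Γ.one m₀) x₀ = x₀ := by rw [hm₀, X.left.one_act]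
  set f₀ := h (Γ.one m₀) with hf₀
  set χ := extChartAt X.X.model x₀ with hχ
  have hχs : SmoothNear X.X.model 𝓘(𝕜, EuclideanSpace 𝕜 (Fin X.X.dim)) χ x₀ :=
    smoothNear_extChartAt x₀
  have hχs' : SmoothNear 𝓘(𝕜, EuclideanSpace 𝕜 (Fin X.X.dim)) X.X.model χ.symm (χ x₀) :=
    smoothNear_extChartAt_symm x₀
  have hχ0 : χ.symm (χ x₀) = x₀ := extChartAt_to_inv x₀
  have hpair : SmoothNear 𝓘(𝕜, F) (Γ.Obj.model.prod 𝓘(𝕜, F)) (fun f : F => (m₀, f)) f₀ :=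
    SmoothNear.const.prodMk .id
  -- the points `γ f = G (m₀, f)` of the fibre of `t` over `m₀`
  have hγs : SmoothNear 𝓘(𝕜, F) Γ.Arr.model (fun f => G (m₀, f)) f₀ := hG.comp hpair rfl
  have hγ : ∀ᶠ f in 𝓝 f₀, Γ.t (G (m₀, f)) = m₀ ∧ h (G (m₀, f)) = f := hpair.pull hGh rfl
  have hθ : SmoothNear 𝓘(𝕜, F) X.X.model (fun f => X.left.act (G (m₀, f)) x₀) f₀ :=
    X.left.contMDiffOn_act.comp_smoothNear (hγs.prodMk .const)
      (hγ.mono fun f hf => hf.1.trans hm₀)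
  have hθ0 : X.left.act (G (m₀, f₀)) x₀ = x₀ := by rw [hG1, hone]
  have hθ' := hχs.comp hθ hθ0
  -- units and the moving bisection `b (f₁, m) = G (m, h 1_m + f₁ - f₀)`
  have hu : SmoothNear Γ.Obj.model 𝓘(𝕜, F) (fun m => h (Γ.one m)) m₀ :=
    hh.comp (Γ.contMDiff_one.smoothNear m₀) rfl
  have hbarg : SmoothNear (𝓘(𝕜, F).prod Γ.Obj.model) (Γ.Obj.model.prod 𝓘(𝕜, F))
      (fun y : F × Γ.Obj => (y.2, h (Γ.one y.2) + y.1 - f₀)) (f₀, m₀) := by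
    refine SmoothNear.snd.prodMk ?_
    have h1 : SmoothNear (𝓘(𝕜, F).prod Γ.Obj.model) 𝓘(𝕜, F)
      (fun y : F × Γ.Obj => h (Γ.one y.2)) (f₀, m₀) := hu.comp SmoothNear.snd rfl
    have h2 : ContDiff 𝕜 ∞ (fun y : F × F => y.1 + y.2 - f₀) := by fun_prop
    exact (h2.smoothNear _).comp (h1.prodMk_space SmoothNear.fst) rfl
  have hbarg0 : (m₀, h (Γ.one m₀) + f₀ - f₀) = (m₀, f₀) := by rw [add_sub_cancel_right]
  set b : F × Γ.Obj → Γ.Arr := fun y => G (y.2, h (Γ.one y.2) + y.1 - f₀) with hb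
  have hbs : SmoothNear (𝓘(𝕜, F).prod Γ.Obj.model) Γ.Arr.model b (f₀, m₀) :=
    hG.comp hbarg hbarg0
  have htb : ∀ᶠ y in 𝓝 (f₀, m₀), Γ.t (b y) = y.2 := by
    filter_upwards [hbarg.pull hGh hbarg0] with y hy using hy.1
  have hb0 : b (f₀, m₀) = Γ.one m₀ := by simp only [hb, hbarg0, hG1]
  -- left translation in the source and in the target
  have hγ2 : SmoothNear 𝓘(𝕜, F × F) Γ.Arr.model (fun y : F × F => G (m₀, y.2)) (f₀, f₀) :=
    hγs.comp (contDiff_snd.smoothNear _) rfl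
  have hsγ : SmoothNear 𝓘(𝕜, F × F) Γ.Obj.model (fun y : F × F => Γ.s (G (m₀, y.2))) (f₀, f₀) :=
    (Γ.isSubmersion_s.contMDiff.smoothNear _).comp hγ2 rfl
  have hsγ0 : Γ.s (G (m₀, f₀)) = m₀ := by rw [hG1, Γ.s_one]
  have hb2 : SmoothNear 𝓘(𝕜, F × F) (𝓘(𝕜, F).prod Γ.Obj.model)
      (fun y : F × F => (y.1, Γ.s (G (m₀, y.2)))) (f₀, f₀) :=
    (contDiff_fst.smoothNear _).prodMk hsγ
  have hb20 : (f₀, Γ.s (G (m₀, f₀))) = (f₀, m₀) := by rw [hsγ0]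
  have hprod : SmoothNear 𝓘(𝕜, F × F) Γ.Arr.model
      (fun y : F × F => Γ.mul (b (y.1, Γ.s (G (m₀, y.2)))) (G (m₀, y.2))) (f₀, f₀) := by
    refine Γ.contMDiffOn_mul.comp_smoothNear ((hbs.comp hb2 hb20).prodMk hγ2) ?_
    filter_upwards [hb2.pull htb hb20] with y hy using hy
  have hprod0 : Γ.mul (b (f₀, Γ.s (G (m₀, f₀)))) (G (m₀, f₀)) = Γ.one m₀ := by
    rw [hsγ0, hb0, hG1]
    have := Γ.one_mul (Γ.one m₀)
    rwa [Γ.s_one] at this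
  have hl := hh.comp hprod hprod0
  -- The translation in the target: acting on `x` by the bisection `b (f₁, ·)` at `p x`.
  -- Associativity of the action makes the orbit map intertwine it with multiplication by the same
  -- bisection on the fibre of `t`.
  set m : F × EuclideanSpace 𝕜 (Fin X.X.dim) → EuclideanSpace 𝕜 (Fin X.X.dim) := fun y =>
    χ (X.left.act (b (y.1, X.p (χ.symm y.2))) (χ.symm y.2)) with hm
  have hms : SmoothNear 𝓘(𝕜, F × EuclideanSpace 𝕜 (Fin X.X.dim))
      𝓘(𝕜, EuclideanSpace 𝕜 (Fin X.X.dim)) m (f₀, χ (X.left.act (G (m₀, f₀)) x₀)) := by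
    rw [hθ0]
    have h1 : SmoothNear 𝓘(𝕜, F × EuclideanSpace 𝕜 (Fin X.X.dim)) X.X.model
        (fun y => χ.symm y.2) (f₀, χ x₀) := hχs'.comp (contDiff_snd.smoothNear _) rfl
    have h2 : SmoothNear 𝓘(𝕜, F × EuclideanSpace 𝕜 (Fin X.X.dim)) (𝓘(𝕜, F).prod Γ.Obj.model)
        (fun y => (y.1, X.p (χ.symm y.2))) (f₀, χ x₀) :=
      (contDiff_fst.smoothNear _).prodMk ((X.isSubmersion_p.contMDiff.smoothNear _).comp h1 rfl)
    have h20 : (f₀, X.p (χ.symm (χ x₀))) = (f₀, m₀) := by rw [hχ0, hm₀]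
    have h3 := X.left.contMDiffOn_act.comp_smoothNear ((hbs.comp h2 h20).prodMk h1)
      (h2.pull htb h20)
    refine hχs.comp h3 ?_
    simp only [hχ0]
    rw [← hm₀, hb0, hone]
  obtain ⟨U, hU, hUo, hfU⟩ := eventually_nhds_iff.1 (hγ.and (hθ.pull
    (eventually_extChartAt_left_inv (I := X.X.model) x₀) hθ0))
  refine injective_fderiv_of_homogeneous hθ' (U := U) (hUo.mem_nhds hfU) ?_ hl ?_ ?_ hms ?_
  · intro f hf f' hf' hff
    have h1 : X.left.act (G (m₀, f)) x₀ = X.left.act (G (m₀, f')) x₀ := by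
      rw [← (hU f hf).2, ← (hU f' hf').2]
      exact congrArg χ.symm hff
    have h2 := X.left_act_injective ((hU f hf).1.1.trans hm₀) ((hU f' hf').1.1.trans hm₀) h1
    rw [← (hU f hf).1.2, h2, (hU f' hf').1.2]
  -- For `f₁ = f₀` the bisection consists of units, so the translation is the identity.
  · have h1 : ∀ᶠ f in 𝓝 f₀, G (Γ.t (Γ.one (Γ.s (G (m₀, f)))),
        h (Γ.one (Γ.s (G (m₀, f))))) = Γ.one (Γ.s (G (m₀, f))) := by
      have h2 : SmoothNear 𝓘(𝕜, F) Γ.Arr.model (fun f => Γ.one (Γ.s (G (m₀, f)))) f₀ :=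
        (Γ.contMDiff_one.smoothNear _).comp
          ((Γ.isSubmersion_s.contMDiff.smoothNear _).comp hγs rfl) rfl
      exact h2.pull hhG (by rw [hsγ0])
    filter_upwards [h1, hγ] with f hf hf'
    simp only [hb, add_sub_cancel_right]
    rw [Γ.t_one] at hf
    rw [hf, Γ.one_mul, hf'.2]
  -- Over `m₀` the bisection with parameter `f` is the arrow `G (m₀, f)` itself, so translation
  -- moves the unit to it.
  · filter_upwards [hγ] with f hf
    rw [hsγ0, hG1]
    have h1 : b (f, m₀) = G (m₀, f) := by simp only [hb]; rw [← hf₀, add_sub_cancel_left]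
    have h2 := Γ.mul_one (G (m₀, f))
    rw [hf.1] at h2
    rw [h1, h2, hf.2]
  · have h1 : ∀ᶠ y : F × F in 𝓝 (f₀, f₀), Γ.t (G (m₀, y.2)) = m₀ ∧
        χ.symm (χ (X.left.act (G (m₀, y.2)) x₀)) = X.left.act (G (m₀, y.2)) x₀ := by
      have h2 : SmoothNear 𝓘(𝕜, F × F) 𝓘(𝕜, F) (fun y : F × F => y.2) (f₀, f₀) :=
        contDiff_snd.smoothNear _
      filter_upwards [h2.pull hγ rfl, h2.pull (hθ.pull
        (eventually_extChartAt_left_inv (I := X.X.model) x₀) hθ0) rfl] with y h3 h4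
      exact ⟨h3.1, h4⟩
    filter_upwards [h1, hb2.pull htb hb20, hprod.pull hhG hprod0] with y hy1 hy2 hy3
    have h4 : Γ.t (b (y.1, Γ.s (G (m₀, y.2)))) = Γ.s (G (m₀, y.2)) := hy2
    simp only [hm, hy1.2]
    rw [Γ.t_mul _ _ h4, hy1.1] at hy3
    rw [hy3, X.left.mul_act _ _ _ h4 (by rw [hy1.1, hm₀]), X.left.map_act _ _ (by rw [hy1.1, hm₀])]

end MoritaEquivalence

end LieGroupoid

/-! ### Smoothness of the division map -/

namespace LieGroupoid.MoritaEquivalence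

variable {𝕜 : Type v} [RCLike 𝕜] {Γ Γ' : LieGroupoid.{u, v} 𝕜} (X : MoritaEquivalence Γ Γ')

/-- Near the diagonal, division extends to a smooth map that solves `γ · x = y`
for arrows `γ` close to units. -/
theorem exists_local_division (x₀ : X.X) : ∃ Λ : X.X × X.X → Γ.Arr,
    SmoothNear (X.X.model.prod X.X.model) Γ.Arr.model Λ (x₀, x₀) ∧
    (∀ᶠ a in 𝓝 (x₀, x₀), Γ.t (Λ a) = X.p a.2) ∧
    ∀ᶠ a : Γ.Arr × X.X in 𝓝 (Γ.one (X.p x₀), x₀), Γ.t a.1 = X.p a.2 →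
      Λ (X.left.act a.1 a.2, a.2) = a.1 := by
  obtain ⟨m₀, hm₀⟩ : ∃ m₀, m₀ = X.p x₀ := ⟨_, rfl⟩
  obtain ⟨G, h, hG, hh, hG1, hGh, hhG⟩ := Γ.isSubmersion_t.isProjectionAt (Γ.one m₀)
  rw [← hm₀]
  simp only [Γ.t_one] at hG hG1 hGh
  generalize (Module.finrank 𝕜 (EuclideanSpace 𝕜 (Fin Γ.Arr.dim)) -
    Module.finrank 𝕜 (EuclideanSpace 𝕜 (Fin Γ.Obj.dim))) = k at *
  have hinj := X.injective_fderiv_orbit x₀ hm₀ hG hh hG1 hGh hhG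
  have hone : X.left.act (Γ.one m₀) x₀ = x₀ := by rw [hm₀, X.left.one_act]
  generalize hf₀ : h (Γ.one m₀) = f₀ at *
  have hχ := smoothNear_extChartAt (I := X.X.model) x₀
  have hχ' := smoothNear_extChartAt_symm (I := X.X.model) x₀
  have hχ0 : (extChartAt X.X.model x₀).symm (extChartAt X.X.model x₀ x₀) = x₀ :=
    extChartAt_to_inv x₀
  have hχinv := eventually_extChartAt_left_inv (I := X.X.model) x₀
  generalize extChartAt X.X.model x₀ = χ at *
  generalize hv₀ : χ x₀ = v₀ at *
  have hps := X.isSubmersion_p.contMDiff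
  have hxs : SmoothNear 𝓘(𝕜, EuclideanSpace 𝕜 (Fin X.X.dim) × EuclideanSpace 𝕜 (Fin k)) X.X.model
      (fun y => χ.symm y.1) (v₀, f₀) := hχ'.comp (contDiff_fst.smoothNear _) rfl
  have harg : SmoothNear 𝓘(𝕜, EuclideanSpace 𝕜 (Fin X.X.dim) × EuclideanSpace 𝕜 (Fin k))
      (Γ.Obj.model.prod 𝓘(𝕜, EuclideanSpace 𝕜 (Fin k)))
      (fun y => (X.p (χ.symm y.1), y.2)) (v₀, f₀) :=
    ((hps.smoothNear _).comp hxs rfl).prodMk (contDiff_snd.smoothNear _)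
  have harg0 : (X.p (χ.symm v₀), f₀) = (m₀, f₀) := by rw [hχ0, hm₀]
  have hact : SmoothNear 𝓘(𝕜, EuclideanSpace 𝕜 (Fin X.X.dim) × EuclideanSpace 𝕜 (Fin k)) X.X.model
      (fun y => X.left.act (G (X.p (χ.symm y.1), y.2)) (χ.symm y.1)) (v₀, f₀) :=
    X.left.contMDiffOn_act.comp_smoothNear ((hG.comp harg harg0).prodMk hxs)
      ((harg.pull hGh harg0).mono fun y hy => hy.1)
  have hact0 : X.left.act (G (X.p (χ.symm v₀), f₀)) (χ.symm v₀) = x₀ := by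
    rw [harg0, hG1, hχ0, hone]
  have hactχ := hχ.comp hact hact0
  -- In coordinates this is `(γ, x) ↦ (x, γ · x)`, with `γ` given by its fibre coordinate over `p
  -- x`. The first component is kept, so a kernel vector of its derivative is a kernel vector for
  -- the orbit map of `x₀`.
  have hΘ : SmoothNear 𝓘(𝕜, EuclideanSpace 𝕜 (Fin X.X.dim) × EuclideanSpace 𝕜 (Fin k))
      𝓘(𝕜, EuclideanSpace 𝕜 (Fin X.X.dim) × EuclideanSpace 𝕜 (Fin X.X.dim))
      (fun y => (y.1, χ (X.left.act (G (X.p (χ.symm y.1), y.2)) (χ.symm y.1)))) (v₀, f₀) :=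
    (contDiff_fst.smoothNear _).prodMk_space hactχ
  have hΘinj : Function.Injective (fderiv 𝕜
      (fun y : EuclideanSpace 𝕜 (Fin X.X.dim) × EuclideanSpace 𝕜 (Fin k) =>
        (y.1, χ (X.left.act (G (X.p (χ.symm y.1), y.2)) (χ.symm y.1)))) (v₀, f₀)) := by
    have h1 := HasFDerivAt.of_smoothNear hactχ
    have h2 := (hasFDerivAt_fst (𝕜 := 𝕜) (p := (v₀, f₀))).prodMk h1
    have h3 : HasFDerivAt (fun f : EuclideanSpace 𝕜 (Fin k) =>
        χ (X.left.act (G (X.p (χ.symm v₀), f)) (χ.symm v₀))) _ f₀ :=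
      h1.comp f₀ (hasFDerivAt_prodMk_right v₀ f₀)
    simp only [hχ0, ← hm₀] at h3
    rw [h3.fderiv] at hinj
    rw [h2.fderiv]
    refine (injective_iff_map_eq_zero _).2 fun w hw => ?_
    obtain ⟨w₁, w₂⟩ := w
    simp only [ContinuousLinearMap.prod_apply, ContinuousLinearMap.coe_fst', Prod.mk_eq_zero] at hw
    obtain ⟨rfl, hw⟩ := hw
    refine Prod.ext rfl ((injective_iff_map_eq_zero _).1 hinj w₂ ?_)
    simpa using hw
  obtain ⟨g, hg, hgΘ⟩ := exists_smooth_left_inverse hΘ hΘinj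
  have hg0 := hgΘ.self_of_nhds
  simp only [hact0, hv₀] at hg hg0
  have hχp : SmoothNear (X.X.model.prod X.X.model)
      𝓘(𝕜, EuclideanSpace 𝕜 (Fin X.X.dim) × EuclideanSpace 𝕜 (Fin X.X.dim))
      (fun a : X.X × X.X => (χ a.2, χ a.1)) (x₀, x₀) :=
    (hχ.comp SmoothNear.snd rfl).prodMk_space (hχ.comp SmoothNear.fst rfl)
  have hGarg : SmoothNear (X.X.model.prod X.X.model)
      (Γ.Obj.model.prod 𝓘(𝕜, EuclideanSpace 𝕜 (Fin k)))
      (fun a : X.X × X.X => (X.p a.2, (g (χ a.2, χ a.1)).2)) (x₀, x₀) :=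
    ((hps.smoothNear _).comp SmoothNear.snd rfl).prodMk
      ((contDiff_snd.smoothNear _).comp (hg.comp hχp (by simp only [hv₀])) rfl)
  have hGarg0 : (X.p x₀, (g (χ x₀, χ x₀)).2) = (m₀, f₀) := by rw [hv₀, hg0, hm₀]
  -- Only the fibre coordinate is taken from the left inverse `g`; the base point is `p a.2` itself,
  -- so `t` has the right value even at pairs not on a common orbit.
  refine ⟨fun a => G (X.p a.2, (g (χ a.2, χ a.1)).2), hG.comp hGarg hGarg0, ?_, ?_⟩
  · exact (hGarg.pull hGh hGarg0).mono fun a ha => ha.1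
  · have h1 := (SmoothNear.snd (I := Γ.Arr.model) (I' := X.X.model)
      (a := (Γ.one m₀, x₀))).pull hχinv rfl
    have h2 := (SmoothNear.fst (I := Γ.Arr.model) (I' := X.X.model)
      (a := (Γ.one m₀, x₀))).pull hhG rfl
    have h3 : SmoothNear (Γ.Arr.model.prod X.X.model)
        𝓘(𝕜, EuclideanSpace 𝕜 (Fin X.X.dim) × EuclideanSpace 𝕜 (Fin k))
        (fun a : Γ.Arr × X.X => (χ a.2, h a.1)) (Γ.one m₀, x₀) :=
      (hχ.comp SmoothNear.snd rfl).prodMk_space (hh.comp SmoothNear.fst rfl)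
    filter_upwards [h1, h2, h3.pull hgΘ (by simp only [hv₀, hf₀])] with a ha1 ha2 ha3 hta
    simp only [ha1, ← hta, ha2] at ha3
    simp only [ha3, ← hta, ha2]

/-- A local section `b` of `t` through `div y₀ x₀` moves `(y₀, x₀)` to the diagonal point `(y₀,
y₀)`. There `tendsto_div` places the true quotient in the range where `exists_local_division`
computes it, and multiplying by `b` undoes the translation. -/
theorem contMDiffOn_div : ContMDiffOn (X.X.model.prod X.X.model) Γ.Arr.model ∞
    (fun a : X.X × X.X => X.div a.1 a.2) {a | X.p' a.2 = X.p' a.1} := by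
  refine contMDiffOn_of_local_extension ?_
  rintro ⟨y₀, x₀⟩ h₀
  change X.p' x₀ = X.p' y₀ at h₀
  obtain ⟨b, hb, hb0, htb⟩ := (Γ.isSubmersion_t.isProjectionAt (X.div y₀ x₀)).exists_section
  rw [X.t_div] at hb hb0 htb
  obtain ⟨Λ, hΛ, htΛ, hΛa⟩ := X.exists_local_division y₀
  have hps := X.isSubmersion_p.contMDiff
  have hbx : SmoothNear (X.X.model.prod X.X.model) Γ.Arr.model
      (fun a : X.X × X.X => b (X.p a.2)) (y₀, x₀) :=
    hb.comp ((hps.smoothNear _).comp SmoothNear.snd rfl) rfl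
  have htbx : ∀ᶠ a : X.X × X.X in 𝓝 (y₀, x₀), Γ.t (b (X.p a.2)) = X.p a.2 :=
    ((hps.smoothNear _).comp (SmoothNear.snd (I := X.X.model) (I' := X.X.model)
      (a := (y₀, x₀))) rfl).pull htb rfl
  have hx₁ : SmoothNear (X.X.model.prod X.X.model) X.X.model
      (fun a : X.X × X.X => X.left.act (b (X.p a.2)) a.2) (y₀, x₀) :=
    X.left.contMDiffOn_act.comp_smoothNear (hbx.prodMk SmoothNear.snd) htbx
  have hx₁0 : X.left.act (b (X.p x₀)) x₀ = y₀ := by rw [hb0, X.div_act_self h₀]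
  have harg : SmoothNear (X.X.model.prod X.X.model) (X.X.model.prod X.X.model)
      (fun a : X.X × X.X => (a.1, X.left.act (b (X.p a.2)) a.2)) (y₀, x₀) :=
    SmoothNear.fst.prodMk hx₁
  have harg0 : (y₀, X.left.act (b (X.p x₀)) x₀) = (y₀, y₀) := by rw [hx₁0]
  have hΛx := hΛ.comp harg harg0
  refine ⟨fun a => Γ.mul (Λ (a.1, X.left.act (b (X.p a.2)) a.2)) (b (X.p a.2)), ?_, ?_⟩
  · refine Γ.contMDiffOn_mul.comp_smoothNear (hΛx.prodMk hbx) ?_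
    filter_upwards [htbx, harg.pull htΛ harg0] with a ha1 ha2
    simp only [ha2, X.left.map_act _ _ ha1]
  · have h1 : Tendsto (fun a : X.X × X.X => (a.1, X.left.act (b (X.p a.2)) a.2))
        (𝓝[{a | X.p' a.2 = X.p' a.1}] (y₀, x₀)) (𝓝[{a | X.p' a.2 = X.p' a.1}] (y₀, y₀)) := by
      refine tendsto_nhdsWithin_iff.2 ⟨?_, ?_⟩
      · have h2 := harg.continuousAt.tendsto
        simp only [hx₁0] at h2
        exact h2.mono_left nhdsWithin_le_nhds
      · filter_upwards [nhdsWithin_le_nhds htbx, self_mem_nhdsWithin] with a ha1 ha2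
        rw [X.p'_left _ _ ha1, ha2]
    have h3 := (X.tendsto_div y₀).comp h1
    have h4 := h3.prodMk_nhds (((tendsto_nhdsWithin_iff.1 h1).1).snd_nhds)
    filter_upwards [h4.eventually hΛa, nhdsWithin_le_nhds htbx, self_mem_nhdsWithin]
      with a ha1 ha2 ha3
    have ha4 : X.p' (X.left.act (b (X.p a.2)) a.2) = X.p' a.1 := by
      rw [X.p'_left _ _ ha2]; exact ha3
    simp only [Function.comp_apply] at ha1
    have ha5 := ha1 (X.t_div _ _)
    rw [X.div_act_self ha4] at ha5
    rw [ha5]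
    have ha6 : Γ.t (X.div a.1 (X.left.act (b (X.p a.2)) a.2)) = Γ.s (b (X.p a.2)) := by
      rw [X.t_div, X.left.map_act _ _ ha2]
    refine X.div_eq (by rw [Γ.t_mul _ _ ha6, ha2]) ?_
    rw [X.left.mul_act _ _ _ ha6 ha2, X.div_act_self ha4]

end LieGroupoid.MoritaEquivalence

/-! ### The opposite Morita equivalence and induced modules -/

theorem ContMDiffOn.comp_contMDiffWithinAt {𝕜 : Type*} [RCLike 𝕜]
    {E : Type*} [NormedAddCommGroup E] [NormedSpace 𝕜 E] {H : Type*} [TopologicalSpace H]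
    {I : ModelWithCorners 𝕜 E H} {M : Type*} [TopologicalSpace M] [ChartedSpace H M]
    {E' : Type*} [NormedAddCommGroup E'] [NormedSpace 𝕜 E'] {H' : Type*} [TopologicalSpace H']
    {I' : ModelWithCorners 𝕜 E' H'} {M' : Type*} [TopologicalSpace M'] [ChartedSpace H' M']
    {E'' : Type*} [NormedAddCommGroup E''] [NormedSpace 𝕜 E''] {H'' : Type*} [TopologicalSpace H'']
    {I'' : ModelWithCorners 𝕜 E'' H''} {M'' : Type*} [TopologicalSpace M''] [ChartedSpace H'' M'']
    {g : M' → M''} {A : Set M'} (hg : ContMDiffOn I' I'' ∞ g A) {c : M → M'} {s : Set M} {a : M}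
    (ha : a ∈ s) (hc : ContMDiffWithinAt I I' ∞ c s a) (hA : ∀ᶠ y in 𝓝[s] a, c y ∈ A) :
    ContMDiffWithinAt I I'' ∞ (fun y => g (c y)) s a :=
  ((hg (c a) (hA.self_of_nhdsWithin ha)).comp' a hc).mono_of_mem_nhdsWithin
    (inter_mem self_mem_nhdsWithin hA)

/-- Precomposition with a local retraction onto the slice gives the extension. -/
theorem ContMDiffOn.exists_extension {𝕜 : Type*} [RCLike 𝕜]
    {E : Type*} [NormedAddCommGroup E] [NormedSpace 𝕜 E] {H : Type*} [TopologicalSpace H]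
    {I : ModelWithCorners 𝕜 E H} {M : Type*} [TopologicalSpace M] [ChartedSpace H M]
    {E' : Type*} [NormedAddCommGroup E'] [NormedSpace 𝕜 E'] {H' : Type*} [TopologicalSpace H']
    {I' : ModelWithCorners 𝕜 E' H'} {M' : Type*} [TopologicalSpace M'] [ChartedSpace H' M']
    {g : M → M'} {A : Set M} (hg : ContMDiffOn I I' ∞ g A) {a : M} {d : ℕ}
    (hA : IsSliceAt I A a d) :
    ∃ G : M → M', SmoothNear I I' G a ∧ ∀ᶠ y in 𝓝[A] a, g y = G y := by
  obtain ⟨r, hr, -, hrA, hrid⟩ := hA.exists_retraction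
  exact ⟨fun y => g (r y), hg.comp_smoothNear hr hrA, hrid.mono fun y hy => by simp only [hy]⟩

namespace LieGroupoid

variable {𝕜 : Type v} [RCLike 𝕜]

namespace RightAction

variable {Γ : LieGroupoid.{u, v} 𝕜} {Z : Mfd.{u, v} 𝕜} {φ : Z → Γ.Obj} (α : RightAction Γ Z φ)

theorem act_act_inv {γ : Γ.Arr} {z : Z} (h : φ z = Γ.s γ) :
    α.act (α.act z γ) (Γ.inv γ) = z := by
  rw [← α.act_mul _ _ _ h (Γ.s_inv γ).symm, Γ.mul_inv, ← h, α.act_one]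

theorem act_inv_act {γ : Γ.Arr} {z : Z} (h : φ z = Γ.t γ) :
    α.act (α.act z (Γ.inv γ)) γ = z := by
  have := α.act_act_inv (γ := Γ.inv γ) (z := z) (by rw [Γ.s_inv, h])
  rwa [Γ.inv_inv] at this

@[ext]
theorem ext {α β : RightAction Γ Z φ} (h : ∀ z γ, α.act z γ = β.act z γ) : α = β := by
  obtain ⟨a, _⟩ := α
  obtain ⟨b, _⟩ := β
  obtain rfl : a = b := funext fun z => funext (h z)
  rfl

end RightAction

@[ext]
theorem LeftAction.ext {Γ : LieGroupoid.{u, v} 𝕜} {Z : Mfd.{u, v} 𝕜} {φ : Z → Γ.Obj}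
    {α β : LeftAction Γ Z φ} (h : ∀ γ z, α.act γ z = β.act γ z) : α = β := by
  obtain ⟨a, _⟩ := α
  obtain ⟨b, _⟩ := β
  obtain rfl : a = b := funext fun γ => funext (h γ)
  rfl

/-- The right action by inverses. -/
def LeftAction.toRight {Γ : LieGroupoid.{u, v} 𝕜} {Z : Mfd.{u, v} 𝕜} {φ : Z → Γ.Obj}
    (α : LeftAction Γ Z φ) : RightAction Γ Z φ where
  act z γ := α.act (Γ.inv γ) z
  contMDiffOn_act := by
    refine α.contMDiffOn_act.comp (t := {a | Γ.t a.1 = φ a.2}) (f := fun a : Z × Γ.Arr =>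
      (Γ.inv a.2, a.1)) ?_ fun a ha => ?_
    · exact ((Γ.contMDiff_inv.comp contMDiff_snd).prodMk contMDiff_fst).contMDiffOn
    · exact (Γ.t_inv _).trans (Eq.symm ha)
  map_act z γ h := by rw [α.map_act _ _ (by rw [Γ.t_inv, h]), Γ.s_inv]
  act_one z := by rw [Γ.inv_one, α.one_act]
  act_mul z γ δ h h' := by
    rw [Γ.inv_mul_rev h', α.mul_act _ _ _ (by rw [Γ.t_inv, Γ.s_inv, h']) (by rw [Γ.t_inv, h])]

/-- The left action by inverses. -/
def RightAction.toLeft {Γ : LieGroupoid.{u, v} 𝕜} {Z : Mfd.{u, v} 𝕜} {φ : Z → Γ.Obj}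
    (α : RightAction Γ Z φ) : LeftAction Γ Z φ where
  act γ z := α.act z (Γ.inv γ)
  contMDiffOn_act := by
    refine α.contMDiffOn_act.comp (t := {a | φ a.1 = Γ.s a.2}) (f := fun a : Γ.Arr × Z =>
      (a.2, Γ.inv a.1)) ?_ fun a ha => ?_
    · exact (contMDiff_snd.prodMk (Γ.contMDiff_inv.comp contMDiff_fst)).contMDiffOn
    · exact Eq.symm ((Γ.s_inv _).trans ha)
  map_act γ z h := by rw [α.map_act _ _ (by rw [Γ.s_inv, h]), Γ.t_inv]
  one_act z := by rw [Γ.inv_one, α.act_one]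
  mul_act γ δ z h h' := by
    rw [Γ.inv_mul_rev h, α.act_mul _ _ _ (by rw [Γ.s_inv, h']) (by rw [Γ.t_inv, Γ.s_inv, h])]

namespace MoritaEquivalence

variable {Γ Γ' : LieGroupoid.{u, v} 𝕜} (X : MoritaEquivalence Γ Γ')

theorem isProperMap_toLeft : IsProperMap (fun a : {a : Γ'.Arr × X.X // Γ'.t a.1 = X.p' a.2} =>
    (X.right.toLeft.act a.1.1 a.1.2, a.1.2)) := by
  let e : {a : Γ'.Arr × X.X // Γ'.t a.1 = X.p' a.2} ≃ₜ
      {a : X.X × Γ'.Arr // X.p' a.1 = Γ'.s a.2} :=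
    { toFun a := ⟨(a.1.2, Γ'.inv a.1.1), by rw [Γ'.s_inv, a.2]⟩
      invFun a := ⟨(Γ'.inv a.1.2, a.1.1), by rw [Γ'.t_inv, a.2]⟩
      left_inv a := Subtype.ext (Prod.ext (Γ'.inv_inv _) rfl)
      right_inv a := Subtype.ext (Prod.ext rfl (Γ'.inv_inv _))
      continuous_toFun := Continuous.subtype_mk ((continuous_snd.comp continuous_subtype_val).prodMk
        (Γ'.contMDiff_inv.continuous.comp (continuous_fst.comp continuous_subtype_val)))
          (fun a => a.2.symm.trans (Γ'.s_inv _).symm)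
      continuous_invFun := Continuous.subtype_mk ((Γ'.contMDiff_inv.continuous.comp
        (continuous_snd.comp continuous_subtype_val)).prodMk
        (continuous_fst.comp continuous_subtype_val))
          (fun a => (Γ'.t_inv _).trans a.2.symm) }
  exact (Homeomorph.prodComm X.X X.X).isProperMap.comp (X.proper_right.comp e.isProperMap)

theorem isProperMap_toRight : IsProperMap (fun a : {a : X.X × Γ.Arr // X.p a.1 = Γ.s a.2} =>
    (a.1.1, X.left.toRight.act a.1.1 a.1.2)) := by
  let e : {a : X.X × Γ.Arr // X.p a.1 = Γ.s a.2} ≃ₜ {a : Γ.Arr × X.X // Γ.t a.1 = X.p a.2} :=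
    { toFun a := ⟨(Γ.inv a.1.2, a.1.1), by rw [Γ.t_inv, a.2]⟩
      invFun a := ⟨(a.1.2, Γ.inv a.1.1), by rw [Γ.s_inv, a.2]⟩
      left_inv a := Subtype.ext (Prod.ext rfl (Γ.inv_inv _))
      right_inv a := Subtype.ext (Prod.ext (Γ.inv_inv _) rfl)
      continuous_toFun := Continuous.subtype_mk ((Γ.contMDiff_inv.continuous.comp
        (continuous_snd.comp continuous_subtype_val)).prodMk
        (continuous_fst.comp continuous_subtype_val))
          (fun a => (Γ.t_inv _).trans a.2.symm)
      continuous_invFun := Continuous.subtype_mk ((continuous_snd.comp continuous_subtype_val).prodMk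
        (Γ.contMDiff_inv.continuous.comp (continuous_fst.comp continuous_subtype_val)))
          (fun a => a.2.symm.trans (Γ.s_inv _).symm) }
  exact (Homeomorph.prodComm X.X X.X).isProperMap.comp (X.proper_left.comp e.isProperMap)

/-- The opposite Morita equivalence. -/
abbrev symm : MoritaEquivalence Γ' Γ where
  X := X.X
  p := X.p'
  p' := X.p
  surjective_p := X.surjective_p'
  surjective_p' := X.surjective_p
  isSubmersion_p := X.isSubmersion_p'
  isSubmersion_p' := X.isSubmersion_p
  left := X.right.toLeft
  right := X.left.toRight
  p'_left γ x h := X.p_right _ _ (by rw [Γ'.s_inv, h])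
  p_right x γ h := X.p'_left _ _ (by rw [Γ.t_inv, h])
  comm γ' x γ h h' := (X.comm _ _ _ (by rw [Γ.t_inv, h']) (by rw [Γ'.s_inv, h])).symm
  proper_left := X.isProperMap_toLeft
  proper_right := X.isProperMap_toRight
  free_left γ x h h' := by
    rw [← Γ'.inv_inv γ, X.free_right x (Γ'.inv γ) (by rw [Γ'.s_inv, h]) h', Γ'.inv_one]
  free_right x γ h h' := by
    rw [← Γ.inv_inv γ, X.free_left (Γ.inv γ) x (by rw [Γ.t_inv, h]) h', Γ.inv_one]
  transitive_left x y h := by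
    obtain ⟨γ, h1, h2⟩ := X.transitive_right x y h
    exact ⟨Γ'.inv γ, by rw [Γ'.t_inv, h1], (congrArg _ (Γ'.inv_inv γ)).trans h2⟩
  transitive_right x y h := by
    obtain ⟨γ, h1, h2⟩ := X.transitive_left x y h
    exact ⟨Γ.inv γ, by rw [Γ.s_inv, h1], (congrFun (congrArg _ (Γ.inv_inv γ)) x).trans h2⟩

theorem symm_symm : X.symm.symm = X := by
  have h1 : X.left.toRight.toLeft = X.left := LeftAction.ext fun γ z =>
    congrFun (congrArg _ (Γ.inv_inv γ)) z
  have h2 : X.right.toLeft.toRight = X.right := RightAction.ext fun z γ =>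
    congrArg _ (Γ'.inv_inv γ)
  obtain ⟨⟩ := X
  simp only [symm] at *
  congr

/-- Two points in one fibre of `p'` differ by an arrow of `Γ`, whose ends are their images under
`p`; stability then says that both images lie in `S` or neither does. -/
theorem preimage_mapSet {S : Set Γ.Obj} (hS : Γ.IsStable S) : X.p' ⁻¹' X.mapSet S = X.p ⁻¹' S := by
  ext x
  constructor
  · rintro ⟨y, hy, hyx⟩
    have h1 := hS (X.div x y)
    rw [X.t_div, X.s_div hyx] at h1
    exact h1.1 hy
  · exact fun hx => ⟨x, hx, rfl⟩

theorem symm_mapSet {S : Set Γ.Obj} (hS : Γ.IsStable S) : X.symm.mapSet (X.mapSet S) = S := by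
  change X.p '' (X.p' ⁻¹' X.mapSet S) = S
  rw [X.preimage_mapSet hS, image_preimage_eq _ X.surjective_p]

theorem isStable_mapSet {S : Set Γ.Obj} (hS : Γ.IsStable S) : Γ'.IsStable (X.mapSet S) := by
  intro γ
  obtain ⟨x, hx⟩ := X.surjective_p' (Γ'.s γ)
  have h1 := X.right.map_act x γ hx
  have h2 : ∀ y, X.p' y ∈ X.mapSet S ↔ X.p y ∈ S := fun y =>
    Set.ext_iff.1 (X.preimage_mapSet hS) y
  rw [← hx, ← h1, h2, h2, X.p_right _ _ hx]

/-- `π : Z × X → Z'` restricts to a submersion from `Z ×_M X` onto `Z'` that identifies the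
right module `Z'` with the quotient of `Z ×_M X` by `Γ`. -/
structure IsInducedVia (Z : RightModule Γ) (Z' : RightModule Γ')
    (π : Z.space × X.X → Z'.space) : Prop where
  contMDiffOn : ContMDiffOn (Z.space.model.prod X.X.model) Z'.space.model ∞ π (X.fiberProduct Z)
  exists_section : ∀ a ∈ X.fiberProduct Z, ∃ ζ : Z'.space → Z.space × X.X,
    SmoothNear Z'.space.model (Z.space.model.prod X.X.model) ζ (π a) ∧ ζ (π a) = a ∧
    ∀ᶠ b in 𝓝 (π a), ζ b ∈ X.fiberProduct Z ∧ π (ζ b) = b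
  surjective : ∀ z', ∃ a ∈ X.fiberProduct Z, π a = z'
  exact : ∀ a ∈ X.fiberProduct Z, ∀ b ∈ X.fiberProduct Z, π a = π b ↔ ∃ γ : Γ.Arr,
    Γ.t γ = X.p a.2 ∧ b = (Z.action.act a.1 (Γ.inv γ), X.left.act γ a.2)
  map_eq : ∀ a ∈ X.fiberProduct Z, Z'.map (π a) = X.p' a.2
  act_eq : ∀ a ∈ X.fiberProduct Z, ∀ γ', X.p' a.2 = Γ'.s γ' →
    Z'.action.act (π a) γ' = π (a.1, X.right.act a.2 γ')

theorem isSliceAt_fiberProduct (Z : RightModule Γ) {a : Z.space × X.X}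
    (ha : a ∈ X.fiberProduct Z) :
    IsSliceAt (Z.space.model.prod X.X.model) (X.fiberProduct Z) a
      (Z.space.dim + (X.X.dim - Γ.Obj.dim)) := by
  have h1 := (X.isSubmersion_p.isProjectionAt a.2).isSliceAt_fiberProduct
    (IsSliceAt.univ (I := Z.space.model) a.1) (Z.contMDiff_map.smoothNear a.1) ha
  simp only [finrank_euclideanSpace_fin, mem_univ, true_and] at h1
  exact h1

theorem orbitRel_equivalence (Z : RightModule Γ) : Equivalence (X.orbitRel Z) where
  refl a := ⟨Γ.one (X.p a.1.2), Γ.t_one _, by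
    rw [Γ.inv_one, X.left.one_act, ← a.2.out, Z.action.act_one]⟩
  symm := by
    rintro ⟨⟨z, x⟩, h⟩ ⟨b, hb⟩ ⟨γ, hγ, rfl⟩
    change Z.map z = X.p x at h
    refine ⟨Γ.inv γ, (Γ.t_inv γ).trans (X.left.map_act _ _ hγ).symm, ?_⟩
    simp only
    rw [X.act_inv_act hγ, Γ.inv_inv, Z.action.act_inv_act (h.trans hγ.symm)]
  trans := by
    rintro ⟨⟨z, x⟩, h⟩ ⟨b, hb⟩ ⟨c, hc⟩ ⟨γ, hγ, rfl⟩ ⟨δ, hδ, rfl⟩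
    change Z.map z = X.p x at h
    simp only at hγ hδ
    rw [X.left.map_act _ _ hγ] at hδ
    refine ⟨Γ.mul δ γ, by rw [Γ.t_mul _ _ hδ, hγ], ?_⟩
    simp only
    rw [Γ.inv_mul_rev hδ, X.left.mul_act _ _ _ hδ hγ, Z.action.act_mul _ _ _
      (by rw [Γ.s_inv, h, hγ]) (by rw [Γ.t_inv, Γ.s_inv, hδ])]

theorem mk_eq_mk_iff (Z : RightModule Γ) (a b : X.fiberProduct Z) :
    Quot.mk (X.orbitRel Z) a = Quot.mk (X.orbitRel Z) b ↔ X.orbitRel Z a b :=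
  ⟨fun h => ((X.orbitRel_equivalence Z).eqvGen_iff).1 (Quot.eqvGen_exact h), Quot.sound⟩

/-- This trades the abstract quotient and the atlas on the fibre product for one map on the full
product `Z × X`, with smoothness on a subset and local sections. All later arguments use this form.
-/
theorem isInduced_iff (Z : RightModule Γ) (Z' : RightModule Γ') :
    X.IsInduced Z Z' ↔ ∃ π, X.IsInducedVia Z Z' π := by
  constructor
  · rintro ⟨e, hsub, hmap, hact⟩
    -- Values of `π` off the fibre product are irrelevant, but some must exist: surjectivity of `p`
    -- always completes `z` to a point of the fibre product.
    have hx : ∀ a : Z.space × X.X, ∃ x, Z.map a.1 = X.p x := fun a =>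
      (X.surjective_p (Z.map a.1)).imp fun x hx => hx.symm
    classical
    obtain ⟨π, hπ⟩ : ∃ π : Z.space × X.X → Z'.space, ∀ a : X.fiberProduct Z,
        π a = e (Quot.mk _ a) :=
      ⟨fun a => if h : a ∈ X.fiberProduct Z then e (Quot.mk _ ⟨a, h⟩) else
        e (Quot.mk _ ⟨(a.1, (hx a).choose), (hx a).choose_spec⟩), fun a => dif_pos a.2⟩
    refine ⟨π, ?_, ?_, ?_, ?_, ?_, ?_⟩
    · refine contMDiffOn_of_local_extension fun a ha => ?_
      obtain ⟨G, hG, hGπ⟩ := (hsub.exists_extension_section ⟨a, ha⟩).1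
      exact ⟨G, hG, eventually_nhdsWithin_of_subtype (s := ⟨a, ha⟩)
        (hGπ.mono fun y hy => (hπ y).trans hy)⟩
    · intro a ha
      obtain ⟨ζ, hζ, hζa, hζπ⟩ := (hsub.exists_extension_section ⟨a, ha⟩).2
      rw [← hπ] at hζ hζa hζπ
      exact ⟨ζ, hζ, hζa, hζπ.mono fun b ⟨hb, hb'⟩ => ⟨hb, (hπ ⟨_, hb⟩).trans hb'⟩⟩
    · intro z'
      obtain ⟨a, ha⟩ := Quot.exists_rep (e.symm z')
      exact ⟨a, a.2, by rw [hπ, ha, e.apply_symm_apply]⟩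
    · intro a ha b hb
      rw [hπ ⟨a, ha⟩, hπ ⟨b, hb⟩]
      exact e.injective.eq_iff.trans (X.mk_eq_mk_iff Z ⟨a, ha⟩ ⟨b, hb⟩)
    · intro a ha
      rw [hπ ⟨a, ha⟩, hmap]
    · intro a ha γ' h
      rw [hπ ⟨a, ha⟩, hact _ _ h, ← hπ]
  · rintro ⟨π, h⟩
    have hfun : ∀ a b : X.fiberProduct Z, X.orbitRel Z a b → π a = π b :=
      fun a b hab => (h.exact a a.2 b b.2).2 hab
    let e : X.BalancedProduct Z → Z'.space := Quot.lift (fun a => π a) hfun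
    have he : Function.Bijective e := by
      constructor
      · rintro ⟨a⟩ ⟨b⟩ hab
        exact Quot.sound ((h.exact a a.2 b b.2).1 hab)
      · intro z'
        obtain ⟨a, ha, rfl⟩ := h.surjective z'
        exact ⟨Quot.mk _ ⟨a, ha⟩, rfl⟩
    refine ⟨Equiv.ofBijective e he, ?_, fun a => h.map_eq a a.2, fun a γ' h' => h.act_eq a a.2 γ' h'⟩
    refine isSubmersionOnSubmanifold_of_extension_section
      (fun a ha => X.isSliceAt_fiberProduct Z ha) (fun a => ?_) (fun a => ?_)
    · obtain ⟨G, hG, hGπ⟩ := h.contMDiffOn.exists_extension (X.isSliceAt_fiberProduct Z a.2)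
      exact ⟨G, hG, eventually_subtype_of_nhdsWithin hGπ⟩
    · obtain ⟨ζ, hζ, hζa, hζπ⟩ := h.exists_section a a.2
      exact ⟨ζ, hζ, hζa, hζπ.mono fun b hb => ⟨hb.1, hb.2⟩⟩

end MoritaEquivalence

end LieGroupoid

/-! ### Reversibility of induction -/

namespace LieGroupoid.MoritaEquivalence

variable {𝕜 : Type v} [RCLike 𝕜] {Γ Γ' : LieGroupoid.{u, v} 𝕜} {X : MoritaEquivalence Γ Γ'}

theorem mem_fiberProduct {Z : RightModule Γ} {a : Z.space × X.X} :
    a ∈ X.fiberProduct Z ↔ Z.map a.1 = X.p a.2 := Iff.rfl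

namespace IsInducedVia

variable {Z : RightModule Γ} {Z' : RightModule Γ'} {π : Z.space × X.X → Z'.space}
  (h : X.IsInducedVia Z Z' π)


theorem act_left (h : X.IsInducedVia Z Z' π) {z : Z.space} {x : X.X} (hz : Z.map z = X.p x) {γ : Γ.Arr} (hγ : Γ.t γ = X.p x) :
    π (Z.action.act z (Γ.inv γ), X.left.act γ x) = π (z, x) := by
  refine ((h.exact (z, x) hz _ ?_).2 ⟨γ, hγ, rfl⟩).symm
  rw [mem_fiberProduct]
  simp only
  rw [Z.action.map_act _ _ (by rw [hz, Γ.s_inv, hγ]), X.left.map_act _ _ hγ, Γ.t_inv]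

theorem act_div (h : X.IsInducedVia Z Z' π) {z : Z.space} {x y : X.X} (hz : Z.map z = X.p x) (hxy : X.p' x = X.p' y) :
    π (Z.action.act z (Γ.inv (X.div y x)), y) = π (z, x) := by
  have := h.act_left hz (X.t_div y x)
  rwa [X.div_act_self hxy] at this

/-- An arrow relating `(z, x)` to `(w, x)` fixes `x`, so it is a unit by freeness. -/
theorem left_injective (h : X.IsInducedVia Z Z' π) {z w : Z.space} {x : X.X} (hz : Z.map z = X.p x) (hw : Z.map w = X.p x)
    (hzw : π (z, x) = π (w, x)) : z = w := by
  obtain ⟨γ, hγ, hγw⟩ := (h.exact (z, x) hz (w, x) hw).1 hzw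
  simp only [Prod.mk.injEq] at hγw
  have h1 := X.free_left γ x hγ hγw.2.symm
  rw [hγw.1, h1, Γ.inv_one, ← hz, Z.action.act_one]

theorem map_act_div {z : Z.space} {x y : X.X} (hz : Z.map z = X.p x) (hxy : X.p' x = X.p' y) :
    Z.map (Z.action.act z (Γ.inv (X.div y x))) = X.p y := by
  rw [Z.action.map_act _ _ (by rw [Γ.s_inv, X.t_div, hz]), Γ.t_inv, X.s_div hxy]

/-- Any representative of `z'` can be moved along its orbit, by division, until its second component
is the given `x`. -/
theorem exists_eq (h : X.IsInducedVia Z Z' π) (z' : Z'.space) {x : X.X} (hx : Z'.map z' = X.p' x) :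
    ∃ z, Z.map z = X.p x ∧ π (z, x) = z' := by
  obtain ⟨⟨z₁, x₁⟩, h₁, rfl⟩ := h.surjective z'
  have h2 : X.p' x₁ = X.p' x := by rw [← hx, h.map_eq _ h₁]
  exact ⟨_, map_act_div h₁ h2, h.act_div h₁ h2⟩

/-- The smooth lift `z ↦ (z, σ (φ z))` of points of `Z`. -/
theorem smoothNear_section (h : X.IsInducedVia Z Z' π) {z : Z.space} {σ : Γ.Obj → X.X}
    (hσ : SmoothNear Γ.Obj.model X.X.model σ (Z.map z))
    (hpσ : ∀ᶠ m in 𝓝 (Z.map z), X.p (σ m) = m) :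
    SmoothNear Z.space.model (Z.space.model.prod X.X.model) (fun w => (w, σ (Z.map w))) z ∧
    SmoothNear Z.space.model Z'.space.model (fun w => π (w, σ (Z.map w))) z ∧
    ∀ᶠ w in 𝓝 z, (w, σ (Z.map w)) ∈ X.fiberProduct Z := by
  have h1 := SmoothNear.id.prodMk (hσ.comp (Z.contMDiff_map.smoothNear z) rfl)
  have h2 : ∀ᶠ w in 𝓝 z, (w, σ (Z.map w)) ∈ X.fiberProduct Z :=
    ((Z.contMDiff_map.smoothNear z).pull hpσ rfl).mono fun w hw => hw.symm
  exact ⟨h1, h.contMDiffOn.comp_smoothNear h1 h2, h2⟩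

/-- The inverse projection sends `(z', x)` to the unique `z` with `π (z, x) = z'`: existence is
`exists_eq`, uniqueness `left_injective`. -/
theorem exists_symm (h : X.IsInducedVia Z Z' π) : ∃ π' : Z'.space × X.X → Z.space, X.symm.IsInducedVia Z' Z π' := by
  have hne : ∀ a : Z'.space × X.X, Nonempty Z.space := fun a => ⟨(h.surjective a.1).choose.1⟩
  classical
  obtain ⟨π', hπ'⟩ : ∃ π' : Z'.space × X.X → Z.space, ∀ a, Z'.map a.1 = X.p' a.2 →
      Z.map (π' a) = X.p a.2 ∧ π (π' a, a.2) = a.1 :=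
    ⟨fun a => if ha : Z'.map a.1 = X.p' a.2 then (h.exists_eq a.1 ha).choose
      else (hne a).some, fun a ha => by simp only [dif_pos ha]; exact (h.exists_eq a.1 ha).choose_spec⟩
  have huniq : ∀ z x, Z.map z = X.p x → π' (π (z, x), x) = z := fun z x hz => by
    have h1 := hπ' (π (z, x), x) (h.map_eq (z, x) hz)
    exact h.left_injective h1.1 hz h1.2
  refine ⟨π', ?_, ?_, ?_, ?_, ?_, ?_⟩
  · rintro ⟨z', x⟩ ha
    change Z'.map z' = X.p' x at ha
    obtain ⟨z, hz, rfl⟩ := h.exists_eq z' ha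
    obtain ⟨ζ, hζ, hζa, hζπ⟩ := h.exists_section (z, x) hz
    have h1 : SmoothNear (Z'.space.model.prod X.X.model) (Z.space.model.prod X.X.model)
        (fun b => ζ b.1) (π (z, x), x) :=
      hζ.comp (SmoothNear.fst (a := (π (z, x), x))) rfl
    have h3 : ∀ᶠ b in 𝓝[X.symm.fiberProduct Z'] (π (z, x), x), ζ b.1 ∈ X.fiberProduct Z ∧
        π (ζ b.1) = b.1 := nhdsWithin_le_nhds
      ((SmoothNear.fst (I := Z'.space.model) (I' := X.X.model) (a := (π (z, x), x))).pull hζπ rfl)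
    have h2 : ∀ᶠ b in 𝓝[X.symm.fiberProduct Z'] (π (z, x), x), X.p' (ζ b.1).2 = X.p' b.2 := by
      filter_upwards [h3, self_mem_nhdsWithin] with b hb hb'
      rw [← h.map_eq _ hb.1, hb.2]
      exact hb'
    -- Near a point, `π'` is the formula: lift `z'` by the section `ζ`, then move the lift by
    -- division until its second component is `x`. Smoothness of division enters here.
    have h4 := X.contMDiffOn_div.comp_contMDiffWithinAt (I := Z'.space.model.prod X.X.model)
      (s := X.symm.fiberProduct Z') (a := (π (z, x), x)) (c := fun b : Z'.space × X.X => (b.2, (ζ b.1).2)) ha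
      (contMDiffWithinAt_snd.prodMk h1.contMDiffAt.snd.contMDiffWithinAt) h2
    have h5 := Z.action.contMDiffOn_act.comp_contMDiffWithinAt (I := Z'.space.model.prod X.X.model)
      (s := X.symm.fiberProduct Z') (a := (π (z, x), x))
      (c := fun b : Z'.space × X.X => ((ζ b.1).1, Γ.inv (X.div b.2 (ζ b.1).2))) ha
      (h1.contMDiffAt.fst.contMDiffWithinAt.prodMk
        ((Γ.contMDiff_inv.contMDiffAt).comp_contMDiffWithinAt _ h4)) (by
        filter_upwards [h3] with b hb
        rw [Γ.s_inv, X.t_div, ← hb.1])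
    refine h5.congr_of_eventuallyEq_of_mem ?_ ha
    filter_upwards [h2, h3, self_mem_nhdsWithin] with b hb2 hb3 hb
    have h6 := hπ' b hb
    refine h.left_injective h6.1 (map_act_div hb3.1 hb2) ?_
    rw [h6.2, h.act_div hb3.1 hb2, hb3.2]
  · rintro ⟨z', x⟩ ha
    change Z'.map z' = X.p' x at ha
    obtain ⟨z, hz, rfl⟩ := h.exists_eq z' ha
    rw [huniq z x hz]
    obtain ⟨σ, hσ, hσx, hpσ⟩ := (X.isSubmersion_p.isProjectionAt x).exists_section
    rw [← hz] at hσ hσx hpσ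
    obtain ⟨h1, h2, h3⟩ := h.smoothNear_section hσ hpσ
    -- A local section of `p` supplies the second component needed to lift `w` back to `Z' × X`.
    refine ⟨fun w => (π (w, σ (Z.map w)), σ (Z.map w)),
      h2.prodMk (hσ.comp (Z.contMDiff_map.smoothNear z) rfl), by simp only [hσx], ?_⟩
    filter_upwards [h3] with w hw
    exact ⟨h.map_eq _ hw, huniq _ _ hw⟩
  · intro z
    obtain ⟨x, hx⟩ := X.surjective_p (Z.map z)
    exact ⟨(π (z, x), x), h.map_eq (z, x) hx.symm, huniq z x hx.symm⟩
  · rintro ⟨z', x⟩ ha ⟨w', y⟩ hb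
    change Z'.map z' = X.p' x at ha
    change Z'.map w' = X.p' y at hb
    obtain ⟨z, hz, rfl⟩ := h.exists_eq z' ha
    obtain ⟨w, hw, rfl⟩ := h.exists_eq w' hb
    rw [huniq z x hz, huniq w y hw]
    constructor
    · rintro rfl
      -- Equal first components force `p x = p y`, and the fibres of `p` are `Γ'`-orbits.
      obtain ⟨γ, hγ, rfl⟩ := X.transitive_right x y (hz.symm.trans hw)
      refine ⟨Γ'.inv γ, (Γ'.t_inv γ).trans hγ.symm, ?_⟩
      change _ = (Z'.action.act _ (Γ'.inv (Γ'.inv γ)), X.right.act _ (Γ'.inv (Γ'.inv γ)))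
      rw [Γ'.inv_inv, h.act_eq (z, x) hz γ hγ]
    · rintro ⟨γ, hγ, heq⟩
      change (_, _) = (Z'.action.act _ (Γ'.inv γ), X.right.act _ (Γ'.inv γ)) at heq
      change Γ'.t γ = X.p' x at hγ
      have hγ' : X.p' x = Γ'.s (Γ'.inv γ) := by rw [Γ'.s_inv, hγ]
      rw [h.act_eq (z, x) hz _ hγ'] at heq
      simp only [Prod.mk.injEq] at heq
      obtain ⟨h1, rfl⟩ := heq
      exact h.left_injective (hz.trans (X.p_right _ _ hγ').symm) hw h1.symm
  · exact fun a ha => (hπ' a ha).1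
  · rintro ⟨z', x⟩ ha γ hγ
    change Z'.map z' = X.p' x at ha
    change X.p x = Γ.s γ at hγ
    obtain ⟨z, hz, rfl⟩ := h.exists_eq z' ha
    change _ = π' (_, X.left.act (Γ.inv γ) x)
    have h1 : Γ.t (Γ.inv γ) = X.p x := by rw [Γ.t_inv, hγ]
    have h2 := h.act_left hz h1
    rw [Γ.inv_inv] at h2
    rw [huniq z x hz, ← h2, huniq]
    rw [Z.action.map_act _ _ (hz.trans hγ), X.left.map_act _ _ h1, Γ.s_inv]

end IsInducedVia

theorem IsInduced.symm {Z : RightModule Γ} {Z' : RightModule Γ'} (h : X.IsInduced Z Z') :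
    X.symm.IsInduced Z' Z := by
  obtain ⟨π, h⟩ := (X.isInduced_iff _ _).1 h
  exact (X.symm.isInduced_iff _ _).2 h.exists_symm

theorem isInduced_symm_iff {Z : RightModule Γ} {Z' : RightModule Γ'} :
    X.symm.IsInduced Z' Z ↔ X.IsInduced Z Z' := by
  refine ⟨fun h => ?_, IsInduced.symm⟩
  have := h.symm
  rwa [X.symm_symm] at this

end LieGroupoid.MoritaEquivalence

/-! ### Transfer of resolutions -/

/-- The preimage is identified with its graph, the fibre product of `A` with `f`. -/
theorem IsProjectionAt.isSliceAt_preimage {𝕜 : Type*} [RCLike 𝕜]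
    {E : Type*} [NormedAddCommGroup E] [NormedSpace 𝕜 E] {H : Type*} [TopologicalSpace H]
    {I : ModelWithCorners 𝕜 E H} {M : Type*} [TopologicalSpace M] [ChartedSpace H M]
    {E' : Type*} [NormedAddCommGroup E'] [NormedSpace 𝕜 E'] {H' : Type*} [TopologicalSpace H']
    {I' : ModelWithCorners 𝕜 E' H'} {M' : Type*} [TopologicalSpace M'] [ChartedSpace H' M']
    {f : M → M'} {x : M} {k : ℕ} (h : IsProjectionAt I I' f x k) (hf : SmoothNear I I' f x)
    {A : Set M'} {d : ℕ} (hA : IsSliceAt I' A (f x) d) : IsSliceAt I (f ⁻¹' A) x (d + k) := by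
  refine (h.isSliceAt_fiberProduct hA SmoothNear.id rfl).transfer (α := fun y => (f y, y))
    (β := fun y => y.2) (hf.prodMk SmoothNear.id) SmoothNear.snd rfl rfl ?_ ?_
  · filter_upwards [self_mem_nhdsWithin] with y hy using ⟨⟨hy, rfl⟩, rfl⟩
  · filter_upwards [self_mem_nhdsWithin] with y hy
    refine ⟨?_, Prod.ext hy.2.symm rfl⟩
    change f y.2 ∈ A
    rw [← hy.2]
    exact hy.1

namespace LieGroupoid

variable {𝕜 : Type v} [RCLike 𝕜]

/-- The restriction of `φ` to `φ⁻¹ S` is a diffeomorphism onto the submanifold `S` if and only if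
it is injective and has local smooth sections. -/
theorem isResolution_iff {Z M : Mfd.{u, v} 𝕜} {S : Set M} {φ : Z → M} :
    IsResolution S φ ↔ ContMDiff Z.model M.model ∞ φ ∧ Dense (φ ⁻¹' S) ∧
      IsEmbeddedSubmanifold M.model S ∧ InjOn φ (φ ⁻¹' S) ∧
      ∀ m ∈ S, ∃ g : M → Z, SmoothNear M.model Z.model g m ∧ ∀ᶠ y in 𝓝[S] m, φ (g y) = y := by
  constructor
  · rintro ⟨h1, h2, d, C, hS, ψ, hψ, hφψ, hψφ⟩
    refine ⟨h1, h2, ⟨d, C, hS⟩, fun z hz w hw hzw => ?_, fun m hm => ?_⟩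
    · rw [← hψφ z hz, ← hψφ w hw]
      exact congrArg ψ (Subtype.ext hzw)
    · obtain ⟨G, hG, hGψ⟩ := hS.smoothNear_iff.1 (hψ.smoothNear ⟨m, hm⟩)
      refine ⟨G, hG, eventually_nhdsWithin_of_subtype (s := ⟨m, hm⟩) (hGψ.mono fun y hy => ?_)⟩
      rw [← hy, hφψ]
  · rintro ⟨h1, h2, ⟨d, C, hS⟩, hinj, hsec⟩
    refine ⟨h1, h2, d, C, hS, ?_⟩
    have hex : ∀ m : S, ∃ z, φ z = m := fun m => by
      obtain ⟨g, -, hg⟩ := hsec m m.2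
      exact ⟨g m, hg.self_of_nhdsWithin m.2⟩
    choose ψ hψ using hex
    refine ⟨ψ, contMDiff_iff_smoothNear.2 fun m => hS.smoothNear_iff.2 ?_, hψ, fun z hz => ?_⟩
    · obtain ⟨g, hg, hgφ⟩ := hsec m m.2
      refine ⟨g, hg, (eventually_subtype_of_nhdsWithin hgφ).mono fun y hy => ?_⟩
      refine hinj ?_ ?_ ((hψ y).trans hy.symm)
      · rw [mem_preimage, hψ]; exact y.2
      · rw [mem_preimage, hy]; exact y.2
    · refine hinj ?_ hz (hψ _)
      rw [mem_preimage, hψ]; exact hz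

namespace MoritaEquivalence

variable {Γ Γ' : LieGroupoid.{u, v} 𝕜} {X : MoritaEquivalence Γ Γ'}

/-- The common preimage in `X` is a submanifold because `p` is a submersion. Its retraction,
conjugated by a local section of `p'` and `p'`, is a retraction onto the image. -/
theorem isEmbeddedSubmanifold_mapSet {S : Set Γ.Obj} (hS : IsEmbeddedSubmanifold Γ.Obj.model S)
    (hstable : Γ.IsStable S) : IsEmbeddedSubmanifold Γ'.Obj.model (X.mapSet S) := by
  obtain ⟨d, hS⟩ := isEmbeddedSubmanifold_iff.1 hS
  refine isEmbeddedSubmanifold_iff.2 ⟨d + (X.X.dim - Γ.Obj.dim) - (X.X.dim - Γ'.Obj.dim), ?_⟩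
  rintro _ ⟨x, hx, rfl⟩
  have h1 := (X.isSubmersion_p.isProjectionAt x).isSliceAt_preimage
    (X.isSubmersion_p.contMDiff.smoothNear x) (hS _ hx)
  have hproj := X.isSubmersion_p'.isProjectionAt x
  obtain ⟨σ, hσ, hσx, hpσ⟩ := hproj.exists_section
  rw [← X.preimage_mapSet hstable] at h1
  obtain ⟨R, hR, hRx, hRS, hRid⟩ := h1.exists_retraction
  have hr : SmoothNear Γ'.Obj.model Γ'.Obj.model (fun u => X.p' (R (σ u))) (X.p' x) :=
    (X.isSubmersion_p'.contMDiff.smoothNear _).comp (hR.comp hσ hσx) rfl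
  obtain ⟨d', hd'⟩ := IsSliceAt.of_retraction (A := X.mapSet S) (mem_image_of_mem X.p' hx) hr
    (hσ.pull hRS hσx) (by
      filter_upwards [nhdsWithin_le_nhds (hσ.pullWithin hRid hσx), nhdsWithin_le_nhds hpσ,
        self_mem_nhdsWithin] with u hu hu' huS
      rw [hu (by rwa [mem_preimage, hu']), hu'])
  -- The retraction gives a dimension `d'` depending on the point; pulling back again and comparing
  -- dimensions in `X` shows that it does not.
  have h2 := h1.dim_unique (hproj.isSliceAt_preimage
    (X.isSubmersion_p'.contMDiff.smoothNear x) hd')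
  simp only [finrank_euclideanSpace_fin] at h2
  rw [h2, Nat.add_sub_cancel]
  exact hd'

/-- Density is pushed along `w ↦ π (w, σ (φ w))` with `σ` a section of `p`. For injectivity, two
points over the same `m'` are represented with the same `x`, hence over the same point `p x` of `S`.
Sections over `S'` are built from `u ↦ (g (p (σ u)), σ u)`, where now `σ` is a section of `p'`. -/
theorem IsInducedVia.isResolution {Z : RightModule Γ} {Z' : RightModule Γ'}
    {π : Z.space × X.X → Z'.space} (h : X.IsInducedVia Z Z' π) {S : Set Γ.Obj}
    (hstable : Γ.IsStable S) (hZ : IsResolution S Z.map) :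
    IsResolution (X.mapSet S) Z'.map := by
  obtain ⟨-, hdense, hS, hinj, hsec⟩ := isResolution_iff.1 hZ
  refine isResolution_iff.2 ⟨Z'.contMDiff_map, fun z' => ?_,
    isEmbeddedSubmanifold_mapSet hS hstable, fun a' ha b' hb hab => ?_, ?_⟩
  · obtain ⟨⟨z, x⟩, hz, rfl⟩ := h.surjective z'
    rw [mem_fiberProduct] at hz
    simp only at hz
    obtain ⟨σ, hσ, hσx, hpσ⟩ := (X.isSubmersion_p.isProjectionAt x).exists_section
    rw [← hz] at hσ hσx hpσ
    obtain ⟨-, h2, h3⟩ := h.smoothNear_section hσ hpσ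
    have h4 : ∃ᶠ w in 𝓝 z, Z.map w ∈ S := mem_closure_iff_frequently.1 (hdense z)
    rw [mem_closure_iff_frequently]
    have h5 := h2.continuousAt.tendsto
    simp only [hσx] at h5
    refine h5.frequently ((h4.and_eventually h3).mono fun w ⟨hw, hw'⟩ => ?_)
    rw [mem_preimage, h.map_eq _ hw']
    exact mem_image_of_mem X.p' (show X.p _ ∈ S by rw [← hw'.out]; exact hw)
  · obtain ⟨⟨z, x⟩, hz, rfl⟩ := h.surjective a'
    have h1 := h.map_eq _ hz
    obtain ⟨w, hw, rfl⟩ := h.exists_eq b' (hab.symm.trans h1)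
    rw [mem_preimage, h1] at ha
    have h2 : X.p x ∈ S := (Set.ext_iff.1 (X.preimage_mapSet hstable) x).1 ha
    rw [hinj (x₁ := z) (x₂ := w) (by rwa [mem_preimage, hz.out]) (by rwa [mem_preimage, hw])
      (hz.out.trans hw.symm)]
  · rintro _ ⟨x, hx, rfl⟩
    obtain ⟨σ, hσ, hσx, hpσ⟩ := (X.isSubmersion_p'.isProjectionAt x).exists_section
    obtain ⟨g, hg, hgφ⟩ := hsec (X.p x) hx
    have hz : (g (X.p x), x) ∈ X.fiberProduct Z := hgφ.self_of_nhdsWithin hx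
    obtain ⟨G, hG, hGπ⟩ := h.contMDiffOn.exists_extension (X.isSliceAt_fiberProduct Z hz)
    have hpσs : SmoothNear Γ'.Obj.model Γ.Obj.model (fun u => X.p (σ u)) (X.p' x) :=
      (X.isSubmersion_p.contMDiff.smoothNear x).comp hσ hσx
    have hpσx : X.p (σ (X.p' x)) = X.p x := by rw [hσx]
    have hgs : SmoothNear Γ'.Obj.model (Z.space.model.prod X.X.model)
        (fun u => (g (X.p (σ u)), σ u)) (X.p' x) := (hg.comp hpσs hpσx).prodMk hσ
    have hgs0 : (g (X.p (σ (X.p' x))), σ (X.p' x)) = (g (X.p x), x) := by rw [hσx]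
    refine ⟨fun u => G (g (X.p (σ u)), σ u), hG.comp hgs hgs0, ?_⟩
    filter_upwards [nhdsWithin_le_nhds (hgs.pullWithin hGπ hgs0),
      nhdsWithin_le_nhds (hpσs.pullWithin hgφ hpσx), nhdsWithin_le_nhds hpσ,
      self_mem_nhdsWithin] with u hu1 hu2 hu3 hu
    rw [← hu3] at hu
    have h6 : X.p (σ u) ∈ S := (Set.ext_iff.1 (X.preimage_mapSet hstable) (σ u)).1 hu
    have h7 : (g (X.p (σ u)), σ u) ∈ X.fiberProduct Z := hu2 h6
    rw [← hu1 h7, h.map_eq _ h7, hu3]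

theorem IsInduced.isResolution_iff {Z : RightModule Γ} {Z' : RightModule Γ'}
    (h : X.IsInduced Z Z') {S : Set Γ.Obj} (hstable : Γ.IsStable S) :
    IsResolution S Z.map ↔ IsResolution (X.mapSet S) Z'.map := by
  obtain ⟨π, hπ⟩ := (X.isInduced_iff _ _).1 h
  obtain ⟨π', hπ'⟩ := hπ.exists_symm
  refine ⟨hπ.isResolution hstable, fun hZ' => ?_⟩
  have h1 := hπ'.isResolution (X.isStable_mapSet hstable) hZ'
  rwa [X.symm_mapSet hstable] at h1

end MoritaEquivalence

end LieGroupoid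

/-! ### Surjective and proper resolutions -/

theorem IsProjectionAt.map_nhds_le {𝕜 : Type*} [RCLike 𝕜]
    {E : Type*} [NormedAddCommGroup E] [NormedSpace 𝕜 E] {H : Type*} [TopologicalSpace H]
    {I : ModelWithCorners 𝕜 E H} {M : Type*} [TopologicalSpace M] [ChartedSpace H M]
    {E' : Type*} [NormedAddCommGroup E'] [NormedSpace 𝕜 E'] {H' : Type*} [TopologicalSpace H']
    {I' : ModelWithCorners 𝕜 E' H'} {M' : Type*} [TopologicalSpace M'] [ChartedSpace H' M']
    {f : M → M'} {x : M} {k : ℕ} (h : IsProjectionAt I I' f x k) : 𝓝 (f x) ≤ map f (𝓝 x) := by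
  obtain ⟨σ, hσ, hσx, hfσ⟩ := h.exists_section
  intro U hU
  have h1 := hσ.continuousAt.tendsto
  rw [hσx] at h1
  filter_upwards [h1 hU, hfσ] with m hm hm'
  rw [mem_preimage, mem_preimage, hm'] at hm
  exact hm

namespace LieGroupoid.MoritaEquivalence

variable {𝕜 : Type v} [RCLike 𝕜] {Γ Γ' : LieGroupoid.{u, v} 𝕜} {X : MoritaEquivalence Γ Γ'}

theorem isOpenMap_p (X : MoritaEquivalence Γ Γ') : IsOpenMap X.p :=
  isOpenMap_iff_nhds_le.2 fun x => (X.isSubmersion_p.isProjectionAt x).map_nhds_le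

/-- For a continuous open map, preimage commutes with closure. Applying this to both `p` and `p'`
identifies the two sets after pulling back to `X`. -/
theorem mapSet_closure {S : Set Γ.Obj} (hS : Γ.IsStable S) :
    X.mapSet (closure S) = closure (X.mapSet S) := by
  have h1 := X.isOpenMap_p.preimage_closure_eq_closure_preimage
    X.isSubmersion_p.contMDiff.continuous S
  have h2 := X.symm.isOpenMap_p.preimage_closure_eq_closure_preimage
    X.isSubmersion_p'.contMDiff.continuous (X.mapSet S)
  rw [X.preimage_mapSet hS, ← h1] at h2
  rw [mapSet, ← h2, image_preimage_eq _ X.surjective_p']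

namespace IsInducedVia

variable {Z : RightModule Γ} {Z' : RightModule Γ'} {π : Z.space × X.X → Z'.space}

theorem range_map (h : X.IsInducedVia Z Z' π) : range Z'.map = X.mapSet (range Z.map) := by
  ext m'
  constructor
  · rintro ⟨z', rfl⟩
    obtain ⟨⟨z, x⟩, hz, rfl⟩ := h.surjective z'
    exact ⟨x, ⟨z, hz⟩, (h.map_eq _ hz).symm⟩
  · rintro ⟨x, ⟨z, hz⟩, rfl⟩
    exact ⟨π (z, x), h.map_eq (z, x) hz⟩

/-- An ultrafilter on `Z'` with convergent image is lifted to `Z` by representing `z'` with second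
component `σ (φ' z')`. The image of the lift in `M` converges, so properness gives a limit `z`, and
continuity of `π` gives the limit `π (z, x)`. -/
theorem isProperMap (h : X.IsInducedVia Z Z' π) (hZ : IsProperMap Z.map) :
    IsProperMap Z'.map := by
  refine isProperMap_iff_ultrafilter.2 ⟨Z'.contMDiff_map.continuous, fun U m' hU => ?_⟩
  obtain ⟨x, rfl⟩ := X.surjective_p' m'
  obtain ⟨σ, hσ, hσx, hpσ⟩ := (X.isSubmersion_p'.isProjectionAt x).exists_section
  have hex : ∀ z', ∃ z, Z'.map z' = X.p' (σ (Z'.map z')) →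
      Z.map z = X.p (σ (Z'.map z')) ∧ π (z, σ (Z'.map z')) = z' := fun z' => by
    by_cases h' : Z'.map z' = X.p' (σ (Z'.map z'))
    · obtain ⟨z, hz⟩ := h.exists_eq z' h'
      exact ⟨z, fun _ => hz⟩
    · exact ⟨(h.surjective z').choose.1, fun h'' => (h' h'').elim⟩
  choose l hl using hex
  have h1 : ∀ᶠ z' in (U : Filter Z'.space),
      Z.map (l z') = X.p (σ (Z'.map z')) ∧ π (l z', σ (Z'.map z')) = z' :=
    (hU.eventually hpσ).mono fun z' hz' => hl z' hz'.symm
  have h2 : Tendsto (fun z' => σ (Z'.map z')) U (𝓝 x) := by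
    have := hσ.continuousAt.tendsto.comp hU
    rwa [hσx] at this
  have h3 : Tendsto Z.map (U.map l) (𝓝 (X.p x)) := by
    rw [Ultrafilter.coe_map, tendsto_map'_iff]
    exact ((X.isSubmersion_p.contMDiff.continuous.tendsto x).comp h2).congr'
      (h1.mono fun z' hz' => hz'.1.symm)
  obtain ⟨z, hz, hUz⟩ := (isProperMap_iff_ultrafilter.1 hZ).2 h3
  refine ⟨π (z, x), h.map_eq (z, x) hz, ?_⟩
  have h4 : Tendsto (fun z' => (l z', σ (Z'.map z'))) U (𝓝[X.fiberProduct Z] (z, x)) :=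
    tendsto_nhdsWithin_iff.2 ⟨(show Tendsto l U (𝓝 z) from hUz).prodMk_nhds h2,
      h1.mono fun z' hz' => hz'.1⟩
  have h5 := ((h.contMDiffOn.continuousOn (z, x) hz).tendsto.comp h4).congr'
    (h1.mono fun z' hz' => hz'.2)
  exact h5

/-- Induced modules of isomorphic modules. -/
theorem comp_diffeomorph (h : X.IsInducedVia Z Z' π) {Z₁ : RightModule Γ}
    (Φ : Diffeomorph Z₁.space.model Z.space.model Z₁.space Z.space ∞)
    (hΦ : ∀ z, Z.map (Φ z) = Z₁.map z)
    (hact : ∀ z γ, Z₁.map z = Γ.s γ → Φ (Z₁.action.act z γ) = Z.action.act (Φ z) γ) :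
    X.IsInducedVia Z₁ Z' (fun a => π (Φ a.1, a.2)) := by
  have hmem : ∀ a : Z₁.space × X.X, (Φ a.1, a.2) ∈ X.fiberProduct Z ↔ a ∈ X.fiberProduct Z₁ :=
    fun a => by rw [mem_fiberProduct, mem_fiberProduct, hΦ]
  refine ⟨?_, fun a ha => ?_, fun z' => ?_, fun a ha b hb => ?_, fun a ha => ?_,
    fun a ha γ hγ => ?_⟩
  · exact h.contMDiffOn.comp (((Φ.contMDiff.comp contMDiff_fst).prodMk
      contMDiff_snd).contMDiffOn) fun a ha => (hmem a).2 ha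
  · obtain ⟨ζ, hζ, hζa, hζπ⟩ := h.exists_section _ ((hmem a).2 ha)
    have h1 : SmoothNear Z'.space.model Z₁.space.model (fun b => Φ.symm (ζ b).1)
        (π (Φ a.1, a.2)) := (Φ.symm.contMDiff.smoothNear _).comp (SmoothNear.fst.comp hζ rfl) rfl
    refine ⟨fun b => (Φ.symm (ζ b).1, (ζ b).2), h1.prodMk (SmoothNear.snd.comp hζ rfl), ?_, ?_⟩
    · simp only [hζa, Φ.symm_apply_apply]
    · filter_upwards [hζπ] with b hb
      rw [← hmem]
      simp only [Φ.apply_symm_apply]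
      exact hb
  · obtain ⟨⟨z, x⟩, hz, rfl⟩ := h.surjective z'
    refine ⟨(Φ.symm z, x), ?_, by simp only [Φ.apply_symm_apply]⟩
    rw [← hmem]
    simp only [Φ.apply_symm_apply]
    exact hz
  · rw [h.exact _ ((hmem a).2 ha) _ ((hmem b).2 hb)]
    refine exists_congr fun γ => and_congr_right fun hγ => ?_
    have h1 : Z₁.map a.1 = Γ.s (Γ.inv γ) := by rw [Γ.s_inv, hγ]; exact ha
    simp only [Prod.ext_iff, ← hact _ _ h1]
    exact and_congr_left fun _ => Φ.injective.eq_iff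
  · rw [h.map_eq _ ((hmem a).2 ha)]
  · rw [h.act_eq _ ((hmem a).2 ha) γ hγ]

/-- The induced module is unique up to isomorphism. -/
theorem exists_diffeomorph (h : X.IsInducedVia Z Z' π) {Z₁ : RightModule Γ'}
    {π₁ : Z.space × X.X → Z₁.space} (h₁ : X.IsInducedVia Z Z₁ π₁) :
    ∃ Φ : Diffeomorph Z'.space.model Z₁.space.model Z'.space Z₁.space ∞,
      ∀ z, Z₁.map (Φ z) = Z'.map z := by
  have key : ∀ {Z' Z₁ : RightModule Γ'} {π : Z.space × X.X → Z'.space}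
      {π₁ : Z.space × X.X → Z₁.space}, X.IsInducedVia Z Z' π → X.IsInducedVia Z Z₁ π₁ →
      ∃ f : Z'.space → Z₁.space, ContMDiff Z'.space.model Z₁.space.model ∞ f ∧
        ∀ a ∈ X.fiberProduct Z, f (π a) = π₁ a := by
    intro Z' Z₁ π π₁ h h₁
    choose s hs hπs using h.surjective
    -- Both projections have the same fibres, so the arbitrary choice of preimages `s` does not
    -- matter; smoothness is checked with the smooth sections instead.
    have hf : ∀ a ∈ X.fiberProduct Z, π₁ (s (π a)) = π₁ a := fun a ha =>
      (h₁.exact _ (hs _) _ ha).2 ((h.exact _ (hs _) _ ha).1 (hπs _))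
    refine ⟨fun z => π₁ (s z), contMDiff_iff_smoothNear.2 fun z' => ?_, hf⟩
    obtain ⟨a, ha, rfl⟩ := h.surjective z'
    obtain ⟨ζ, hζ, hζa, hζπ⟩ := h.exists_section a ha
    refine (h₁.contMDiffOn.comp_smoothNear hζ (hζπ.mono fun b hb => hb.1)).congr ?_
    filter_upwards [hζπ] with b hb
    rw [← hf _ hb.1, hb.2]
  obtain ⟨f, hf, hfπ⟩ := key h h₁
  obtain ⟨g, hg, hgπ⟩ := key h₁ h
  refine ⟨⟨⟨f, g, fun z => ?_, fun z => ?_⟩, hf, hg⟩, fun z => ?_⟩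
  · obtain ⟨a, ha, rfl⟩ := h.surjective z
    rw [hfπ a ha, hgπ a ha]
  · obtain ⟨a, ha, rfl⟩ := h₁.surjective z
    rw [hgπ a ha, hfπ a ha]
  · obtain ⟨a, ha, rfl⟩ := h.surjective z
    change Z₁.map (f (π a)) = _
    rw [hfπ a ha, h.map_eq a ha, h₁.map_eq a ha]

end IsInducedVia

end LieGroupoid.MoritaEquivalence

/-! ### Equivariance of isomorphisms of resolutions -/

namespace LieGroupoid

variable {𝕜 : Type v} [RCLike 𝕜] {Γ Γ' : LieGroupoid.{u, v} 𝕜} {X : MoritaEquivalence Γ Γ'}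

/-- Isomorphisms of equivariant resolutions are equivariant, by density. -/
theorem EquivariantResolution.map_act_of_iso {S : Set Γ.Obj} (hS : Γ.IsStable S)
    {R₁ R₂ : EquivariantResolution Γ S}
    (Φ : Diffeomorph R₁.space.model R₂.space.model R₁.space R₂.space ∞)
    (hΦ : ∀ z, R₂.map (Φ z) = R₁.map z) (z : R₁.space) (γ : Γ.Arr) (h : R₁.map z = Γ.s γ) :
    Φ (R₁.action.act z γ) = R₂.action.act (Φ z) γ := by
  -- A local section of `s` through `γ` spreads the identity to nearby `w`, with both sides
  -- continuous at `z`. When `w` lies over `S` both sides lie over `t (σ (φ w))`, which is in `S` by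
  -- stability, so injectivity over `S` makes them equal; density finishes.
  obtain ⟨σ, hσ, hσγ, hsσ⟩ := (Γ.isSubmersion_s.isProjectionAt γ).exists_section
  rw [← h] at hσ hσγ hsσ
  have h1 : SmoothNear R₁.space.model Γ.Arr.model (fun w => σ (R₁.map w)) z :=
    hσ.comp (R₁.contMDiff_map.smoothNear z) rfl
  have h2 : ∀ᶠ w in 𝓝 z, R₁.map w = Γ.s (σ (R₁.map w)) :=
    ((R₁.contMDiff_map.smoothNear z).pull hsσ rfl).mono fun w hw => hw.symm
  have h3 : ContinuousAt (fun w => Φ (R₁.action.act w (σ (R₁.map w)))) z :=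
    Φ.contMDiff.continuous.continuousAt.comp
      (R₁.action.contMDiffOn_act.comp_smoothNear (SmoothNear.id.prodMk h1) h2).continuousAt
  have h4 : ContinuousAt (fun w => R₂.action.act (Φ w) (σ (R₁.map w))) z :=
    (R₂.action.contMDiffOn_act.comp_smoothNear ((Φ.contMDiff.smoothNear z).prodMk h1)
      (h2.mono fun w hw => (hΦ w).trans hw)).continuousAt
  have h5 : ∃ᶠ w in 𝓝 z, Φ (R₁.action.act w (σ (R₁.map w))) =
      R₂.action.act (Φ w) (σ (R₁.map w)) := by
    have hd := mem_closure_iff_frequently.1 (R₁.isResolution.dense z)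
    refine (hd.and_eventually h2).mono fun w ⟨hw, hw'⟩ => ?_
    have h6 : R₂.map (Φ (R₁.action.act w (σ (R₁.map w)))) = Γ.t (σ (R₁.map w)) := by
      rw [hΦ, R₁.action.map_act _ _ hw']
    have h7 : R₂.map (R₂.action.act (Φ w) (σ (R₁.map w))) = Γ.t (σ (R₁.map w)) :=
      R₂.action.map_act _ _ ((hΦ w).trans hw')
    have h8 : Γ.t (σ (R₁.map w)) ∈ S := (hS _).2 (by rw [← hw']; exact hw)
    exact (isResolution_iff.1 R₂.isResolution).2.2.2.1 (by rwa [mem_preimage, h6])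
      (by rwa [mem_preimage, h7]) (h6.trans h7.symm)
  have h9 := tendsto_nhds_unique_of_frequently_eq h3.tendsto h4.tendsto h5
  rwa [hσγ] at h9

namespace MoritaEquivalence

theorem IsInduced.of_iso_left {S : Set Γ.Obj} (hS : Γ.IsStable S)
    {R₁ R₂ : EquivariantResolution Γ S} (hR : R₁ ≈ R₂) {Z' : RightModule Γ'}
    (h : X.IsInduced R₂.toRightModule Z') : X.IsInduced R₁.toRightModule Z' := by
  obtain ⟨Φ, hΦ⟩ := hR
  obtain ⟨π, h⟩ := (X.isInduced_iff _ _).1 h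
  exact (X.isInduced_iff _ _).2
    ⟨_, h.comp_diffeomorph Φ hΦ (EquivariantResolution.map_act_of_iso hS Φ hΦ)⟩

theorem IsInduced.iso {S' : Set Γ'.Obj} {Z : RightModule Γ} {R₁ R₂ : EquivariantResolution Γ' S'}
    (h₁ : X.IsInduced Z R₁.toRightModule) (h₂ : X.IsInduced Z R₂.toRightModule) : R₁ ≈ R₂ := by
  obtain ⟨π₁, h₁⟩ := (X.isInduced_iff _ _).1 h₁
  obtain ⟨π₂, h₂⟩ := (X.isInduced_iff _ _).1 h₂
  exact h₁.exists_diffeomorph h₂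

theorem IsInduced.range_map {Z : RightModule Γ} {Z' : RightModule Γ'} (h : X.IsInduced Z Z') :
    range Z'.map = X.mapSet (range Z.map) := by
  obtain ⟨π, h⟩ := (X.isInduced_iff _ _).1 h
  exact h.range_map

theorem IsInduced.isProperMap {Z : RightModule Γ} {Z' : RightModule Γ'} (h : X.IsInduced Z Z')
    (hZ : IsProperMap Z.map) : IsProperMap Z'.map := by
  obtain ⟨π, h⟩ := (X.isInduced_iff _ _).1 h
  exact h.isProperMap hZ

end MoritaEquivalence

end LieGroupoid

/-! ### Quotients of submanifolds -/

/-- The quotient of a submanifold by a closed equivalence relation with local slices. -/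
theorem exists_quotient_manifold {𝕜 : Type*} [RCLike 𝕜]
    {E : Type*} [NormedAddCommGroup E] [NormedSpace 𝕜 E] {H : Type*} [TopologicalSpace H]
    {I : ModelWithCorners 𝕜 E H} {M : Type*} [TopologicalSpace M] [ChartedSpace H M]
    [SecondCountableTopology M] {N : Set M} {r : N → N → Prop} (hr : Equivalence r)
    (hclosed : IsClosed {a : N × N | r a.1 a.2}) {d : ℕ}
    (h : ∀ a : N, ∃ (D : Set N) (ρ : N → N), IsOpen D ∧ a ∈ D ∧
      (∀ n ∈ D, ∀ n', r n n' → n' ∈ D) ∧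
      (∀ n ∈ D, ∃ G : M → M, SmoothNear I I G n ∧ ∀ᶠ y : N in 𝓝 n, (ρ y : M) = G y) ∧
      (∀ n ∈ D, r n (ρ n)) ∧ (∀ n ∈ D, ∀ n', r n n' → ρ n = ρ n') ∧ ρ a = a ∧
      IsSliceAt I ((fun n => (ρ n : M)) '' D) a d) :
    ∃ _ : ChartedSpace (EuclideanSpace 𝕜 (Fin d)) (Quot r),
      IsManifold 𝓘(𝕜, EuclideanSpace 𝕜 (Fin d)) ∞ (Quot r) ∧ T2Space (Quot r) ∧
      SecondCountableTopology (Quot r) ∧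
      (∀ a : N, ∃ G : M → Quot r, SmoothNear I 𝓘(𝕜, EuclideanSpace 𝕜 (Fin d)) G a ∧
        ∀ᶠ y : N in 𝓝 a, Quot.mk r y = G y) ∧
      ∀ a : N, ∃ ζ : Quot r → M, SmoothNear 𝓘(𝕜, EuclideanSpace 𝕜 (Fin d)) I ζ (Quot.mk r a) ∧
        ζ (Quot.mk r a) = a ∧ ∀ᶠ b in 𝓝 (Quot.mk r a), ∃ hb : ζ b ∈ N, Quot.mk r ⟨ζ b, hb⟩ = b := by
  classical
  have hmk : ∀ {a b : N}, Quot.mk r a = Quot.mk r b ↔ r a b := fun {a b} =>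
    ⟨fun h => hr.eqvGen_iff.1 (Quot.eqvGen_exact h), Quot.sound⟩
  choose D ρ hDo haD hDr hρs hrρ hρr hρa hslice using h
  have hρD : ∀ a, ∀ n ∈ D a, ρ a n ∈ D a := fun a n hn => hDr a n hn _ (hrρ a n hn)
  have hρc : ∀ a, ContinuousOn (fun n => (ρ a n : M)) (D a) := fun a n hn => by
    obtain ⟨G, hG, hρG⟩ := hρs a n hn
    exact ((hG.continuousAt.comp continuous_subtype_val.continuousAt).congr
      (hρG.mono fun y hy => hy.symm)).continuousWithinAt
  have hquot : IsQuotientMap (Quot.mk r) := isQuotientMap_quot_mk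
  have hpre : ∀ a, Quot.mk r ⁻¹' (Quot.mk r '' D a) = D a := fun a => by
    refine Subset.antisymm ?_ (subset_preimage_image _ _)
    rintro n ⟨n', hn', hnn⟩
    exact hDr a n' hn' n (hmk.1 hnn)
  have hopen : ∀ a, IsOpen (Quot.mk r '' D a) := fun a => by
    rw [← hquot.isOpen_preimage, hpre]
    exact hDo a
  have hout : ∀ n : N, r (Quot.out (Quot.mk r n)) n := fun n => hmk.1 (Quot.out_eq _)
  -- `Quot.out` picks an arbitrary representative, but `ρ a` is constant on classes, so the induced
  -- map from the quotient to the slice is continuous.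
  have hj : ∀ a, ∀ n ∈ D a, ρ a (Quot.out (Quot.mk r n)) = ρ a n := fun a n hn =>
    (hρr a n hn _ (hr.symm (hout n))).symm
  have hρmk : ∀ a, ∀ n ∈ D a, Quot.mk r (ρ a n) = Quot.mk r n := fun a n hn =>
    hmk.2 (hr.symm (hrρ a n hn))
  have hchart : ∀ a : N, ∃ (χ : OpenPartialHomeomorph (Quot r) (EuclideanSpace 𝕜 (Fin d)))
      (f : M → EuclideanSpace 𝕜 (Fin d)) (g : EuclideanSpace 𝕜 (Fin d) → M),
      Quot.mk r a ∈ χ.source ∧ χ.source ⊆ Quot.mk r '' D a ∧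
      (∀ n : N, Quot.mk r n ∈ χ.source → χ (Quot.mk r n) = f (ρ a n) ∧
        SmoothNear I 𝓘(𝕜, EuclideanSpace 𝕜 (Fin d)) f (ρ a n)) ∧
      ∀ v ∈ χ.target, SmoothNear 𝓘(𝕜, EuclideanSpace 𝕜 (Fin d)) I g v ∧
        ∃ hv : g v ∈ N, χ.symm v = Quot.mk r ⟨g v, hv⟩ := by
    intro a
    obtain ⟨k, hk⟩ : ∃ k : M → Quot r, ∀ n : N, k n = Quot.mk r n :=
      ⟨fun y => if h : y ∈ N then Quot.mk r ⟨y, h⟩ else Quot.mk r a, fun n => dif_pos n.2⟩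
    have hkc : ContinuousOn k N := by
      rw [continuousOn_iff_continuous_domRestrict]
      exact hquot.continuous.congr fun y => (hk y).symm
    have hTN : (fun n => (ρ a n : M)) '' D a ⊆ N := by
      rintro _ ⟨n, -, rfl⟩
      exact (ρ a n).2
    obtain ⟨χ, f, g, h1, h2, h3, h4⟩ := (hslice a).exists_chart (hopen a)
      (j := fun q => (ρ a q.out : M)) (k := k) (by
        rw [hquot.continuousOn_isOpen_iff (hopen a), hpre]
        exact (hρc a).congr fun n hn => congrArg Subtype.val (hj a n hn))
      (hkc.mono hTN) (by
        rintro _ ⟨n, hn, rfl⟩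
        simp only [hk]
        exact ⟨_, hρD a n hn, rfl⟩) (by
        rintro _ ⟨n, hn, rfl⟩
        simp only [hk, hρmk a n hn, hj a n hn]) (by
        rintro _ ⟨n, hn, rfl⟩
        simp only [hj a n hn]
        exact ⟨n, hn, rfl⟩) (by
        rintro _ ⟨n, hn, rfl⟩
        simp only [hj a n hn, hk, hρmk a n hn])
    refine ⟨χ, f, g, by rwa [hk] at h1, h2, fun n hn => ?_, fun v hv => ?_⟩
    · have h5 := h3 _ hn
      obtain ⟨n', hn', hnn⟩ := h2 hn
      have hnD := hDr a n' hn' n (hmk.1 hnn)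
      simp only [hj a n hnD] at h5
      exact h5
    · obtain ⟨h5, h6, h7⟩ := h4 v hv
      exact ⟨h7, hTN h6, by rw [h5, ← hk]⟩
  choose χ f g hχ hχD hf hg using hchart
  have hχo : ∀ q : Quot r, q ∈ (χ q.out).source := fun q => by
    have := hχ q.out
    rwa [Quot.out_eq] at this
  have hnD : ∀ a n, Quot.mk r n ∈ (χ a).source → n ∈ D a := fun a n hn => by
    rw [← hpre]
    exact hχD a hn
  let _ : ChartedSpace (EuclideanSpace 𝕜 (Fin d)) (Quot r) :=
    chartedSpaceOfCharts (fun q => χ q.out) hχo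
  -- the points `g v` represent classes near those in the source of another chart
  have hgρ : ∀ a a' v (hv : v ∈ (χ a).target), (χ a).symm v ∈ Quot.mk r '' D a' →
      ∃ G : EuclideanSpace 𝕜 (Fin d) → M, SmoothNear 𝓘(𝕜, EuclideanSpace 𝕜 (Fin d)) I G v ∧
        ∀ᶠ w in 𝓝 v, ∃ hw : g a w ∈ N, (χ a).symm w = Quot.mk r ⟨g a w, hw⟩ ∧
          ρ a' ⟨g a w, hw⟩ = G w ∧ (⟨g a w, hw⟩ : N) ∈ D a' := by
    intro a a' v hv hvD
    obtain ⟨hgs, hgN, hgv⟩ := hg a v hv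
    rw [hgv] at hvD
    have h1 : (⟨g a v, hgN⟩ : N) ∈ D a' := by rw [← hpre]; exact hvD
    obtain ⟨G, hG, hGρ⟩ := hρs a' _ h1
    refine ⟨fun w => G (g a w), hG.comp hgs rfl, ?_⟩
    have h2 : ∀ᶠ y : N in 𝓝 ⟨g a v, hgN⟩, ∃ hy : (y : M) ∈ N, ρ a' ⟨y, hy⟩ = G y ∧
        (⟨y, hy⟩ : N) ∈ D a' := by
      filter_upwards [hGρ, (hDo a').mem_nhds h1] with y hy hy'
      exact ⟨y.2, hy, hy'⟩
    have h3 := hgs.pullWithin (eventually_nhdsWithin_of_subtype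
      (q := fun y : M => ∃ hy : y ∈ N, ρ a' ⟨y, hy⟩ = G y ∧ (⟨y, hy⟩ : N) ∈ D a') h2) rfl
    filter_upwards [h3, (χ a).open_target.mem_nhds hv] with w hw hwt
    obtain ⟨-, hwN, hw1⟩ := hg a w hwt
    obtain ⟨hwN', hw2, hw3⟩ := hw hwN
    exact ⟨hwN, hw1, hw2, hw3⟩
  have hman : IsManifold 𝓘(𝕜, EuclideanSpace 𝕜 (Fin d)) ∞ (Quot r) := by
    refine isManifold_chartedSpaceOfCharts (fun q => χ q.out) hχo fun q q' v hv hv' => ?_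
    obtain ⟨G, hG, hGw⟩ := hgρ q.out q'.out v hv (hχD _ hv')
    obtain ⟨h1, h2, h3, -⟩ := hGw.self_of_nhds
    have h4 := (hf q'.out ⟨g q.out v, h1⟩ (by rw [← h2]; exact hv')).2
    have h5 := h4.comp hG h3.symm
    refine (contMDiffAt_iff_contDiffAt.1 h5.contMDiffAt).congr_of_eventuallyEq ?_
    have h6 := ((χ q.out).symm.continuousAt hv).preimage_mem_nhds
      ((χ q'.out).open_source.mem_nhds hv')
    filter_upwards [hGw, h6] with w ⟨hw1, hw2, hw3, _⟩ hw'
    rw [mem_preimage, hw2] at hw'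
    rw [hw2, (hf q'.out _ hw').1, hw3]
  have hmax : ∀ q : Quot r,
      χ q.out ∈ IsManifold.maximalAtlas 𝓘(𝕜, EuclideanSpace 𝕜 (Fin d)) ∞ (Quot r) :=
    fun q => IsManifold.subset_maximalAtlas ⟨q, rfl⟩
  have hext : ∀ a : N, ∃ G : M → Quot r, SmoothNear I 𝓘(𝕜, EuclideanSpace 𝕜 (Fin d)) G a ∧
      ∀ᶠ y : N in 𝓝 a, Quot.mk r y = G y := by
    intro a
    set b := Quot.out (Quot.mk r a) with hb
    have hab : Quot.mk r a ∈ (χ b).source := hχo _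
    obtain ⟨G, hG, hGρ⟩ := hρs b a (hnD b a hab)
    have h1 : SmoothNear 𝓘(𝕜, EuclideanSpace 𝕜 (Fin d)) 𝓘(𝕜, EuclideanSpace 𝕜 (Fin d))
        (χ b).symm (χ b (Quot.mk r a)) :=
      (contMDiffOn_symm_of_mem_maximalAtlas (hmax _)).smoothNear
        ((χ b).open_target.mem_nhds ((χ b).map_source hab))
    obtain ⟨h2, h3⟩ := hf b a hab
    refine ⟨fun y => (χ b).symm (f b (G y)), h1.comp (h3.comp hG hGρ.self_of_nhds.symm) ?_, ?_⟩
    · rw [h2, hGρ.self_of_nhds]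
    · have h4 : ∀ᶠ y : N in 𝓝 a, Quot.mk r y ∈ (χ b).source :=
        hquot.continuous.continuousAt.preimage_mem_nhds ((χ b).open_source.mem_nhds hab)
      filter_upwards [hGρ, h4] with y hy hy'
      rw [← hy, ← (hf b y hy').1, (χ b).left_inv hy']
  have hsec : ∀ a : N, ∃ ζ : Quot r → M,
      SmoothNear 𝓘(𝕜, EuclideanSpace 𝕜 (Fin d)) I ζ (Quot.mk r a) ∧
      ζ (Quot.mk r a) = a ∧ ∀ᶠ b in 𝓝 (Quot.mk r a), ∃ hb : ζ b ∈ N,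
        Quot.mk r ⟨ζ b, hb⟩ = b := by
    intro a
    set b := Quot.out (Quot.mk r a) with hb
    have hab : Quot.mk r a ∈ (χ b).source := hχo _
    have h0 := (χ b).map_source hab
    have hinv := (χ b).left_inv hab
    obtain ⟨G, hG, hGw⟩ := hgρ b a _ h0 (by rw [hinv]; exact ⟨a, haD a, rfl⟩)
    have h1 : SmoothNear 𝓘(𝕜, EuclideanSpace 𝕜 (Fin d)) 𝓘(𝕜, EuclideanSpace 𝕜 (Fin d))
        (χ b) (Quot.mk r a) :=
      (contMDiffOn_of_mem_maximalAtlas (hmax _)).smoothNear ((χ b).open_source.mem_nhds hab)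
    -- The chart is built around a representative `b` that may differ from `a`. Applying `ρ a` to
    -- its parametrization moves the section into the slice of `a`, and `ρ a a = a` makes it pass
    -- through `a` exactly.
    refine ⟨fun q => G (χ b q), hG.comp h1 rfl, ?_, ?_⟩
    · obtain ⟨h2, h3, h4, -⟩ := hGw.self_of_nhds
      rw [hinv] at h3
      simp only [← h4]
      rw [← hρr a a (haD a) _ (hmk.1 h3), hρa]
    · filter_upwards [h1.pull hGw rfl, (χ b).open_source.mem_nhds hab] with q hq hq'
      obtain ⟨h2, h3, h4, h5⟩ := hq
      rw [(χ b).left_inv hq'] at h3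
      have h6 : (⟨G (χ b q), by rw [← h4]; exact Subtype.prop _⟩ : N) = ρ a ⟨g b (χ b q), h2⟩ :=
        Subtype.ext h4.symm
      exact ⟨by rw [← h4]; exact Subtype.prop _, by rw [h6, hρmk a _ h5, ← h3]⟩
  have hopenmap : IsOpenMap (Quot.mk r) := by
    refine isOpenMap_iff_nhds_le.2 fun a U hU => ?_
    obtain ⟨ζ, hζ, hζa, hζr⟩ := hsec a
    have hU' : ∀ᶠ y : N in 𝓝 a, ∃ hy : (y : M) ∈ N, Quot.mk r ⟨y, hy⟩ ∈ U := by
      filter_upwards [hU] with y hy using ⟨y.2, hy⟩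
    have h1 := hζ.pullWithin (eventually_nhdsWithin_of_subtype
      (q := fun y : M => ∃ hy : y ∈ N, Quot.mk r ⟨y, hy⟩ ∈ U) hU') hζa
    filter_upwards [h1, hζr] with q hq ⟨hqN, hq'⟩
    obtain ⟨h2, h3⟩ := hq hqN
    rwa [hq'] at h3
  have hoq : IsOpenQuotientMap (Quot.mk r) := ⟨hquot.surjective, hquot.continuous, hopenmap⟩
  refine ⟨inferInstance, hman, ?_, hquot.secondCountableTopology hopenmap, hext, hsec⟩
  -- The quotient by an open projection is Hausdorff exactly when the relation is closed.
  rw [t2Space_iff_of_isOpenQuotientMap hoq]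
  simpa only [Function.Pullback, hmk] using hclosed

/-! ### Existence of induced modules -/

theorem IsSliceAt.of_eventually_iff {𝕜 : Type*} [RCLike 𝕜]
    {E : Type*} [NormedAddCommGroup E] [NormedSpace 𝕜 E] {H : Type*} [TopologicalSpace H]
    {I : ModelWithCorners 𝕜 E H} {M : Type*} [TopologicalSpace M] [ChartedSpace H M]
    {A B : Set M} {a : M} {d : ℕ} (hA : IsSliceAt I A a d) (h : ∀ᶠ y in 𝓝 a, y ∈ B ↔ y ∈ A) :
    IsSliceAt I B a d := by
  refine hA.transfer (α := fun y => y) (β := fun y => y) SmoothNear.id SmoothNear.id rfl rfl ?_ ?_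
  · filter_upwards [nhdsWithin_le_nhds h, self_mem_nhdsWithin] with y hy hyB
      using ⟨hy.1 hyB, rfl⟩
  · filter_upwards [nhdsWithin_le_nhds h, self_mem_nhdsWithin] with y hy hyA
      using ⟨hy.2 hyA, rfl⟩

namespace LieGroupoid.MoritaEquivalence

variable {𝕜 : Type v} [RCLike 𝕜] {Γ Γ' : LieGroupoid.{u, v} 𝕜} (X : MoritaEquivalence Γ Γ')

theorem inv_div {x y : X.X} (h : X.p' x = X.p' y) : Γ.inv (X.div y x) = X.div x y :=
  (X.div_eq (by rw [Γ.t_inv, X.s_div h]) (by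
    have := X.act_inv_act (X.t_div y x)
    rwa [X.div_act_self h] at this)).symm

/-! ### Moving points along orbits by division -/

section

variable (Z : RightModule Γ)

/-- The point `(z, x)` moved along its `Γ`-orbit to a point with second component `y`. -/
noncomputable def move (a : Z.space × X.X) (y : X.X) : Z.space × X.X :=
  (Z.action.act a.1 (Γ.inv (X.div y a.2)), y)

variable {Z}

theorem move_mem {a : Z.space × X.X} (ha : a ∈ X.fiberProduct Z) {y : X.X}
    (h : X.p' a.2 = X.p' y) : X.move Z a y ∈ X.fiberProduct Z := IsInducedVia.map_act_div ha h

theorem move_move {a : Z.space × X.X} (ha : a ∈ X.fiberProduct Z) {y : X.X}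
    (h : X.p' a.2 = X.p' y) : X.move Z (X.move Z a y) a.2 = a := by
  have h1 : Z.map a.1 = Γ.s (Γ.inv (X.div y a.2)) := by
    rw [Γ.s_inv, X.t_div]; exact ha
  refine Prod.ext ?_ rfl
  change Z.action.act (Z.action.act a.1 (Γ.inv (X.div y a.2))) (Γ.inv (X.div a.2 y)) = a.1
  rw [← X.inv_div h, Z.action.act_act_inv h1]

/-- The unknown arrow must be the quotient of the second components. The orbit relation thus becomes
two equations in continuous maps. -/
theorem orbitRel_iff (a b : X.fiberProduct Z) :
    X.orbitRel Z a b ↔ X.p' a.1.2 = X.p' b.1.2 ∧ b.1.1 = (X.move Z a b.1.2).1 := by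
  constructor
  · rintro ⟨γ, hγ, hb⟩
    have h2 : b.1.2 = X.left.act γ a.1.2 := by rw [hb]
    refine ⟨by rw [h2, X.p'_left _ _ hγ], ?_⟩
    change _ = Z.action.act _ _
    rw [X.div_eq hγ h2.symm, hb]
  · rintro ⟨h, hb⟩
    exact ⟨X.div b.1.2 a.1.2, X.t_div _ _, Prod.ext hb (X.div_act_self h).symm⟩

theorem orbitRel_move (a : X.fiberProduct Z) {y : X.X} (h : X.p' a.1.2 = X.p' y) :
    X.orbitRel Z a ⟨X.move Z a y, X.move_mem a.2 h⟩ :=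
  (X.orbitRel_iff _ _).2 ⟨h, rfl⟩

theorem eq_of_orbitRel {a b : X.fiberProduct Z} (hab : X.orbitRel Z a b)
    (h : a.1.2 = b.1.2) : a = b := by
  obtain ⟨γ, hγ, hb⟩ := hab
  have h2 : b.1.2 = X.left.act γ a.1.2 := by rw [hb]
  have h3 := X.free_left γ _ hγ (by rw [← h2, h])
  refine Subtype.ext (Prod.ext ?_ h)
  rw [hb]
  simp only
  rw [h3, Γ.inv_one, ← a.2.out, Z.action.act_one]

theorem contMDiffWithinAt_move {E : Type*} [NormedAddCommGroup E] [NormedSpace 𝕜 E] {H : Type*}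
    [TopologicalSpace H] {I : ModelWithCorners 𝕜 E H} {P : Type*} [TopologicalSpace P]
    [ChartedSpace H P] {A : Set P} {q : P} (hq : q ∈ A) {f : P → Z.space × X.X} {g : P → X.X}
    (hf : ContMDiffWithinAt I (Z.space.model.prod X.X.model) ∞ f A q)
    (hg : ContMDiffWithinAt I X.X.model ∞ g A q)
    (hN : ∀ᶠ y in 𝓝[A] q, f y ∈ X.fiberProduct Z ∧ X.p' (f y).2 = X.p' (g y)) :
    ContMDiffWithinAt I (Z.space.model.prod X.X.model) ∞ (fun y => X.move Z (f y) (g y)) A q := by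
  have h1 := X.contMDiffOn_div.comp_contMDiffWithinAt (c := fun y => (g y, (f y).2)) hq
    (hg.prodMk hf.snd) (hN.mono fun y hy => hy.2)
  refine (Z.action.contMDiffOn_act.comp_contMDiffWithinAt
    (c := fun y => ((f y).1, Γ.inv (X.div (g y) (f y).2))) hq
    (hf.fst.prodMk ((Γ.contMDiff_inv.contMDiffAt).comp_contMDiffWithinAt _ h1))
    (hN.mono fun y hy => ?_)).prodMk hg
  change _ = Γ.s _
  rw [Γ.s_inv, X.t_div]
  exact hy.1

/-- The first condition of `orbitRel_iff` is closed since `M'` is Hausdorff; on that closed set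
`move` is continuous, so the second is closed since `Z` is Hausdorff. -/
theorem isClosed_orbitRel :
    IsClosed {a : X.fiberProduct Z × X.fiberProduct Z | X.orbitRel Z a.1 a.2} := by
  have hp' := X.isSubmersion_p'.contMDiff.continuous
  let K : Set ((Z.space × X.X) × X.X) := {a | a.1 ∈ X.fiberProduct Z ∧ X.p' a.1.2 = X.p' a.2}
  have hK : ContinuousOn (fun a : (Z.space × X.X) × X.X => X.move Z a.1 a.2) K := fun a ha =>
    (X.contMDiffWithinAt_move (I := (Z.space.model.prod X.X.model).prod X.X.model) ha
      contMDiffWithinAt_fst contMDiffWithinAt_snd self_mem_nhdsWithin).continuousWithinAt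
  let c : X.fiberProduct Z × X.fiberProduct Z → (Z.space × X.X) × X.X := fun a => (a.1.1, a.2.1.2)
  have hc : Continuous c := by fun_prop
  have hcl : IsClosed (c ⁻¹' K) := by
    have : c ⁻¹' K = {a | X.p' a.1.1.2 = X.p' a.2.1.2} := by
      ext a
      exact ⟨fun h => h.2, fun h => ⟨a.1.2, h⟩⟩
    rw [this]
    exact isClosed_eq (by fun_prop) (by fun_prop)
  have h1 : ContinuousOn (fun a => ((X.move Z (c a).1 (c a).2).1, a.2.1.1)) (c ⁻¹' K) :=
    ((hK.comp hc.continuousOn fun a ha => ha).fst).prodMk (by fun_prop)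
  have h2 := h1.preimage_isClosed_of_isClosed hcl isClosed_diagonal
  convert h2 using 1
  ext a
  change X.orbitRel Z a.1 a.2 ↔ a ∈ c ⁻¹' K ∧ _ = _
  rw [X.orbitRel_iff]
  exact ⟨fun h => ⟨⟨a.1.2, h.1⟩, h.2.symm⟩, fun h => ⟨h.1.2, h.2.symm⟩⟩

/-- A slice for the `Γ`-orbits in `Z ×_M X`, given by a local section `σ` of `p'`. -/
theorem isSliceAt_section {a : Z.space × X.X} (ha : a ∈ X.fiberProduct Z) {U : Set Γ'.Obj}
    (hU : IsOpen U) (haU : X.p' a.2 ∈ U) {σ : Γ'.Obj → X.X}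
    (hσ : ∀ u ∈ U, SmoothNear Γ'.Obj.model X.X.model σ u ∧ X.p' (σ u) = u)
    (hσa : σ (X.p' a.2) = a.2) :
    IsSliceAt (Z.space.model.prod X.X.model)
      {b | b ∈ X.fiberProduct Z ∧ X.p' b.2 ∈ U ∧ σ (X.p' b.2) = b.2} a
      (Z.space.dim + (X.X.dim - Γ.Obj.dim) - (X.X.dim - Γ'.Obj.dim)) := by
  have hp' := X.isSubmersion_p'.contMDiff
  have hU' : IsOpen {b : Z.space × X.X | X.p' b.2 ∈ U} :=
    hU.preimage (hp'.continuous.comp continuous_snd)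
  set D : Set (Z.space × X.X) := {b | b ∈ X.fiberProduct Z ∧ X.p' b.2 ∈ U} with hD
  set T : Set (Z.space × X.X) :=
    {b | b ∈ X.fiberProduct Z ∧ X.p' b.2 ∈ U ∧ σ (X.p' b.2) = b.2} with hT
  have hTD : T ⊆ D := fun b hb => ⟨hb.1, hb.2.1⟩
  have haT : a ∈ T := ⟨ha, haU, hσa⟩
  have hDs : IsSliceAt (Z.space.model.prod X.X.model) D a
      (Z.space.dim + (X.X.dim - Γ.Obj.dim)) := by
    refine (X.isSliceAt_fiberProduct Z ha).of_eventually_iff ?_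
    filter_upwards [hU'.mem_nhds haU] with b hb using and_iff_left hb
  -- `ρ` replaces the second component by the value of `σ` in the same `p'`-fibre. It retracts `D`
  -- onto `T`, so `T` is a submanifold once `D` is.
  set ρ : Z.space × X.X → Z.space × X.X := fun b => X.move Z b (σ (X.p' b.2)) with hρ
  have hρs : ContMDiffOn (Z.space.model.prod X.X.model) (Z.space.model.prod X.X.model) ∞ ρ D := by
    intro b hb
    have h1 : SmoothNear (Z.space.model.prod X.X.model) X.X.model
        (fun b : Z.space × X.X => σ (X.p' b.2)) b :=
      (hσ _ hb.2).1.comp ((hp'.smoothNear _).comp SmoothNear.snd rfl) rfl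
    refine X.contMDiffWithinAt_move hb contMDiffWithinAt_id h1.contMDiffAt.contMDiffWithinAt ?_
    filter_upwards [self_mem_nhdsWithin] with b hb using ⟨hb.1, (hσ _ hb.2).2.symm⟩
  have hρT : ∀ b ∈ D, ρ b ∈ T := fun b hb => by
    have h1 := (hσ _ hb.2).2
    refine ⟨X.move_mem hb.1 h1.symm, ?_, ?_⟩
    · change X.p' (σ (X.p' b.2)) ∈ U
      rw [h1]; exact hb.2
    · change σ (X.p' (σ (X.p' b.2))) = σ (X.p' b.2)
      rw [h1]
  have hmove : ∀ b ∈ X.fiberProduct Z, X.move Z b b.2 = b := fun b hb =>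
    (congrArg Subtype.val (X.eq_of_orbitRel (X.orbitRel_move ⟨b, hb⟩ rfl) rfl)).symm
  have hρid : ∀ b ∈ T, ρ b = b := fun b hb => by
    simp only [hρ, hb.2.2]
    exact hmove b hb.1
  obtain ⟨R, hR, hRa, hRD, hRid⟩ := hDs.exists_retraction
  have hρR : SmoothNear (Z.space.model.prod X.X.model) (Z.space.model.prod X.X.model)
      (fun b => ρ (R b)) a := hρs.comp_smoothNear hR hRD
  obtain ⟨d', hd'⟩ := IsSliceAt.of_retraction (A := T) haT hρR
    (hRD.mono fun b hb => hρT _ hb) (by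
      filter_upwards [nhdsWithin_mono a hTD hRid, self_mem_nhdsWithin] with b hb hbT
      rw [hb, hρid b hbT])
  -- `D` is the fibre product of the slice with `X`
  have hB := (X.isSubmersion_p'.isProjectionAt a.2).isSliceAt_fiberProduct hd'
    (φ := fun b => X.p' b.2) ((hp'.smoothNear _).comp SmoothNear.snd rfl) rfl
  set B : Set ((Z.space × X.X) × X.X) := {y | y.1 ∈ T ∧ X.p' y.1.2 = X.p' y.2} with hBdef
  have hβ : ContMDiffOn ((Z.space.model.prod X.X.model).prod X.X.model)
      (Z.space.model.prod X.X.model) ∞ (fun y => X.move Z y.1 y.2) B := fun y hy => by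
    refine X.contMDiffWithinAt_move hy contMDiffWithinAt_fst contMDiffWithinAt_snd ?_
    filter_upwards [self_mem_nhdsWithin] with y hy using ⟨hy.1.1, hy.2⟩
  obtain ⟨β, hβs, hβB⟩ := hβ.exists_extension hB
  have haB : (a, a.2) ∈ B := ⟨haT, rfl⟩
  have hβa : β (a, a.2) = a := by
    rw [← hβB.self_of_nhdsWithin haB]
    exact hmove a ha
  have hα : SmoothNear (Z.space.model.prod X.X.model)
      ((Z.space.model.prod X.X.model).prod X.X.model) (fun b => (ρ (R b), b.2)) a :=
    hρR.prodMk SmoothNear.snd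
  have hαa : (ρ (R a), a.2) = (a, a.2) := by rw [hRa, hρid a haT]
  have hαB : ∀ b ∈ D, (ρ b, b.2) ∈ B := fun b hb => ⟨hρT b hb, (hσ _ hb.2).2⟩
  have h2 := hB.transfer hα hβs hαa hβa (A := D) (by
    filter_upwards [hRid, self_mem_nhdsWithin, nhdsWithin_le_nhds (hα.pullWithin hβB hαa)]
      with b hb hbD hb'
    rw [hb] at hb'
    rw [hb, ← hb' (hαB b hbD)]
    exact ⟨hαB b hbD, X.move_move hbD.1 (hσ _ hbD.2).2.symm⟩) (by
    filter_upwards [hβB, self_mem_nhdsWithin, nhdsWithin_le_nhds (hβs.pullWithin hRid hβa)]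
      with y hy hyB hy'
    rw [← hy] at hy' ⊢
    have h3 : X.move Z y.1 y.2 ∈ D := ⟨X.move_mem hyB.1.1 hyB.2, by
      change X.p' y.2 ∈ U
      rw [← hyB.2]; exact hyB.1.2.1⟩
    refine ⟨h3, ?_⟩
    rw [hy' h3]
    refine Prod.ext ?_ rfl
    change X.move Z (X.move Z y.1 y.2) (σ (X.p' y.2)) = y.1
    rw [← hyB.2, hyB.1.2.2, X.move_move hyB.1.1 hyB.2])
  -- The equality `d' + k = dim D`, with `k` the fibre dimension of `p'`, determines `d'` and shows
  -- that the outer truncated subtraction loses nothing.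
  have h3 := h2.dim_unique hDs
  simp only [finrank_euclideanSpace_fin] at h3
  rw [← h3, Nat.add_sub_cancel]
  exact hd'

end

end LieGroupoid.MoritaEquivalence

/-! ### Local slices and existence of the induced module -/

namespace LieGroupoid.MoritaEquivalence

variable {𝕜 : Type v} [RCLike 𝕜] {Γ Γ' : LieGroupoid.{u, v} 𝕜} (X : MoritaEquivalence Γ Γ')
  (Z : RightModule Γ)

/-- `D` is the part lying over the domain `U` of a local section `σ` of `p'`; it is saturated
because `p'` is constant on orbits. Each orbit in `D` has exactly one point with second component `σ
(p' x)`, by freeness, and `ρ` moves to it. -/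
theorem exists_local_slice (a : X.fiberProduct Z) :
    ∃ (D : Set (X.fiberProduct Z)) (ρ : X.fiberProduct Z → X.fiberProduct Z), IsOpen D ∧ a ∈ D ∧
      (∀ n ∈ D, ∀ n', X.orbitRel Z n n' → n' ∈ D) ∧
      (∀ n ∈ D, ∃ G : Z.space × X.X → Z.space × X.X,
        SmoothNear (Z.space.model.prod X.X.model) (Z.space.model.prod X.X.model) G n ∧
        ∀ᶠ y : X.fiberProduct Z in 𝓝 n, (ρ y : Z.space × X.X) = G y) ∧
      (∀ n ∈ D, X.orbitRel Z n (ρ n)) ∧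
      (∀ n ∈ D, ∀ n', X.orbitRel Z n n' → ρ n = ρ n') ∧ ρ a = a ∧
      IsSliceAt (Z.space.model.prod X.X.model) ((fun n => (ρ n : Z.space × X.X)) '' D) a
        (Z.space.dim + (X.X.dim - Γ.Obj.dim) - (X.X.dim - Γ'.Obj.dim)) := by
  classical
  have hp' := X.isSubmersion_p'.contMDiff
  have hrel := X.orbitRel_equivalence Z
  obtain ⟨σ, hσ, hσa, hpσ⟩ := (X.isSubmersion_p'.isProjectionAt a.1.2).exists_section
  obtain ⟨U, hσU, hU, haU⟩ := eventually_nhds_iff.1 (hσ.eventually.and hpσ)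
  -- Outside `U` the section need not lie in the right fibre, so `ρ` is set to the identity there;
  -- that part is never used.
  obtain ⟨ρ, hρ⟩ : ∃ ρ : X.fiberProduct Z → X.fiberProduct Z, ∀ n, X.p' n.1.2 ∈ U →
      (ρ n : Z.space × X.X) = X.move Z n (σ (X.p' n.1.2)) :=
    ⟨fun n => if h : X.p' n.1.2 ∈ U then
      ⟨X.move Z n (σ (X.p' n.1.2)), X.move_mem n.2 (hσU _ h).2.symm⟩ else n,
      fun n h => by simp only [dif_pos h]⟩
  have hp'N : Continuous fun n : X.fiberProduct Z => X.p' n.1.2 :=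
    hp'.continuous.comp (continuous_snd.comp continuous_subtype_val)
  have hρr : ∀ n : X.fiberProduct Z, X.p' n.1.2 ∈ U → X.orbitRel Z n (ρ n) := fun n hn => by
    have h1 : ρ n = ⟨_, X.move_mem n.2 (hσU _ hn).2.symm⟩ := Subtype.ext (hρ n hn)
    rw [h1]
    exact X.orbitRel_move n (hσU _ hn).2.symm
  have hρ2 : ∀ n : X.fiberProduct Z, X.p' n.1.2 ∈ U → (ρ n).1.2 = σ (X.p' n.1.2) :=
    fun n hn => by rw [hρ n hn]; rfl
  refine ⟨{n | X.p' n.1.2 ∈ U}, ρ, hU.preimage hp'N, haU, fun n hn n' hnn => ?_, fun n hn => ?_,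
    hρr, fun n hn n' hnn => ?_, ?_, ?_⟩
  · change X.p' n'.1.2 ∈ U
    rw [← ((X.orbitRel_iff _ _).1 hnn).1]
    exact hn
  · have h1 : SmoothNear (Z.space.model.prod X.X.model) X.X.model
        (fun b : Z.space × X.X => σ (X.p' b.2)) n :=
      (hσU _ hn).1.comp ((hp'.smoothNear _).comp SmoothNear.snd rfl) rfl
    have hUn : ∀ᶠ b : Z.space × X.X in 𝓝 n.1, X.p' b.2 ∈ U :=
      (hU.preimage (hp'.continuous.comp continuous_snd)).mem_nhds hn
    have hs : IsSliceAt (Z.space.model.prod X.X.model)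
        {b | b ∈ X.fiberProduct Z ∧ X.p' b.2 ∈ U} n.1
        (Z.space.dim + (X.X.dim - Γ.Obj.dim)) := by
      refine (X.isSliceAt_fiberProduct Z n.2).of_eventually_iff ?_
      filter_upwards [hUn] with b hb using and_iff_left hb
    have h2 : ContMDiffOn (Z.space.model.prod X.X.model) (Z.space.model.prod X.X.model) ∞
        (fun b => X.move Z b (σ (X.p' b.2))) {b | b ∈ X.fiberProduct Z ∧ X.p' b.2 ∈ U} := by
      intro b hb
      have h1 : SmoothNear (Z.space.model.prod X.X.model) X.X.model
          (fun b : Z.space × X.X => σ (X.p' b.2)) b :=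
        (hσU _ hb.2).1.comp ((hp'.smoothNear _).comp SmoothNear.snd rfl) rfl
      refine X.contMDiffWithinAt_move hb contMDiffWithinAt_id
        h1.contMDiffAt.contMDiffWithinAt ?_
      filter_upwards [self_mem_nhdsWithin] with b hb using ⟨hb.1, (hσU _ hb.2).2.symm⟩
    obtain ⟨G, hG, hGρ⟩ := h2.exists_extension hs
    refine ⟨G, hG, ?_⟩
    have h3 : ∀ᶠ y : X.fiberProduct Z in 𝓝 n, X.p' y.1.2 ∈ U :=
      hp'N.continuousAt.preimage_mem_nhds (hU.mem_nhds hn)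
    have h4 := continuous_subtype_val.continuousAt.eventually (eventually_nhdsWithin_iff.1 hGρ)
    filter_upwards [h3, h4] with y hy hy'
    rw [hρ y hy, hy' ⟨y.2, hy⟩]
  · have h1 := ((X.orbitRel_iff _ _).1 hnn).1
    have hn' : X.p' n'.1.2 ∈ U := by rw [← h1]; exact hn
    refine X.eq_of_orbitRel (hrel.trans (hrel.symm (hρr n hn)) (hrel.trans hnn (hρr n' hn'))) ?_
    rw [hρ2 n hn, hρ2 n' hn', h1]
  · exact (X.eq_of_orbitRel (hρr a haU) ((hρ2 a haU).trans hσa).symm).symm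
  · convert X.isSliceAt_section a.2 hU haU hσU hσa using 1
    ext b
    constructor
    · rintro ⟨n, hn, rfl⟩
      have h1 : X.p' (ρ n).1.2 = X.p' n.1.2 := by rw [hρ2 n hn, (hσU _ hn).2]
      refine ⟨(ρ n).2, ?_, ?_⟩
      · rw [h1]; exact hn
      · rw [h1, hρ2 n hn]
    · rintro ⟨hb, hbU, hσb⟩
      refine ⟨⟨b, hb⟩, hbU, congrArg Subtype.val
        (X.eq_of_orbitRel (hρr ⟨b, hb⟩ hbU) ((hρ2 ⟨b, hb⟩ hbU).trans hσb).symm).symm⟩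

/-- The balanced product of a right module with a Morita equivalence is a right module. -/
theorem exists_isInduced : ∃ Z' : RightModule Γ', X.IsInduced Z Z' := by
  classical
  have hrel := X.orbitRel_equivalence Z
  obtain ⟨C, hman, ht2, hsc, hext, hsec⟩ :=
    exists_quotient_manifold hrel X.isClosed_orbitRel (X.exists_local_slice Z)
  let Q : Mfd.{u, v} 𝕜 := { carrier := Quot (X.orbitRel Z), dim := Z.space.dim + (X.X.dim - Γ.Obj.dim) - (X.X.dim - Γ'.Obj.dim) }
  let mk : X.fiberProduct Z → Q := Quot.mk _
  obtain ⟨π, hπ⟩ : ∃ π : Z.space × X.X → Q, ∀ n : X.fiberProduct Z, π n = mk n := by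
    have hx : ∀ a : Z.space × X.X, ∃ x, Z.map a.1 = X.p x := fun a =>
      (X.surjective_p (Z.map a.1)).imp fun x hx => hx.symm
    exact ⟨fun a => if h : a ∈ X.fiberProduct Z then mk ⟨a, h⟩ else
      mk ⟨(a.1, (hx a).choose), (hx a).choose_spec⟩, fun a => dif_pos a.2⟩
  have hπs : ContMDiffOn (Z.space.model.prod X.X.model) Q.model ∞ π (X.fiberProduct Z) := by
    refine contMDiffOn_of_local_extension fun a ha => ?_
    obtain ⟨G, hG, hGπ⟩ := hext ⟨a, ha⟩
    exact ⟨G, hG, eventually_nhdsWithin_of_subtype (s := ⟨a, ha⟩)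
      (hGπ.mono fun y hy => (hπ y).trans hy)⟩
  have hπsec : ∀ a ∈ X.fiberProduct Z, ∃ ζ : Q → Z.space × X.X,
      SmoothNear Q.model (Z.space.model.prod X.X.model) ζ (π a) ∧ ζ (π a) = a ∧
      ∀ᶠ b in 𝓝 (π a), ζ b ∈ X.fiberProduct Z ∧ π (ζ b) = b := by
    intro a ha
    rw [hπ ⟨a, ha⟩]
    obtain ⟨ζ, hζ, hζa, hζπ⟩ := hsec ⟨a, ha⟩
    exact ⟨ζ, hζ, hζa, hζπ.mono fun b ⟨hb, hb'⟩ => ⟨hb, (hπ ⟨_, hb⟩).trans hb'⟩⟩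
  have hπsurj : ∀ q : Q, ∃ a ∈ X.fiberProduct Z, π a = q := by
    rintro ⟨a⟩
    exact ⟨a, a.2, hπ a⟩
  have hπr : ∀ a ∈ X.fiberProduct Z, ∀ b ∈ X.fiberProduct Z, π a = π b ↔ ∃ γ : Γ.Arr,
      Γ.t γ = X.p a.2 ∧ b = (Z.action.act a.1 (Γ.inv γ), X.left.act γ a.2) := by
    intro a ha b hb
    rw [hπ ⟨a, ha⟩, hπ ⟨b, hb⟩]
    exact X.mk_eq_mk_iff Z ⟨a, ha⟩ ⟨b, hb⟩
  have hp' := X.isSubmersion_p'.contMDiff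
  let φ : Q → Γ'.Obj := Quot.lift (fun n => X.p' n.1.2) fun a b h => ((X.orbitRel_iff a b).1 h).1
  have hφ : ∀ a ∈ X.fiberProduct Z, φ (π a) = X.p' a.2 := fun a ha => by rw [hπ ⟨a, ha⟩]
  -- the class of `(z, x · γ')`
  let act : Q → Γ'.Arr → Q := fun q γ' =>
    π ((hπsurj q).choose.1, X.right.act (hπsurj q).choose.2 γ')
  have hmem : ∀ a ∈ X.fiberProduct Z, ∀ γ', X.p' a.2 = Γ'.s γ' →
      (a.1, X.right.act a.2 γ') ∈ X.fiberProduct Z := fun a ha γ' h =>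
    Eq.trans ha (X.p_right _ _ h).symm
  have hact : ∀ a ∈ X.fiberProduct Z, ∀ γ', X.p' a.2 = Γ'.s γ' →
      act (π a) γ' = π (a.1, X.right.act a.2 γ') := by
    intro a ha γ' h
    -- The chosen representative differs from `a` by an arrow of `Γ`, which commutes with `γ'`; so
    -- the class does not depend on the choice.
    obtain ⟨hb, hba⟩ := (hπsurj (π a)).choose_spec
    simp only [act]
    generalize (hπsurj (π a)).choose = b at *
    obtain ⟨γ, hγ, rfl⟩ := (hπr a ha b hb).1 hba.symm
    refine ((hπr _ (hmem a ha γ' h) _ ?_).2 ⟨γ, ?_, ?_⟩).symm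
    · refine hmem _ hb γ' ?_
      simp only
      rw [X.p'_left _ _ hγ, h]
    · exact hγ.trans (X.p_right _ _ h).symm
    · simp only
      rw [X.comm _ _ _ hγ h]
  let Z' : RightModule Γ' :=
    { space := Q
      map := φ
      contMDiff_map := by
        refine contMDiff_iff_smoothNear.2 fun q => ?_
        obtain ⟨a, ha, rfl⟩ := hπsurj q
        obtain ⟨ζ, hζ, hζa, hζπ⟩ := hπsec a ha
        refine SmoothNear.congr ((hp'.smoothNear _).comp (SmoothNear.snd.comp hζ rfl) rfl) ?_
        filter_upwards [hζπ] with b hb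
        rw [← hφ _ hb.1, hb.2]
      action :=
        { act := act
          contMDiffOn_act := by
            rintro ⟨q, γ₀⟩ hq
            obtain ⟨a, ha, rfl⟩ := hπsurj q
            obtain ⟨ζ, hζ, hζa, hζπ⟩ := hπsec a ha
            have h1 : SmoothNear (Q.model.prod Γ'.Arr.model) (Z.space.model.prod X.X.model)
                (fun b => ζ b.1) (π a, γ₀) :=
              hζ.comp (SmoothNear.fst (a := (π a, γ₀))) rfl
            have h2 : ∀ᶠ b in 𝓝[{b : Q × Γ'.Arr | φ b.1 = Γ'.s b.2}] (π a, γ₀),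
                ζ b.1 ∈ X.fiberProduct Z ∧ π (ζ b.1) = b.1 := nhdsWithin_le_nhds
              ((SmoothNear.fst (I := Q.model) (I' := Γ'.Arr.model) (a := (π a, γ₀))).pull hζπ rfl)
            have h3 : ∀ᶠ b in 𝓝[{b : Q × Γ'.Arr | φ b.1 = Γ'.s b.2}] (π a, γ₀),
                X.p' (ζ b.1).2 = Γ'.s b.2 := by
              filter_upwards [h2, self_mem_nhdsWithin] with b hb hb'
              rw [← hφ _ hb.1, hb.2]
              exact hb'
            have h4 := X.right.contMDiffOn_act.comp_contMDiffWithinAt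
              (c := fun b : Q × Γ'.Arr => ((ζ b.1).2, b.2)) hq
              (h1.contMDiffAt.snd.contMDiffWithinAt.prodMk contMDiffWithinAt_snd) h3
            have h5 := hπs.comp_contMDiffWithinAt
              (c := fun b : Q × Γ'.Arr => ((ζ b.1).1, X.right.act (ζ b.1).2 b.2)) hq
              (h1.contMDiffAt.fst.contMDiffWithinAt.prodMk h4) (by
                filter_upwards [h2, h3] with b hb hb' using hmem _ hb.1 _ hb')
            refine h5.congr_of_eventuallyEq_of_mem ?_ hq
            filter_upwards [h2, h3] with b hb hb'
            rw [← hact _ hb.1 _ hb', hb.2]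
          map_act := by
            intro q γ hq
            obtain ⟨a, ha, rfl⟩ := hπsurj q
            rw [hφ a ha] at hq
            rw [hact a ha γ hq, hφ _ (hmem a ha γ hq), X.right.map_act _ _ hq]
          act_one := by
            intro q
            obtain ⟨a, ha, rfl⟩ := hπsurj q
            rw [hφ a ha, hact a ha _ (Γ'.s_one _).symm, X.right.act_one]
          act_mul := by
            intro q γ δ hq h
            obtain ⟨a, ha, rfl⟩ := hπsurj q
            rw [hφ a ha] at hq
            rw [hact a ha _ (by rw [Γ'.s_mul _ _ h, hq]), hact a ha _ hq,
              hact _ (hmem a ha γ hq) _ (by simp only; rw [X.right.map_act _ _ hq, h]),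
              X.right.act_mul _ _ _ hq h] } }
  exact ⟨Z', (X.isInduced_iff Z Z').2 ⟨π, hπs, hπsec, hπsurj, hπr, hφ, hact⟩⟩

end LieGroupoid.MoritaEquivalence

/-! ### The correspondence of resolutions -/

theorem mainTheorem5 {𝕜 : Type v} [RCLike 𝕜] {Γ Γ' : LieGroupoid.{u, v} 𝕜}
    (X : LieGroupoid.MoritaEquivalence Γ Γ') (S : Set Γ.Obj)
    (hS : IsEmbeddedSubmanifold Γ.Obj.model S) (hstable : Γ.IsStable S) :
    -- the corresponding subset is a stable embedded submanifold
    IsEmbeddedSubmanifold Γ'.Obj.model (X.mapSet S) ∧ Γ'.IsStable (X.mapSet S) ∧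
    -- a right module is a resolution if and only if the induced module is one
    (∀ (Z : LieGroupoid.RightModule Γ) (Z' : LieGroupoid.RightModule Γ'), X.IsInduced Z Z' →
      (LieGroupoid.IsResolution S Z.map ↔ LieGroupoid.IsResolution (X.mapSet S) Z'.map)) ∧
    -- the induced correspondence of resolutions is one-to-one
    ∃ F : LieGroupoid.ResolutionClass Γ S ≃ LieGroupoid.ResolutionClass Γ' (X.mapSet S),
      (∀ (R : LieGroupoid.EquivariantResolution Γ S)
        (R' : LieGroupoid.EquivariantResolution Γ' (X.mapSet S)),
        F R.cls = R'.cls ↔ X.IsInduced R.toRightModule R'.toRightModule) ∧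
      -- it preserves and reflects surjectivity and properness
      ∀ (R : LieGroupoid.EquivariantResolution Γ S)
        (R' : LieGroupoid.EquivariantResolution Γ' (X.mapSet S)), F R.cls = R'.cls →
        (R.IsSurjective ↔ R'.IsSurjective) ∧ (R.IsProper ↔ R'.IsProper) := by
  have hS' := LieGroupoid.MoritaEquivalence.isEmbeddedSubmanifold_mapSet (X := X) hS hstable
  have hstable' := X.isStable_mapSet hstable
  have hsymm := X.symm_mapSet hstable
  refine ⟨hS', hstable', fun Z Z' h => h.isResolution_iff hstable, ?_⟩
  have hex : ∀ R : LieGroupoid.EquivariantResolution Γ S,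
      ∃ R' : LieGroupoid.EquivariantResolution Γ' (X.mapSet S),
        X.IsInduced R.toRightModule R'.toRightModule := fun R => by
    obtain ⟨Z', h⟩ := X.exists_isInduced R.toRightModule
    exact ⟨⟨Z', (h.isResolution_iff hstable).1 R.isResolution⟩, h⟩
  have hex' : ∀ R' : LieGroupoid.EquivariantResolution Γ' (X.mapSet S),
      ∃ R : LieGroupoid.EquivariantResolution Γ S,
        X.IsInduced R.toRightModule R'.toRightModule := fun R' => by
    obtain ⟨Z, h⟩ := X.symm.exists_isInduced R'.toRightModule
    have h' := LieGroupoid.MoritaEquivalence.isInduced_symm_iff.1 h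
    exact ⟨⟨Z, (h'.isResolution_iff hstable).2 R'.isResolution⟩, h'⟩
  choose f hf using hex
  have hF : ∀ R R₁ : LieGroupoid.EquivariantResolution Γ S, R ≈ R₁ → (f R).cls = (f R₁).cls :=
    fun R R₁ h => Quotient.sound ((hf R).iso ((hf R₁).of_iso_left hstable h))
  -- For the forward implication the isomorphism `f R ≈ R'` is absorbed on the input side of the
  -- opposite equivalence, where `of_iso_left` applies, and the result is turned back.
  have hiff : ∀ (R : LieGroupoid.EquivariantResolution Γ S)
      (R' : LieGroupoid.EquivariantResolution Γ' (X.mapSet S)),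
      (f R).cls = R'.cls ↔ X.IsInduced R.toRightModule R'.toRightModule := fun R R' =>
    ⟨fun h => LieGroupoid.MoritaEquivalence.isInduced_symm_iff.1
      ((hf R).symm.of_iso_left hstable' (Setoid.symm (Quotient.exact h))),
      fun h => Quotient.sound ((hf R).iso h)⟩
  refine ⟨Equiv.ofBijective (Quotient.lift (fun R => (f R).cls) hF) ⟨?_, ?_⟩, hiff, ?_⟩
  · rintro ⟨R⟩ ⟨R₁⟩ h
    -- Both `R` and `R₁` are induced from `f R₁` through the opposite equivalence, and induced
    -- modules are unique up to isomorphism.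
    exact Quotient.sound (((hiff R (f R₁)).1 h).symm.iso (hf R₁).symm)
  · rintro ⟨R'⟩
    obtain ⟨R, hR⟩ := hex' R'
    exact ⟨R.cls, (hiff R R').2 hR⟩
  · intro R R' h
    have h1 := (hiff R R').1 h
    -- Each converse is the direct statement for the opposite equivalence.
    refine ⟨⟨fun h2 => ?_, fun h2 => ?_⟩, h1.isProperMap, h1.symm.isProperMap⟩
    · unfold LieGroupoid.EquivariantResolution.IsSurjective at h2 ⊢
      rw [h1.range_map, h2, LieGroupoid.MoritaEquivalence.mapSet_closure hstable]
    · unfold LieGroupoid.EquivariantResolution.IsSurjective at h2 ⊢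
      rw [h1.symm.range_map, h2, LieGroupoid.MoritaEquivalence.mapSet_closure hstable', hsymm]
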